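/- Let $\tilde D\subset D\subset B$ be Banach spaces with $\|\cdot\|_{\tilde D}\ge\|\cdot\|_D\ge\|\cdot\|_B$ and $\tilde D$ dense in both $D$ and $B$. Let $A(x)$, $x\in\mathbb R$, be uniformly bounded and strongly continuous in $x$ both as operators in $\mathcal L(D,B)$ and in $\mathcal L(\tilde D,D)$. Suppose that each $A(x)$ generates a strongly continuous semigroup $e^{tA(x)}$ in $B$ with core $D$, which restricts to a strongly continuous semigroup in $D$ with core $\tilde D$ and to a semigroup of bounded operators in $\tilde D$, and that in each of the three spaces these operators are bounded uniformly in $x\in\mathbb R$ and $t$ from any compact segment. Let $\nu$ be a finite measure on $(0,\infty)$, with total mass $\|\nu\|$, and put $$L'_\nu f(x)=\int_0^\infty (f(x-y)-f(x))\,\nu(dy),$$ $$D^{(\nu)}_{a+}f(x)=-\int_0^{x-a}(f(x-y)-f(x))\,\nu(dy)+\int_{x-a}^\infty f(x)\,\nu(dy),$$ $$D^{(\nu)}_{a+*}f(x)=-\int_0^{x-a}(f(x-y)-f(x))\,\nu(dy)-\int_{x-a}^\infty (f(a)-f(x))\,\nu(dy).$$ Let $C_\infty(\mathbb R,B)$ be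 the Banach space of continuous functions $\mathbb R\to B$ vanishing at infinity, $C_{kill(a)}([a,\infty),B)$ its closed subspace of functions vanishing on $(-\infty,a]$, and $C_{kill(a)}([a,b],B)$ the space of continuous functions $[a,b]\to B$ vanishing at $a$ (extended by $0$ to the left of $a$). A path $Z_x$ on $[0,t]$ with jump times $0<s_1<\dots<s_n<t$ and jump sizes $z_1,\dots,z_n>0$ equals $x-z_1-\dots-z_k$ on $[s_k,s_{k+1})$ (with $s_0=0$, $s_{n+1}=t$), its final value being $Z_x(t)=x-z_1-\dots-z_n$. Let $\mathbf E_\nu$ be integration over such paths, $n=0,1,2,\dots$, with respect to the measure $e^{-t\|\nu\|}ds_1\cdots ds_n\,\nu(dz_1)\cdots\nu(dz_n)$, and let $$T\exp\Big\{\int_0^tA(Z_x(\tau))\,d\tau\Big\}=e^{s_1A(x)}e^{(s_2-s_1)A(x-z_1)}\cdots e^{(t-s_n)A(x-z_1-\cdots-z_n)}.$$ Then $L'_\nu+A(\cdot)$, defined on $C_\infty(\mathbb R,D)$, has a closure in $C_\infty(\mathbb R,B)$ which generates a strongly continuous semigroup $\Phi^{\nu,A}_t$. For all $a<b$ it restricts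 to a strongly continuous semigroup on $C_{kill(a)}([a,\infty),B)$, and this induces a strongly continuous semigroup on $C_{kill(a)}([a,b],B)$; both are again denoted $\Phi_t^{\nu,A}$. The following holds for all $M_B,m_B$ such that $\|e^{tA(x)}\|_{B\to B}\le M_Be^{tm_B}$ for all $x\in\mathbb R$, $t\ge0$. (1) For $\lambda>m_B+\|\nu\|(M_B-1)$ the resolvent $R_\lambda$ of $\Phi^{\nu,A}_t$ on $C_{kill(a)}([a,\infty),B)$ (the inverse of $\lambda$ minus the generator) is a well-defined bounded operator, and $$R_\lambda g(x)=\int_0^\infty e^{-\lambda t}\,\mathbf E_\nu\Big[T\exp\Big\{\int_0^tA(Z_x(\tau))\,d\tau\Big\}g(Z_x(t))\Big]dt,\qquad(*)$$ with absolutely convergent integrals. For every $g\in C_{kill(a)}([a,\infty),B)$ the function $\mu=R_\lambda g$ is the unique classical solution in $C_{kill(a)}([a,\infty),B)$ of $$(\lambda-A(x)+D^{(\nu)}_{a+})\mu(x)=g(x),\quad x\ge a,\qquad \mu(a)=0,$$ both in the sense that $\mu$ is in the domain of the generator of $\Phi^{\nu,A}_t$ and in the sense that for each $x$ the value $\mu(x)$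 is in the domain of the generator $A(x)$ of $e^{tA(x)}$ in $B$ and the equation holds. (2) On $C_{kill(a)}([a,b],B)$ the same holds, on $[a,b]$, for all $\lambda\ge m_B+\|\nu\|(M_B-1)$ if $\nu\ne0$, and for all $\lambda>m_B+\|\nu\|(M_B-1)$ if $\nu=0$. (3) If all $e^{tA(x)}$, $t\ge 0$, are contractions in $B$ and $\nu\neq0$, then for any $g\in C_{kill(a)}([a,b],B)$ the problem $$D^{(\nu)}_{a+*}\mu(x)=A(x)\mu(x)+g(x),\quad x\in[a,b],\qquad\mu(a)=0,$$ has a unique classical solution $\mu\in C_{kill(a)}([a,b],B)$ (in both senses of (1)), and it is given by $(*)$ with $\lambda=0$. -/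

import Mathlib

open Filter Topology MeasureTheory Set
open scoped ZeroAtInfty

/-- A strongly continuous semigroup `(T t)_{t ≥ 0}` of bounded operators on `E`
(the values of `T` at negative times are irrelevant). -/
structure IsC0Semigroup {E : Type*} [NormedAddCommGroup E] [NormedSpace ℝ E]
    (T : ℝ → E →L[ℝ] E) : Prop where
  zero : T 0 = ContinuousLinearMap.id ℝ E
  add : ∀ s t : ℝ, 0 ≤ s → 0 ≤ t → T (s + t) = (T s).comp (T t)
  cont : ∀ f : E, ContinuousOn (fun t : ℝ => T t f) (Ici 0)

/-- The graph of the infinitesimal generator of `T`: the pairs `(f, h)` such that `f` lies in the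
domain of the generator `G` and `G f = h`. -/
def genGraph {E : Type*} [NormedAddCommGroup E] [NormedSpace ℝ E]
    (T : ℝ → E →L[ℝ] E) : Set (E × E) :=
  {p | Tendsto (fun t : ℝ => t⁻¹ • (T t p.1 - p.1)) (𝓝[>] 0) (𝓝 p.2)}

/-- `R` is the resolvent operator `(lam - G)⁻¹` of the generator `G` of `T`, defined on the whole
space: `h` is in the domain of `G` with `lam • h - G h = g` exactly when `h = R g`. -/
def IsResolvent {E : Type*} [NormedAddCommGroup E] [NormedSpace ℝ E]
    (T : ℝ → E →L[ℝ] E) (lam : ℝ) (R : E →L[ℝ] E) : Prop :=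
  ∀ g h : E, (h, lam • h - g) ∈ genGraph T ↔ h = R g

/-- The operators `S x t` are bounded uniformly in `x ∈ ℝ` and in `t` from any compact segment. -/
def LocUniformlyBounded {E : Type*} [NormedAddCommGroup E] [NormedSpace ℝ E]
    (S : ℝ → ℝ → E →L[ℝ] E) : Prop :=
  ∀ r : ℝ, ∃ C : ℝ, ∀ x : ℝ, ∀ t ∈ Icc (0 : ℝ) r, ‖S x t‖ ≤ C

/-- A uniformly bounded and strongly continuous family of operators. -/
structure IsBoundedStronglyContinuous {E F : Type*}
    [NormedAddCommGroup E] [NormedSpace ℝ E] [NormedAddCommGroup F] [NormedSpace ℝ F]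
    (A : ℝ → E →L[ℝ] F) : Prop where
  bounded : ∃ C : ℝ, ∀ x : ℝ, ‖A x‖ ≤ C
  cont : ∀ v : E, Continuous (fun x : ℝ => A x v)

/-- The three spaces setting `D' ⊆ D ⊆ B` (the inclusions being `κ` and `ι`), with ordered norms
and with `D'` dense in both `D` and `B`. -/
structure ThreeSpaces {B D D' : Type*}
    [NormedAddCommGroup B] [NormedSpace ℝ B] [NormedAddCommGroup D] [NormedSpace ℝ D]
    [NormedAddCommGroup D'] [NormedSpace ℝ D']
    (ι : D →L[ℝ] B) (κ : D' →L[ℝ] D) : Prop where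
  injective_left : Function.Injective ι
  injective_right : Function.Injective κ
  norm_left : ∀ d : D, ‖ι d‖ ≤ ‖d‖
  norm_right : ∀ e : D', ‖κ e‖ ≤ ‖e‖
  dense_mid : DenseRange κ
  dense_big : DenseRange (fun e : D' => ι (κ e))

/-- The assumptions on the family `A x` and on the semigroups `S x t = exp (t A x)`.
`A' x` is `A x` as an operator `D' → D`; `SD x t` and `SD' x t` are the restrictions of `S x t`
to `D` and to `D'`. A set of vectors is a core when the generator is the closure of its
restriction to that set. -/
structure GeneratingFamily {B D D' : Type*}
    [NormedAddCommGroup B] [NormedSpace ℝ B] [NormedAddCommGroup D] [NormedSpace ℝ D]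
    [NormedAddCommGroup D'] [NormedSpace ℝ D']
    (ι : D →L[ℝ] B) (κ : D' →L[ℝ] D)
    (A : ℝ → D →L[ℝ] B) (A' : ℝ → D' →L[ℝ] D)
    (S : ℝ → ℝ → B →L[ℝ] B) (SD : ℝ → ℝ → D →L[ℝ] D) (SD' : ℝ → ℝ → D' →L[ℝ] D') :
    Prop where
  regular : IsBoundedStronglyContinuous A
  regular' : IsBoundedStronglyContinuous A'
  compat : ∀ (x : ℝ) (e : D'), ι (A' x e) = A x (κ e)
  semigroup_B : ∀ x : ℝ, IsC0Semigroup (S x)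
  bounded_B : LocUniformlyBounded S
  core_B : ∀ x : ℝ, genGraph (S x) = closure (range fun d : D => (ι d, A x d))
  restrict_D : ∀ (x t : ℝ), 0 ≤ t → ∀ d : D, ι (SD x t d) = S x t (ι d)
  semigroup_D : ∀ x : ℝ, IsC0Semigroup (SD x)
  bounded_D : LocUniformlyBounded SD
  core_D : ∀ x : ℝ, genGraph (SD x) = closure (range fun e : D' => (κ e, A' x e))
  restrict_D' : ∀ (x t : ℝ), 0 ≤ t → ∀ e : D', κ (SD' x t e) = SD x t (κ e)
  bounded_D' : LocUniformlyBounded SD'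

/-- `L'_ν f (x) = ∫ (f (x - y) - f x) ν(dy)`. -/
noncomputable def levyOp {B : Type*} [NormedAddCommGroup B] [NormedSpace ℝ B]
    (ν : Measure ℝ) (f : ℝ → B) (x : ℝ) : B :=
  ∫ y, (f (x - y) - f x) ∂ν

/-- The generalized Riemann-Liouville derivative `D^{(ν)}_{a+}`. -/
noncomputable def derivRL {B : Type*} [NormedAddCommGroup B] [NormedSpace ℝ B]
    (ν : Measure ℝ) (a : ℝ) (f : ℝ → B) (x : ℝ) : B :=
  -(∫ y in Ioc 0 (x - a), (f (x - y) - f x) ∂ν) + ∫ _y in Ioi (x - a), f x ∂ν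

/-- The generalized Caputo derivative `D^{(ν)}_{a+*}`. -/
noncomputable def derivCaputo {B : Type*} [NormedAddCommGroup B] [NormedSpace ℝ B]
    (ν : Measure ℝ) (a : ℝ) (f : ℝ → B) (x : ℝ) : B :=
  -(∫ y in Ioc 0 (x - a), (f (x - y) - f x) ∂ν) - ∫ _y in Ioi (x - a), (f a - f x) ∂ν

/-- `Φ` is generated by `L'_ν + A(·)` in `C_∞(ℝ, B)`, with core `C_∞(ℝ, D)`: its generator is the
closure of the operator `F ↦ L'_ν F + A(·) F(·)` with domain `C_∞(ℝ, D)`. -/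
def IsGeneratedByLevyPlus {B D : Type*}
    [NormedAddCommGroup B] [NormedSpace ℝ B] [NormedAddCommGroup D] [NormedSpace ℝ D]
    (ν : Measure ℝ) (ι : D →L[ℝ] B) (A : ℝ → D →L[ℝ] B)
    (Φ : ℝ → C₀(ℝ, B) →L[ℝ] C₀(ℝ, B)) : Prop :=
  genGraph Φ = closure {p : C₀(ℝ, B) × C₀(ℝ, B) | ∃ F : C₀(ℝ, D),
    (∀ x, p.1 x = ι (F x)) ∧ ∀ x, p.2 x = levyOp ν p.1 x + A x (F x)}

/-- `C_{kill(a)}([a,∞), B)`: the functions of `C_∞(ℝ, B)` vanishing to the left of `a`. -/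
def CKill (B : Type*) [NormedAddCommGroup B] [NormedSpace ℝ B] (a : ℝ) :
    Submodule ℝ C₀(ℝ, B) where
  carrier := {f | ∀ x ≤ a, f x = 0}
  zero_mem' := by intro x _; rfl
  add_mem' := by
    intro f g hf hg x hx
    simp [hf x hx, hg x hx]
  smul_mem' := by
    intro c f hf x hx
    simp [hf x hx]

/-- `C_{kill(a)}([a,b], B)`: the continuous functions on `[a,b]` vanishing at `a`. -/
def CKillIcc (B : Type*) [NormedAddCommGroup B] [NormedSpace ℝ B] (a b : ℝ) :
    Submodule ℝ C(Icc a b, B) where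
  carrier := {f | ∀ x : Icc a b, (x : ℝ) = a → f x = 0}
  zero_mem' := by intro x _; rfl
  add_mem' := by
    intro f g hf hg x hx
    simp [hf x hx, hg x hx]
  smul_mem' := by
    intro c f hf x hx
    simp [hf x hx]

/-- Extension of a function on `[a,b]` by zero. For functions vanishing at `a` this is the
continuous extension to the left of `a`; the values to the right of `b` are never used. -/
noncomputable def extendZero {B : Type*} [NormedAddCommGroup B] [NormedSpace ℝ B] {a b : ℝ}
    (f : C(Icc a b, B)) (x : ℝ) : B :=
  open Classical in if h : x ∈ Icc a b then f ⟨x, h⟩ else 0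

/-- A piecewise constant path on `[0,t]`, up to its starting point: the number `n` of jumps,
the jump times `s_1, …, s_n`, and the jump sizes `z_1, …, z_n`. -/
abbrev JumpPath : Type := Σ n : ℕ, (Fin n → ℝ) × (Fin n → ℝ)

/-- The simplex `0 < s_1 < ⋯ < s_n < t`. -/
def timeSimplex (n : ℕ) (t : ℝ) : Set (Fin n → ℝ) :=
  {s | StrictMono s ∧ ∀ i, s i ∈ Ioo 0 t}

/-- The measure `ν^{PC}` on paths: the sum over `n` of the products of Lebesgue measure on the
simplex of jump times with `n` copies of `ν` for the jump sizes. -/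
noncomputable def pcMeasure (ν : Measure ℝ) (t : ℝ) : Measure JumpPath :=
  Measure.sum fun n : ℕ =>
    Measure.map (fun p : (Fin n → ℝ) × (Fin n → ℝ) => (⟨n, p⟩ : JumpPath))
      ((volume.restrict (timeSimplex n t)).prod (Measure.pi fun _ : Fin n => ν))

/-- The normalized path measure `e^{-t‖ν‖} ν^{PC}`; `E_ν` is integration against it. -/
noncomputable def pathProb (ν : Measure ℝ) (t : ℝ) : Measure JumpPath :=
  ENNReal.ofReal (Real.exp (-t * ν.real univ)) • pcMeasure ν t

/-- The position `x - z_1 - ⋯ - z_k` of the path started at `x` after its first `k` jumps. -/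
noncomputable def pathPos (x : ℝ) (ω : JumpPath) (k : Fin (ω.1 + 1)) : ℝ :=
  x - ∑ j : Fin ω.1, if j.castSucc < k then ω.2.2 j else 0

/-- The final position `Z_x(t) = x - z_1 - ⋯ - z_n`. -/
noncomputable def pathEnd (x : ℝ) (ω : JumpPath) : ℝ := pathPos x ω (Fin.last ω.1)

/-- The times `0, s_1, …, s_n, t`. -/
noncomputable def pathTime (t : ℝ) (ω : JumpPath) : Fin (ω.1 + 2) → ℝ :=
  Fin.cons (0 : ℝ) (Fin.snoc ω.2.1 t : Fin (ω.1 + 1) → ℝ)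

/-- The backward time-ordered exponential `T exp {∫_0^t A(Z_x(τ)) dτ}` along a path, that is
`exp {s_1 A(x)} exp {(s_2 - s_1) A(x - z_1)} ⋯ exp {(t - s_n) A(x - z_1 - ⋯ - z_n)}`,
where `S x t = exp {t A(x)}`. -/
noncomputable def timeOrderedExp {B : Type*} [NormedAddCommGroup B] [NormedSpace ℝ B]
    (S : ℝ → ℝ → B →L[ℝ] B) (x t : ℝ) (ω : JumpPath) : B →L[ℝ] B :=
  (List.ofFn fun k : Fin (ω.1 + 1) =>
    S (pathPos x ω k) (pathTime t ω k.succ - pathTime t ω k.castSucc)).prod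

/-- `E_ν [T exp {∫_0^t A(Z_x(τ)) dτ} g(Z_x(t))]`. -/
noncomputable def pathExpectation {B : Type*} [NormedAddCommGroup B] [NormedSpace ℝ B]
    (ν : Measure ℝ) (S : ℝ → ℝ → B →L[ℝ] B) (g : ℝ → B) (x t : ℝ) : B :=
  ∫ ω, timeOrderedExp S x t ω (g (pathEnd x ω)) ∂(pathProb ν t)

/-- `v = ∫_0^∞ e^{-lam t} E_ν [T exp {∫_0^t A(Z_x(τ)) dτ} g(Z_x(t))] dt`, both integrals being
absolutely convergent. -/
def IsLaplacePathIntegral {B : Type*} [NormedAddCommGroup B] [NormedSpace ℝ B]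
    (ν : Measure ℝ) (S : ℝ → ℝ → B →L[ℝ] B) (lam : ℝ) (g : ℝ → B) (x : ℝ) (v : B) : Prop :=
  (∀ t : ℝ, 0 ≤ t →
    Integrable (fun ω => timeOrderedExp S x t ω (g (pathEnd x ω))) (pathProb ν t)) ∧
  IntegrableOn (fun t : ℝ => Real.exp (-lam * t) • pathExpectation ν S g x t) (Ioi 0) ∧
  v = ∫ t in Ioi (0 : ℝ), Real.exp (-lam * t) • pathExpectation ν S g x t

/-- `μ(a) = 0`, and for every `x ∈ J` the value `μ(x)` lies in the domain of the generator `A(x)`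
of `S x` and `(lam - A(x) + D^{(ν)}_{a+}) μ(x) = g(x)`. -/
def SolvesRL {B : Type*} [NormedAddCommGroup B] [NormedSpace ℝ B]
    (ν : Measure ℝ) (S : ℝ → ℝ → B →L[ℝ] B) (a lam : ℝ) (J : Set ℝ) (g μ : ℝ → B) : Prop :=
  μ a = 0 ∧ ∀ x ∈ J, (μ x, lam • μ x + derivRL ν a μ x - g x) ∈ genGraph (S x)

/-- `μ(a) = 0`, and for every `x ∈ J` the value `μ(x)` lies in the domain of the generator `A(x)`
of `S x` and `D^{(ν)}_{a+*} μ(x) = A(x) μ(x) + g(x)`. -/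
def SolvesCaputo {B : Type*} [NormedAddCommGroup B] [NormedSpace ℝ B]
    (ν : Measure ℝ) (S : ℝ → ℝ → B →L[ℝ] B) (a : ℝ) (J : Set ℝ) (g μ : ℝ → B) : Prop :=
  μ a = 0 ∧ ∀ x ∈ J, (μ x, derivCaputo ν a μ x - g x) ∈ genGraph (S x)

/-! On `C₀(ℝ, B)` the operators e^{tA(x)} act separately at each point x, while L'_ν = N - ‖ν‖, with
N f(x) = ∫ f(x - y) ν(dy), is bounded. The theorem is therefore bounded perturbation theory for the
pointwise semigroup.

Strong continuity of the pointwise semigroup requires continuity of e^{tA(x)} in x. On D this comes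
from e^{tA(x₀)} - e^{tA(x)} = ∫₀ᵗ e^{(t-s)A(x)} (A(x₀) - A(x)) e^{sA(x₀)} ds
(`RegularFamily.continuous_in_parameter`). The same argument for the pair D' ⊂ D gives a strongly
continuous semigroup on `C₀(ℝ, D)`, which makes that space a core
(`GeneratingFamily.genGraph_mult`). Comparing resolvents shows that the domain of the generator can
be tested point by point (`mem_genGraph_mult`); hence the two notions of classical solution
coincide.

Let R be the pointwise resolvent at c = λ + ‖ν‖. The equation (λ - A - L'_ν) μ = g becomes μ = R N μ
+ R g, solved by ∑ (R N)ⁿ R g. Since ‖R‖ ≤ M / (c - m) and ‖N‖ ≤ ‖ν‖, the series converges for λ > m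
+ ‖ν‖ (M - 1). On [a,b] the weight e^{θx} is available, and it replaces ‖ν‖ by ∫ e^{-θy} ν(dy),
which is strictly smaller when ν ≠ 0 and θ > 0 (`laplaceMass_lt`); this gains the endpoint, in
particular λ = 0 for contractions. All jumps go to the left, so functions vanishing to the left of a
form an invariant subspace on which D_{a+} = -L'_ν, and restriction to [a,b] is a quotient map
compatible with all operators involved.

For the path formula, conditioning on the first jump identifies the integral over paths with n jumps
with the n-th Dyson term (`RegularFamily.integral_pathProd`). Its Laplace transform at c is (R N)ⁿ R
g (`laplace_dyson`), and dominated convergence sums over n. -/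

/-! ### Semigroups, generators and resolvents -/

section SemigroupTheory

variable {E F : Type*} [NormedAddCommGroup E] [NormedSpace ℝ E]
  [NormedAddCommGroup F] [NormedSpace ℝ F]

/-- The bound `‖T t‖ ≤ M e^{t m}` for all `t ≥ 0`. -/
def HasGrowth (T : ℝ → E →L[ℝ] F) (M m : ℝ) : Prop :=
  ∀ t : ℝ, 0 ≤ t → ‖T t‖ ≤ M * Real.exp (t * m)

theorem HasGrowth.nonneg {T : ℝ → E →L[ℝ] F} {M m : ℝ} (h : HasGrowth T M m) : 0 ≤ M := by
  have := (norm_nonneg _).trans (h 0 le_rfl)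
  simpa using this

theorem HasGrowth.apply_le {T : ℝ → E →L[ℝ] F} {M m : ℝ} (h : HasGrowth T M m) {t : ℝ}
    (ht : 0 ≤ t) (f : E) : ‖T t f‖ ≤ M * Real.exp (t * m) * ‖f‖ :=
  ((T t).le_opNorm f).trans (mul_le_mul_of_nonneg_right (h t ht) (norm_nonneg f))

/-- A pointwise continuous and locally bounded family of operators is jointly continuous. -/
theorem continuous_apply_of_locally_bounded {X : Type*} [TopologicalSpace X]
    {Q : X → E →L[ℝ] F} (hb : ∀ x₀, ∃ C, ∀ᶠ x in 𝓝 x₀, ‖Q x‖ ≤ C)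
    (hc : ∀ v, Continuous fun x => Q x v) : Continuous fun p : X × E => Q p.1 p.2 := by
  rw [continuous_iff_continuousAt]
  rintro ⟨x₀, v₀⟩
  obtain ⟨C, hC⟩ := hb x₀
  have hC' : ∀ᶠ p : X × E in 𝓝 (x₀, v₀), ‖Q p.1‖ ≤ C :=
    (continuous_fst.tendsto (x₀, v₀)).eventually hC
  have h1 : Tendsto (fun p : X × E => C * ‖p.2 - v₀‖ + ‖Q p.1 v₀ - Q x₀ v₀‖) (𝓝 (x₀, v₀))
      (𝓝 0) := by
    have : Continuous fun p : X × E => C * ‖p.2 - v₀‖ + ‖Q p.1 v₀ - Q x₀ v₀‖ :=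
      (continuous_const.mul (continuous_snd.sub continuous_const).norm).add
        ((((hc v₀).comp continuous_fst).sub continuous_const).norm)
    simpa using this.tendsto (x₀, v₀)
  rw [ContinuousAt, tendsto_iff_norm_sub_tendsto_zero]
  refine squeeze_zero' (Eventually.of_forall fun _ => norm_nonneg _) ?_ h1
  filter_upwards [hC'] with p hp
  have : Q p.1 p.2 - Q x₀ v₀ = Q p.1 (p.2 - v₀) + (Q p.1 v₀ - Q x₀ v₀) := by
    rw [map_sub]; abel
  rw [this]
  refine (norm_add_le _ _).trans ?_
  gcongr
  exact ((Q p.1).le_opNorm _).trans (by gcongr)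

theorem HasGrowth.locally_bounded {T : ℝ → E →L[ℝ] F} {M m : ℝ} (h : HasGrowth T M m) (r : ℝ) :
    ∃ C, ∀ t ∈ Icc 0 r, ‖T t‖ ≤ C := by
  have h2 := h.nonneg
  refine ⟨M * Real.exp (r * |m|), fun t ht => (h t ht.1).trans ?_⟩
  refine mul_le_mul_of_nonneg_left (Real.exp_le_exp.2 ?_) h2
  exact (mul_le_mul_of_nonneg_left (le_abs_self m) ht.1).trans
    (mul_le_mul_of_nonneg_right ht.2 (abs_nonneg m))

/-- Values at negative times are junk, so orbits are continued constantly by `max t 0`. Joint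
continuity and measurability can then be stated on the whole line. -/
theorem IsC0Semigroup.continuous_clamp {T : ℝ → E →L[ℝ] E} (hT : IsC0Semigroup T) {M m : ℝ}
    (hg : HasGrowth T M m) : Continuous fun p : ℝ × E => T (max p.1 0) p.2 := by
  refine continuous_apply_of_locally_bounded (Q := fun t : ℝ => T (max t 0)) (fun t₀ => ?_)
    fun v => ?_
  · obtain ⟨C, hC⟩ := hg.locally_bounded (max (t₀ + 1) 0)
    refine ⟨C, ?_⟩
    filter_upwards [eventually_le_nhds (show t₀ < t₀ + 1 by linarith)] with t ht
    exact hC _ ⟨le_max_right _ _, max_le_max_right _ ht⟩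
  · exact (hT.cont v).comp_continuous (continuous_id.max continuous_const)
      fun t => le_max_right t 0

theorem genGraph_unique {T : ℝ → E →L[ℝ] E} {f h k : E} (h1 : (f, h) ∈ genGraph T)
    (h2 : (f, k) ∈ genGraph T) : h = k :=
  tendsto_nhds_unique (f := fun t : ℝ => t⁻¹ • (T t f - f)) h1 h2

/-- Difference quotients pass through `R`. The intertwiners used later are resolvents, point
evaluations, embeddings of dense subspaces and restriction to [a,b]. -/
theorem genGraph_map {T : ℝ → E →L[ℝ] E} {U : ℝ → F →L[ℝ] F} (R : E →L[ℝ] F)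
    (hR : ∀ t, 0 ≤ t → ∀ f, R (T t f) = U t (R f)) {f h : E} (hf : (f, h) ∈ genGraph T) :
    (R f, R h) ∈ genGraph U := by
  have h1 := (R.continuous.tendsto h).comp (show Tendsto _ _ _ from hf)
  refine Tendsto.congr' ?_ h1
  filter_upwards [self_mem_nhdsWithin] with t ht
  simp [hR t (le_of_lt ht)]

theorem exp_mul_norm_integrable {φ : ℝ → E} (hφ : Continuous φ) {C m c : ℝ} (hc : m < c)
    (hb : ∀ t, 0 < t → ‖φ t‖ ≤ C * Real.exp (t * m)) :
    IntegrableOn (fun t => Real.exp (-c * t) • φ t) (Ioi 0) ∧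
      ‖∫ t in Ioi (0 : ℝ), Real.exp (-c * t) • φ t‖ ≤ C / (c - m) := by
  have hi : IntegrableOn (fun t : ℝ => C * Real.exp ((m - c) * t)) (Ioi 0) :=
    (integrableOn_exp_mul_Ioi (by linarith) 0).const_mul C
  have hle : ∀ᵐ t ∂(volume.restrict (Ioi (0 : ℝ))),
      ‖Real.exp (-c * t) • φ t‖ ≤ C * Real.exp ((m - c) * t) := by
    filter_upwards [ae_restrict_mem measurableSet_Ioi] with t ht
    rw [norm_smul, Real.norm_of_nonneg (Real.exp_pos _).le]
    calc Real.exp (-c * t) * ‖φ t‖ ≤ Real.exp (-c * t) * (C * Real.exp (t * m)) := by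
          gcongr; exact hb t ht
      _ = C * Real.exp ((m - c) * t) := by
          rw [mul_left_comm, ← Real.exp_add]; ring_nf
  refine ⟨hi.mono' ?_ hle, (norm_integral_le_of_norm_le hi hle).trans_eq ?_⟩
  · exact ((Real.continuous_exp.comp (continuous_const.mul continuous_id)).smul
      hφ).aestronglyMeasurable
  · rw [integral_const_mul, integral_exp_mul_Ioi (by linarith)]
    simp only [mul_zero, Real.exp_zero]
    rw [mul_div_assoc', mul_neg, mul_one, ← neg_sub c m, neg_div_neg_eq]

/-- The Laplace transform of a strongly continuous semigroup is the resolvent of the generator. -/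
theorem exists_resolvent [CompleteSpace E] {T : ℝ → E →L[ℝ] E} (hT : IsC0Semigroup T) {M m : ℝ}
    (hg : HasGrowth T M m) {c : ℝ} (hc : m < c) :
    ∃ R : E →L[ℝ] E, (∀ u, IntegrableOn (fun t => Real.exp (-c * t) • T (max t 0) u) (Ioi 0) ∧
      R u = (∫ t in Ioi (0 : ℝ), Real.exp (-c * t) • T (max t 0) u) ∧
      ‖R u‖ ≤ M / (c - m) * ‖u‖) ∧
      (∀ u, (R u, c • R u - u) ∈ genGraph T) ∧ IsResolvent T c R := by
  have hcont := hT.continuous_clamp hg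
  have hφ : ∀ u, Continuous fun t : ℝ => T (max t 0) u := fun u =>
    hcont.comp (continuous_id.prodMk continuous_const)
  have hb : ∀ u, ∀ t : ℝ, 0 < t → ‖T (max t 0) u‖ ≤ (M * ‖u‖) * Real.exp (t * m) := by
    intro u t ht
    rw [max_eq_left ht.le, mul_right_comm]
    exact hg.apply_le ht.le u
  have key := fun u => exp_mul_norm_integrable (hφ u) hc (hb u)
  let R : E →L[ℝ] E := LinearMap.mkContinuous
    { toFun := fun u => ∫ t in Ioi (0 : ℝ), Real.exp (-c * t) • T (max t 0) u
      map_add' := by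
        intro u v
        rw [← integral_add (key u).1 (key v).1]
        simp
      map_smul' := by
        intro r u
        simp only [RingHom.id_apply]
        rw [← integral_smul]
        congr 1; ext t
        rw [map_smul, smul_comm] }
    (M / (c - m)) (fun u => (key u).2.trans_eq (by ring))
  have hR : ∀ u, R u = ∫ t in Ioi (0 : ℝ), Real.exp (-c * t) • T (max t 0) u := fun u => rfl
  have hcomm : ∀ t, 0 ≤ t → ∀ u, R (T t u) = T t (R u) := by
    intro t ht u
    rw [hR, hR, ← (T t).integral_comp_comm (key u).1]
    refine setIntegral_congr_fun measurableSet_Ioi fun s hs => ?_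
    simp only [map_smul]
    have h1 := hT.add (max s 0) t (le_max_right _ _) ht
    have h2 := hT.add t (max s 0) ht (le_max_right _ _)
    rw [add_comm, h1] at h2
    exact congrArg _ (DFunLike.congr_fun h2 u)
  have hgen : ∀ u, (R u, c • R u - u) ∈ genGraph T := by
    intro u
    have hce : Continuous fun t => Real.exp (-c * t) • T (max t 0) u :=
      (Real.continuous_exp.comp (continuous_const.mul continuous_id)).smul (hφ u)
    -- The substitution s ↦ s + h turns `T h (R u)` into e^{ch} times the tail of the Laplace
    -- integral, an expression differentiable at h = 0.
    have heq : ∀ h, 0 ≤ h → T h (R u) =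
        Real.exp (c * h) • (R u - ∫ s in (0 : ℝ)..h, Real.exp (-c * s) • T (max s 0) u) := by
      intro h hh
      have h3 := intervalIntegral.integral_interval_add_Ioi (key u).1
        ((key u).1.mono_set (Ioi_subset_Ioi hh))
      rw [← hR] at h3
      rw [← eq_sub_iff_add_eq'.2 h3, hR, ← (T h).integral_comp_comm (key u).1, ← integral_smul]
      have h4 := (measurePreserving_add_right (volume : Measure ℝ) h).setIntegral_preimage_emb
        (measurableEmbedding_addRight h)
        (fun s => Real.exp (c * h) • Real.exp (-c * s) • T (max s 0) u) (Ioi h)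
      rw [preimage_add_const_Ioi, sub_self] at h4
      rw [← h4]
      refine setIntegral_congr_fun measurableSet_Ioi fun s hs => ?_
      have hs' : (0 : ℝ) < s := hs
      simp only [map_smul]
      rw [smul_smul, ← Real.exp_add, max_eq_left hs'.le, max_eq_left (by linarith), add_comm s h,
        hT.add h s hh hs'.le]
      simp only [ContinuousLinearMap.comp_apply]
      congr 2; ring
    have hder : HasDerivAt (fun h => Real.exp (c * h) •
        (R u - ∫ s in (0 : ℝ)..h, Real.exp (-c * s) • T (max s 0) u)) (c • R u - u) 0 := by
      have h5 := (hce.integral_hasStrictDerivAt 0 0).hasDerivAt.const_sub (R u)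
      have h6 : HasDerivAt (fun h : ℝ => Real.exp (c * h)) c 0 := by
        simpa using ((hasDerivAt_id (0 : ℝ)).const_mul c).exp
      have h7 := h6.smul h5
      simp only [intervalIntegral.integral_same, sub_zero, mul_zero, Real.exp_zero, one_smul,
        max_self, hT.zero, ContinuousLinearMap.id_apply] at h7
      rwa [neg_add_eq_sub] at h7
    have h8 := (hasDerivAt_iff_tendsto_slope_zero.1 hder).mono_left
      (nhdsWithin_mono 0 (fun x (hx : 0 < x) => ne_of_gt hx) : 𝓝[>] (0 : ℝ) ≤ 𝓝[≠] 0)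
    refine Tendsto.congr' ?_ h8
    filter_upwards [self_mem_nhdsWithin] with t ht
    rw [heq t (le_of_lt ht)]
    simp
  refine ⟨R, fun u => ⟨(key u).1, hR u, (key u).2.trans_eq (by ring)⟩, hgen, fun g h => ⟨fun hh => ?_, ?_⟩⟩
  -- `R` commutes with the semigroup, so `R h` is in the domain with image R(ch - g); by `hgen` this
  -- image is also c R h - h. Comparison gives h = R g.
  · have h1 := genGraph_map R hcomm hh
    have h2 := genGraph_unique h1 (hgen h)
    rw [map_sub, map_smul] at h2
    exact (sub_right_inj.1 h2).symm
  · rintro rfl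
    exact hgen g

theorem IsC0Semigroup.rescale {T : ℝ → E →L[ℝ] E} (hT : IsC0Semigroup T) (w : ℝ) :
    IsC0Semigroup fun t => Real.exp (w * t) • T t where
  zero := by simp [hT.zero]
  add s t hs ht := by
    rw [hT.add s t hs ht, mul_add, Real.exp_add]
    ext f
    simp [smul_smul, mul_comm]
  cont f := by
    have h := hT.cont f
    exact (Real.continuous_exp.comp (continuous_const.mul continuous_id)).continuousOn.smul h

theorem HasGrowth.rescale {T : ℝ → E →L[ℝ] E} {M m : ℝ} (hT : HasGrowth T M m) (w : ℝ) :
    HasGrowth (fun t => Real.exp (w * t) • T t) M (m + w) := by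
  intro t ht
  rw [norm_smul, Real.norm_of_nonneg (Real.exp_pos _).le]
  calc _ ≤ Real.exp (w * t) * (M * Real.exp (t * m)) := by gcongr; exact hT t ht
    _ = _ := by rw [mul_left_comm, ← Real.exp_add]; ring_nf

end SemigroupTheory

open scoped BoundedContinuousFunction

/-! ### Bounded perturbation through the Duhamel equation -/

section Perturbation

variable {E : Type*} [NormedAddCommGroup E] [NormedSpace ℝ E]

theorem Submodule.intervalIntegral_mem [CompleteSpace E]  {Y : Submodule ℝ E} (hY : IsClosed (Y : Set E))
    {φ : ℝ → E} (hφ : Continuous φ) {a b : ℝ} (h : ∀ t, φ t ∈ Y) :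
    ∫ t in a..b, φ t ∈ Y := by
  have : CompleteSpace Y := hY.completeSpace_coe
  let ψ : ℝ → Y := fun t => ⟨φ t, h t⟩
  have hψ : Continuous ψ := hφ.subtype_mk h
  have h1 := Y.subtypeL.intervalIntegral_comp_comm (hψ.intervalIntegrable (μ := volume) a b)
  have h2 : ∫ t in a..b, φ t = Y.subtypeL (∫ t in a..b, ψ t) := h1
  rw [h2]
  exact (∫ t in a..b, ψ t).2

theorem integral_exp_neg_sub_le {δ : ℝ} (hδ : 0 < δ) (t : ℝ) :
    ∫ r in (0 : ℝ)..t, Real.exp (-δ * (t - r)) ≤ 1 / δ := by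
  have h : ∀ r ∈ uIcc 0 t, HasDerivAt (fun r => Real.exp (-δ * (t - r)) / δ)
      (Real.exp (-δ * (t - r))) r := by
    intro r _
    have h1 := ((((hasDerivAt_id r).const_sub t).const_mul (-δ)).exp).div_const δ
    refine h1.congr_deriv ?_
    simp only [id]
    field_simp
  have hc : Continuous fun r : ℝ => Real.exp (-δ * (t - r)) := by fun_prop
  rw [intervalIntegral.integral_eq_sub_of_hasDerivAt h (hc.intervalIntegrable _ _)]
  simp only [sub_self, mul_zero, Real.exp_zero, sub_zero, tsub_le_iff_right,
    le_add_iff_nonneg_right]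
  positivity

/-- The Duhamel integral `∫₀ᵗ T (t - r) (N (u r)) dr`. -/
noncomputable def duhamel (T : ℝ → E →L[ℝ] E) (N : E →L[ℝ] E) (u : ℝ → E) (t : ℝ) : E :=
  ∫ r in (0 : ℝ)..max t 0, T (max (max t 0 - r) 0) (N (u r))

variable {T : ℝ → E →L[ℝ] E} {M δ : ℝ} {N : E →L[ℝ] E}

theorem continuous_duhamel_integrand (hT : IsC0Semigroup T) (hg : HasGrowth T M δ) {u : ℝ → E}
    (hu : Continuous u) : Continuous fun p : ℝ × ℝ => T (max (p.1 - p.2) 0) (N (u p.2)) :=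
  (hT.continuous_clamp hg).comp ((continuous_fst.sub continuous_snd).prodMk
    (N.continuous.comp (hu.comp continuous_snd)))

theorem continuous_duhamel [CompleteSpace E] (hT : IsC0Semigroup T) (hg : HasGrowth T M δ) {u : ℝ → E}
    (hu : Continuous u) : Continuous (duhamel T N u) := by
  refine intervalIntegral.continuous_parametric_intervalIntegral_of_continuous
    (f := fun t r => T (max (max t 0 - r) 0) (N (u r))) ?_ (continuous_id.max continuous_const)
  exact (continuous_duhamel_integrand hT hg hu).comp
    (((continuous_fst (X := ℝ) (Y := ℝ)).max continuous_const).prodMk continuous_snd)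

/-- Exponential decay gives the kernel total mass at most M/δ over all times, so a single sup norm
on the whole time axis suffices. This is why the growth exponent is normalised to -δ. -/
theorem norm_duhamel_le (hg : HasGrowth T M (-δ)) (hδ : 0 < δ)
    {u : ℝ → E} {C : ℝ} (hC : ∀ t, ‖u t‖ ≤ C) (t : ℝ) :
    ‖duhamel T N u t‖ ≤ M * ‖N‖ / δ * C := by
  have hM := hg.nonneg
  have hC0 : 0 ≤ C := (norm_nonneg _).trans (hC 0)
  have hc : Continuous fun r : ℝ => M * ‖N‖ * C * Real.exp (-δ * (max t 0 - r)) := by fun_prop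
  refine (intervalIntegral.norm_integral_le_of_norm_le (le_max_right t 0)
    (ae_of_all _ fun r hr => ?_) (hc.intervalIntegrable _ _)).trans ?_
  · rw [max_eq_left (sub_nonneg.2 hr.2)]
    refine (hg.apply_le (sub_nonneg.2 hr.2) _).trans ?_
    calc _ ≤ M * Real.exp ((max t 0 - r) * -δ) * (‖N‖ * C) := by
          gcongr
          exact (N.le_opNorm _).trans (by gcongr; exact hC r)
      _ = _ := by ring_nf
  · rw [intervalIntegral.integral_const_mul]
    calc _ ≤ M * ‖N‖ * C * (1 / δ) := by gcongr; exact integral_exp_neg_sub_le hδ _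
      _ = _ := by ring

/-- The integral is split at r = t and the second piece is translated. The semigroup law of the
perturbed family rests on this identity. -/
theorem duhamel_shift [CompleteSpace E] (hT : IsC0Semigroup T) (hg : HasGrowth T M δ) {u : ℝ → E}
    (hu : Continuous u) {s t : ℝ} (hs : 0 ≤ s) (ht : 0 ≤ t) :
    duhamel T N u (s + t) =
      T s (duhamel T N u t) + duhamel T N (fun r => u (max r 0 + t)) s := by
  have hk := continuous_duhamel_integrand (N := N) hT hg hu
  have hk' : ∀ a, Continuous fun r => T (max (a - r) 0) (N (u r)) := fun a =>
    hk.comp (continuous_const.prodMk continuous_id)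
  unfold duhamel
  rw [max_eq_left hs, max_eq_left ht, max_eq_left (add_nonneg hs ht),
    ← intervalIntegral.integral_add_adjacent_intervals (b := t)
      ((hk' _).intervalIntegrable _ _) ((hk' _).intervalIntegrable _ _)]
  congr 1
  · rw [← (T s).intervalIntegral_comp_comm ((hk' _).intervalIntegrable _ _)]
    refine intervalIntegral.integral_congr fun r hr => ?_
    rw [uIcc_of_le ht] at hr
    have h1 : 0 ≤ t - r := sub_nonneg.2 hr.2
    rw [max_eq_left h1, max_eq_left (by linarith), add_sub_assoc, hT.add s _ hs h1]
    rfl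
  · have h2 := intervalIntegral.integral_comp_add_right (a := 0) (b := s)
      (fun r => T (max (s + t - r) 0) (N (u r))) t
    rw [zero_add] at h2
    rw [← h2]
    refine intervalIntegral.integral_congr fun r hr => ?_
    rw [uIcc_of_le hs] at hr
    simp only [max_eq_left hr.1, add_sub_add_right_eq_sub]

/-- The integrand is jointly continuous with value `N (u 0)` at the origin, so its averages over
[0,t] tend to that value. -/
theorem tendsto_duhamel [CompleteSpace E] (hT : IsC0Semigroup T) (hg : HasGrowth T M δ) {u : ℝ → E}
    (hu : Continuous u) :
    Tendsto (fun t : ℝ => t⁻¹ • duhamel T N u t) (𝓝[>] 0) (𝓝 (N (u 0))) := by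
  have hk := continuous_duhamel_integrand (N := N) hT hg hu
  have hk' : ∀ a, Continuous fun r => T (max (a - r) 0) (N (u r)) := fun a =>
    hk.comp (continuous_const.prodMk continuous_id)
  rw [Metric.tendsto_nhds]
  intro ε hε
  have h1 := hk.tendsto ((0 : ℝ), (0 : ℝ))
  simp only [sub_self, max_self, hT.zero, ContinuousLinearMap.id_apply] at h1
  obtain ⟨η, hη, h2⟩ := Metric.eventually_nhds_iff.1 (Metric.tendsto_nhds.1 h1 (ε / 2) (by linarith))
  filter_upwards [self_mem_nhdsWithin, nhdsWithin_le_nhds (eventually_lt_nhds hη)] with t ht htη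
  have ht0 : (0 : ℝ) < t := ht
  have h3 : ‖∫ r in (0 : ℝ)..t, (T (max (t - r) 0) (N (u r)) - N (u 0))‖ ≤ ε / 2 * |t - 0| := by
    refine intervalIntegral.norm_integral_le_of_norm_le_const fun r hr => ?_
    rw [uIoc_of_le ht0.le] at hr
    rw [← dist_eq_norm]
    refine (h2 (y := (t, r)) ?_).le
    simp only [Prod.dist_eq, Real.dist_eq, sub_zero]
    rw [abs_of_pos ht0, abs_of_pos hr.1]
    exact max_lt htη (hr.2.trans_lt htη)
  rw [intervalIntegral.integral_sub ((hk' _).intervalIntegrable _ _)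
    (continuous_const.intervalIntegrable _ _), intervalIntegral.integral_const, sub_zero,
    abs_of_pos ht0] at h3
  have h4 : t⁻¹ • duhamel T N u t - N (u 0) =
      t⁻¹ • ((∫ r in (0 : ℝ)..t, T (max (t - r) 0) (N (u r))) - t • N (u 0)) := by
    rw [smul_sub, smul_smul, inv_mul_cancel₀ ht0.ne', one_smul, duhamel, max_eq_left ht0.le]
  rw [dist_eq_norm, h4, norm_smul, norm_inv, Real.norm_of_nonneg ht0.le]
  calc _ ≤ t⁻¹ * (ε / 2 * t) := by gcongr
    _ = ε / 2 := by field_simp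
    _ < ε := by linarith

/-- The Duhamel operator on bounded continuous functions. -/
theorem exists_duhamelCLM [CompleteSpace E] (hT : IsC0Semigroup T) (hg : HasGrowth T M (-δ)) (hδ : 0 < δ) :
    ∃ W : (ℝ →ᵇ E) →L[ℝ] (ℝ →ᵇ E), (∀ u t, W u t = duhamel T N u t) ∧ ‖W‖ ≤ M * ‖N‖ / δ := by
  have hM := hg.nonneg
  have hk : ∀ (u : ℝ →ᵇ E) (a : ℝ), Continuous fun r => T (max (a - r) 0) (N (u r)) := fun u a =>
    (continuous_duhamel_integrand (N := N) hT hg u.continuous).comp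
      (continuous_const.prodMk continuous_id)
  refine ⟨LinearMap.mkContinuous
    { toFun := fun u => BoundedContinuousFunction.ofNormedAddCommGroup (duhamel T N u)
        (continuous_duhamel hT hg u.continuous) _ (norm_duhamel_le hg hδ u.norm_coe_le_norm)
      map_add' := fun u v => ?_
      map_smul' := fun r u => ?_ } (M * ‖N‖ / δ) fun u => ?_, fun u t => rfl,
      LinearMap.mkContinuous_norm_le _ (by positivity) _⟩
  · ext t
    simp only [BoundedContinuousFunction.coe_ofNormedAddCommGroup,
      BoundedContinuousFunction.coe_add, Pi.add_apply, duhamel, map_add]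
    rw [intervalIntegral.integral_add ((hk _ _).intervalIntegrable _ _)
      ((hk _ _).intervalIntegrable _ _)]
  · ext t
    simp [duhamel]
  · exact BoundedContinuousFunction.norm_ofNormedAddCommGroup_le _ (by positivity)
      (norm_duhamel_le hg hδ u.norm_coe_le_norm)

/-- The perturbed orbit is the fixed point of u ↦ T f + W u, where the Duhamel operator W has norm
below 1, so it is the geometric series in W. Uniqueness of the fixed point yields the semigroup law,
and a closed subspace stable under `T` and `N` contains every partial sum. -/
theorem exists_perturbation_of_stable [CompleteSpace E] (hT : IsC0Semigroup T) (hg : HasGrowth T M (-δ))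
    (hδ : 0 < δ) (hN : M * ‖N‖ < δ) :
    ∃ Φ : ℝ → E →L[ℝ] E, IsC0Semigroup Φ ∧
      (∀ f, Tendsto (fun t : ℝ => t⁻¹ • (Φ t f - T t f)) (𝓝[>] 0) (𝓝 (N f))) ∧
      ∀ Y : Submodule ℝ E, IsClosed (Y : Set E) → (∀ t, 0 ≤ t → ∀ f ∈ Y, T t f ∈ Y) →
        (∀ f ∈ Y, N f ∈ Y) → ∀ t, 0 ≤ t → ∀ f ∈ Y, Φ t f ∈ Y := by
  have hM := hg.nonneg
  obtain ⟨W, hW, hWn⟩ := exists_duhamelCLM (N := N) hT hg hδ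
  have hW1 : ‖W‖ < 1 := hWn.trans_lt ((div_lt_one hδ).2 hN)
  have hsum := summable_geometric_of_norm_lt_one hW1
  have hcl : ∀ f, Continuous fun t : ℝ => T (max t 0) f := fun f =>
    (hT.continuous_clamp hg).comp (continuous_id.prodMk continuous_const)
  have hVb : ∀ f (t : ℝ), ‖T (max t 0) f‖ ≤ M * ‖f‖ := by
    intro f t
    refine (hg.apply_le (le_max_right t 0) f).trans ?_
    have : Real.exp (max t 0 * -δ) ≤ 1 := Real.exp_le_one_iff.2
      (mul_nonpos_of_nonneg_of_nonpos (le_max_right t 0) (by linarith))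
    calc _ ≤ M * 1 * ‖f‖ := by gcongr
      _ = _ := by ring
  let V : E →L[ℝ] (ℝ →ᵇ E) := LinearMap.mkContinuous
    { toFun := fun f => BoundedContinuousFunction.ofNormedAddCommGroup
        (fun t : ℝ => T (max t 0) f) (hcl f) _ (hVb f)
      map_add' := fun f g => by ext t; simp
      map_smul' := fun r f => by ext t; simp } M
    (fun f => BoundedContinuousFunction.norm_ofNormedAddCommGroup_le _ (by positivity) (hVb f))
  have hV : ∀ f t, V f t = T (max t 0) f := fun f t => rfl
  let G : (ℝ →ᵇ E) →L[ℝ] (ℝ →ᵇ E) := ∑' n : ℕ, W ^ n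
  have hG1 : (1 - W) * G = 1 := hsum.one_sub_mul_tsum_pow
  have hG2 : G * (1 - W) = 1 := hsum.tsum_pow_mul_one_sub
  have hfix : ∀ f t, G (V f) t = T (max t 0) f + duhamel T N (G (V f)) t := by
    intro f t
    have h1 := DFunLike.congr_fun hG1 (V f)
    have h2 : G (V f) - W (G (V f)) = V f := h1
    rw [← hW, ← hV, ← sub_eq_iff_eq_add]
    exact DFunLike.congr_fun h2 t
  have huniq : ∀ f (u : ℝ →ᵇ E), (∀ t, u t = T (max t 0) f + duhamel T N u t) →
      u = G (V f) := by
    intro f u hu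
    have h1 : (1 - W) u = V f := by
      ext t
      change u t - W u t = V f t
      rw [hW, hV, sub_eq_iff_eq_add]
      exact hu t
    rw [← h1]
    exact (DFunLike.congr_fun hG2 u).symm
  have hzero : ∀ f, G (V f) 0 = f := by
    intro f
    rw [hfix]
    simp [duhamel, hT.zero]
  let Φ : ℝ → E →L[ℝ] E := fun t => (BoundedContinuousFunction.evalCLM ℝ t).comp (G.comp V)
  have hΦ : ∀ t f, Φ t f = G (V f) t := fun t f => rfl
  refine ⟨Φ, ⟨?_, ?_, ?_⟩, ?_, ?_⟩
  · ext f
    exact hzero f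
  · intro s t hs ht
    ext f
    change G (V f) (s + t) = G (V (G (V f) t)) s
    -- The orbit of f shifted by t solves the fixed point equation with initial value Φ t f.
    let u : ℝ →ᵇ E := (G (V f)).compContinuous
      ⟨fun r : ℝ => max r 0 + t, (continuous_id.max continuous_const).add continuous_const⟩
    have hu : ∀ r, u r = G (V f) (max r 0 + t) := fun r => rfl
    have h1 : u = G (V (G (V f) t)) := by
      refine huniq _ u fun r => ?_
      have h3 := duhamel_shift (N := N) hT hg (G (V f)).continuous (le_max_right r 0) ht
      have h4 : duhamel T N (fun r => G (V f) (max r 0 + t)) (max r 0) = duhamel T N u r := by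
        simp only [duhamel, max_eq_left (le_max_right r (0 : ℝ))]
        rfl
      rw [hu, hfix, h3, h4, hfix f t, map_add, max_eq_left ht,
        max_eq_left (add_nonneg (le_max_right r 0) ht), hT.add _ _ (le_max_right r 0) ht]
      simp only [ContinuousLinearMap.comp_apply]
      abel
    rw [← h1, hu, max_eq_left hs]
  · intro f
    exact (G (V f)).continuous.continuousOn
  · intro f
    have h1 := tendsto_duhamel (N := N) hT hg (G (V f)).continuous
    rw [hzero] at h1
    refine Tendsto.congr' ?_ h1
    filter_upwards [self_mem_nhdsWithin] with t ht
    rw [hΦ, hfix, max_eq_left (le_of_lt ht), add_sub_cancel_left]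
  · intro Y hY hTY hNY t _ f hf
    have h1 : ∀ n : ℕ, ∀ r, (W ^ n) (V f) r ∈ Y := by
      intro n
      induction n with
      | zero => exact fun r => hTY _ (le_max_right r 0) f hf
      | succ n ih =>
        intro r
        rw [pow_succ', mul_apply_eq_comp, hW]
        refine Submodule.intervalIntegral_mem hY ?_ fun q => ?_
        · exact (continuous_duhamel_integrand (N := N) hT hg
            ((W ^ n) (V f)).continuous).comp (continuous_const.prodMk continuous_id)
        · exact hTY _ (le_max_right _ _) _ (hNY _ (ih q))
    have h2 : HasSum (fun n : ℕ => (W ^ n) (V f) t) (G (V f) t) :=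
      hsum.hasSum.mapL ((BoundedContinuousFunction.evalCLM ℝ t).comp
        (ContinuousLinearMap.apply ℝ (ℝ →ᵇ E) (V f)))
    exact hY.mem_of_tendsto h2 (Eventually.of_forall fun s => Y.sum_mem fun n _ => h1 n t)

/-- The bounded perturbation theorem, in the form of the first order expansion of the perturbed
semigroup. -/
theorem exists_perturbation [CompleteSpace E] {m : ℝ} (hT : IsC0Semigroup T) (hg : HasGrowth T M m)
    (N : E →L[ℝ] E) :
    ∃ Φ : ℝ → E →L[ℝ] E, IsC0Semigroup Φ ∧
      (∀ f, Tendsto (fun t : ℝ => t⁻¹ • (Φ t f - T t f)) (𝓝[>] 0) (𝓝 (N f))) ∧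
      ∀ Y : Submodule ℝ E, IsClosed (Y : Set E) → (∀ t, 0 ≤ t → ∀ f ∈ Y, T t f ∈ Y) →
        (∀ f ∈ Y, N f ∈ Y) → ∀ t, 0 ≤ t → ∀ f ∈ Y, Φ t f ∈ Y := by
  have hM := hg.nonneg
  -- This δ exceeds M‖N‖ by one, and the rescaling by e^{-wt} turns the growth exponent m into -δ.
  set δ : ℝ := M * ‖N‖ + 1 with hδ
  set w : ℝ := m + δ with hw
  have hg' : HasGrowth (fun t => Real.exp (-w * t) • T t) M (-δ) := by
    have := hg.rescale (-w)
    rwa [show m + -w = -δ by rw [hw]; ring] at this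
  obtain ⟨Ψ, hΨ, hd, hinv⟩ := exists_perturbation_of_stable (N := N) (hT.rescale (-w)) hg'
    (by positivity) (by linarith)
  refine ⟨fun t => Real.exp (w * t) • Ψ t, hΨ.rescale w, fun f => ?_, ?_⟩
  · have h3 : Tendsto (fun t : ℝ => Real.exp (w * t)) (𝓝[>] 0) (𝓝 1) := by
      have : Continuous fun t : ℝ => Real.exp (w * t) := by fun_prop
      simpa using (this.tendsto 0).mono_left (nhdsWithin_le_nhds (s := Ioi (0 : ℝ)))
    have h4 := h3.smul (hd f)
    rw [one_smul] at h4
    refine h4.congr fun t => ?_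
    rw [smul_apply, smul_apply, smul_comm, smul_sub, smul_smul _ _ (T t f), ← Real.exp_add]
    simp
  · intro Y hY hTY hNY t ht f hf
    exact Y.smul_mem _ (hinv Y hY (fun t ht f hf => Y.smul_mem _ (hTY t ht f hf)) hNY t ht f hf)

/-- A bounded perturbation changes the generator by the perturbing operator. -/
theorem mem_genGraph_perturbation {T Φ : ℝ → E →L[ℝ] E} {f g : E}
    (hd : Tendsto (fun t : ℝ => t⁻¹ • (Φ t f - T t f)) (𝓝[>] 0) (𝓝 g)) (h : E) :
    (f, h) ∈ genGraph Φ ↔ (f, h - g) ∈ genGraph T := by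
  constructor
  · intro hh
    refine ((show Tendsto (fun t : ℝ => t⁻¹ • (Φ t f - f)) _ _ from hh).sub hd).congr fun t => ?_
    rw [← smul_sub]
    congr 1
    abel
  · intro hh
    have h1 := (show Tendsto (fun t : ℝ => t⁻¹ • (T t f - f)) _ (𝓝 (h - g)) from hh).add hd
    rw [sub_add_cancel] at h1
    refine h1.congr fun t => ?_
    rw [← smul_add]
    congr 1
    abel

end Perturbation

/-! ### Joint continuity of e^{tA(x)} in time and parameter -/

section Regularity

variable {E F : Type*} [NormedAddCommGroup E] [NormedSpace ℝ E]
  [NormedAddCommGroup F] [NormedSpace ℝ F]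

theorem continuous_apply_of_denseRange {X G : Type*} [TopologicalSpace X] {Q : X → E →L[ℝ] F}
    (hb : ∀ x₀, ∃ C, ∀ᶠ x in 𝓝 x₀, ‖Q x‖ ≤ C) {j : G → E} (hj : DenseRange j)
    (hc : ∀ g, Continuous fun x => Q x (j g)) (v : E) : Continuous fun x => Q x v := by
  rw [continuous_iff_continuousAt]
  intro x₀
  obtain ⟨C, hC⟩ := hb x₀
  have hC0 : 0 ≤ C := (norm_nonneg _).trans hC.self_of_nhds
  rw [ContinuousAt, Metric.tendsto_nhds]
  intro ε hε
  obtain ⟨g, hg⟩ := Metric.denseRange_iff.1 hj v (ε / (3 * (C + 1))) (by positivity)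
  have hg' : C * ‖v - j g‖ < ε / 3 := by
    rw [dist_eq_norm] at hg
    calc C * ‖v - j g‖ ≤ (C + 1) * ‖v - j g‖ := by gcongr; linarith
      _ < (C + 1) * (ε / (3 * (C + 1))) := by gcongr
      _ = ε / 3 := by field_simp
  filter_upwards [hC, Metric.tendsto_nhds.1 ((hc g).tendsto x₀) (ε / 3) (by linarith)] with x h1 h2
  rw [dist_eq_norm] at h2 ⊢
  have h3 : ‖Q x (v - j g)‖ < ε / 3 :=
    (((Q x).le_opNorm _).trans (by gcongr)).trans_lt hg'
  have h4 : ‖Q x₀ (v - j g)‖ < ε / 3 :=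
    (((Q x₀).le_opNorm _).trans (by gcongr; exact hC.self_of_nhds)).trans_lt hg'
  have h5 : Q x v - Q x₀ v = Q x (v - j g) + (Q x (j g) - Q x₀ (j g)) - Q x₀ (v - j g) := by
    rw [map_sub, map_sub]; abel
  rw [h5]
  calc _ ≤ ‖Q x (v - j g)‖ + ‖Q x (j g) - Q x₀ (j g)‖ + ‖Q x₀ (v - j g)‖ :=
        (norm_sub_le _ _).trans (by gcongr; exact norm_add_le _ _)
    _ < ε := by linarith

theorem hasDerivWithinAt_Ioi_of_tendsto {φ : ℝ → F} {s : ℝ} {d : F}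
    (h : Tendsto (fun t : ℝ => t⁻¹ • (φ (s + t) - φ s)) (𝓝[>] 0) (𝓝 d)) :
    HasDerivWithinAt φ d (Ioi s) s := by
  rw [hasDerivWithinAt_iff_tendsto_slope' (by simp)]
  have h1 : Tendsto (fun y => y - s) (𝓝[>] s) (𝓝[>] 0) := by
    refine tendsto_nhdsWithin_iff.2 ⟨?_, ?_⟩
    · have : Continuous fun y : ℝ => y - s := continuous_id.sub continuous_const
      simpa using (this.tendsto s).mono_left (nhdsWithin_le_nhds (s := Ioi s))
    · filter_upwards [self_mem_nhdsWithin] with y hy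
      exact mem_Ioi.2 (sub_pos.2 (mem_Ioi.1 hy))
  refine (h.comp h1).congr fun y => ?_
  simp [slope_def_module]

/-- The bound C on [0,1] is iterated ⌊t⌋ times, giving C · C^⌊t⌋ ≤ C · e^{t log C}. Both constants
are uniform in x because C is. -/
theorem exists_growth {T : ℝ → ℝ → E →L[ℝ] E} (hT : ∀ x, IsC0Semigroup (T x))
    (hb : LocUniformlyBounded T) : ∃ M m, ∀ x, HasGrowth (T x) M m := by
  obtain ⟨C₀, hC₀⟩ := hb 1
  -- C ≥ 1 is needed for C^⌊t⌋ ≤ C^t.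
  set C := max C₀ 1 with hCdef
  have hC : ∀ x, ∀ t ∈ Icc (0 : ℝ) 1, ‖T x t‖ ≤ C := fun x t ht =>
    (hC₀ x t ht).trans (le_max_left _ _)
  have hC1 : 1 ≤ C := le_max_right _ _
  have hCpos : 0 < C := by linarith
  have key : ∀ (n : ℕ) x t, t ∈ Icc (0 : ℝ) 1 → ‖T x (n + t)‖ ≤ C ^ n * C := by
    intro n
    induction n with
    | zero => intro x t ht; simpa using hC x t ht
    | succ n ih =>
      intro x t ht
      have h1 := (hT x).add 1 (n + t) zero_le_one (add_nonneg n.cast_nonneg ht.1)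
      rw [show (1 : ℝ) + (n + t) = (n + 1 : ℕ) + t by push_cast; ring] at h1
      rw [h1]
      refine (ContinuousLinearMap.opNorm_comp_le _ _).trans ?_
      calc _ ≤ C * (C ^ n * C) := by
            gcongr
            · exact hC x 1 ⟨zero_le_one, le_rfl⟩
            · exact ih x t ht
        _ = _ := by ring
  refine ⟨C, Real.log C, fun x t ht => ?_⟩
  have h2 := key ⌊t⌋₊ x (t - ⌊t⌋₊)
    ⟨sub_nonneg.2 (Nat.floor_le ht), by linarith [(Nat.lt_floor_add_one t).le]⟩
  rw [add_sub_cancel] at h2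
  refine h2.trans ?_
  rw [mul_comm]
  gcongr
  rw [mul_comm, ← Real.rpow_def_of_pos hCpos, ← Real.rpow_natCast]
  exact Real.rpow_le_rpow_of_exponent_le hC1 (Nat.floor_le ht)

/-- A family of semigroups `T x` whose generators are given on the dense invariant subspace `E`
by the bounded strongly continuous family `A x`. -/
structure RegularFamily (j : E →L[ℝ] F) (A : ℝ → E →L[ℝ] F) (T : ℝ → ℝ → F →L[ℝ] F)
    (U : ℝ → ℝ → E →L[ℝ] E) : Prop where
  dense : DenseRange j
  regular : IsBoundedStronglyContinuous A
  semigroup : ∀ x, IsC0Semigroup (T x)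
  bounded : LocUniformlyBounded T
  gen : ∀ x e, (j e, A x e) ∈ genGraph (T x)
  restrict : ∀ x t, 0 ≤ t → ∀ e, j (U x t e) = T x t (j e)
  bounded' : LocUniformlyBounded U

namespace RegularFamily

variable {j : E →L[ℝ] F} {A : ℝ → E →L[ℝ] F} {T : ℝ → ℝ → F →L[ℝ] F}
  {U : ℝ → ℝ → E →L[ℝ] E}

/-- The orbit of one semigroup starting in E stays in E, where the generators of all the others are
known. This allows two parameters x₀ and x to be compared. -/
theorem tendsto_orbit (h : RegularFamily j A T U) (x₀ x : ℝ) {s : ℝ} (hs : 0 ≤ s) (e : E) :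
    Tendsto (fun r : ℝ => r⁻¹ • (T x r (T x₀ s (j e)) - T x₀ s (j e))) (𝓝[>] 0)
      (𝓝 (A x (U x₀ s e))) := by
  rw [← h.restrict x₀ s hs e]
  exact h.gen x (U x₀ s e)

/-- No continuity of s ↦ U x₀ s e in E is assumed, but the function is a pointwise limit of
difference quotients that are continuous in s with values in F. -/
theorem stronglyMeasurable_orbit (h : RegularFamily j A T U) (x₀ x : ℝ) (e : E) :
    StronglyMeasurable fun s : ℝ => A x (U x₀ (max s 0) e) := by
  obtain ⟨M, m, hg⟩ := exists_growth h.semigroup h.bounded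
  have h1 : Tendsto (fun n : ℕ => (1 : ℝ) / ((n : ℝ) + 1)) atTop (𝓝[>] 0) :=
    tendsto_nhdsWithin_iff.2 ⟨tendsto_one_div_add_atTop_nhds_zero_nat,
      Eventually.of_forall fun n => by simp only [mem_Ioi]; positivity⟩
  have hc : Continuous fun s : ℝ => T x₀ (max s 0) (j e) :=
    ((h.semigroup x₀).continuous_clamp (hg x₀)).comp (continuous_id.prodMk continuous_const)
  refine stronglyMeasurable_of_tendsto atTop (f := fun (n : ℕ) (s : ℝ) =>
    ((1 : ℝ) / ((n : ℝ) + 1))⁻¹ • (T x ((1 : ℝ) / ((n : ℝ) + 1)) (T x₀ (max s 0) (j e)) -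
      T x₀ (max s 0) (j e))) (fun n => ?_) ?_
  · exact ((((T x _).continuous.comp hc).sub hc).const_smul _).stronglyMeasurable
  · rw [tendsto_pi_nhds]
    intro s
    exact (h.tendsto_orbit x₀ x (le_max_right s 0) e).comp h1

/-- The right derivative of the orbit of `j e` is `T x t (A x e)`, bounded uniformly in x. The
resulting Lipschitz constant does not depend on x, as the sup norm over x will require. -/
theorem norm_sub_le (h : RegularFamily j A T U) (r : ℝ) :
    ∃ C, ∀ x, ∀ s ∈ Icc (0 : ℝ) r, ∀ t ∈ Icc (0 : ℝ) r, ∀ e,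
      ‖T x t (j e) - T x s (j e)‖ ≤ C * ‖e‖ * |t - s| := by
  obtain ⟨C, hC⟩ := h.bounded r
  obtain ⟨CA, hCA⟩ := h.regular.bounded
  refine ⟨C * CA, fun x => ?_⟩
  have main : ∀ s ∈ Icc (0 : ℝ) r, ∀ t ∈ Icc (0 : ℝ) r, s ≤ t → ∀ e,
      ‖T x t (j e) - T x s (j e)‖ ≤ C * CA * ‖e‖ * |t - s| := by
    intro s hs t ht hst e
    rw [abs_of_nonneg (sub_nonneg.2 hst)]
    refine norm_image_sub_le_of_norm_deriv_right_le_segment (f := fun t => T x t (j e))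
      (f' := fun t => T x t (A x e))
      (((h.semigroup x).cont (j e)).mono fun y hy => hs.1.trans hy.1) (fun y hy => ?_)
      (fun y hy => ?_) t ⟨hst, le_rfl⟩
    · have hy0 : 0 ≤ y := hs.1.trans hy.1
      refine (hasDerivWithinAt_Ioi_of_tendsto ?_).Ici_of_Ioi
      refine (((T x y).continuous.tendsto _).comp (show Tendsto _ _ _ from h.gen x e)).congr' ?_
      filter_upwards [self_mem_nhdsWithin] with r hr
      rw [(h.semigroup x).add y r hy0 (le_of_lt hr)]
      simp
    · have h1 := hC x y ⟨hs.1.trans hy.1, hy.2.le.trans ht.2⟩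
      rw [mul_assoc]
      refine ((T x y).le_opNorm _).trans (mul_le_mul h1 ?_ (norm_nonneg _)
        ((norm_nonneg _).trans h1))
      exact ((A x).le_opNorm e).trans (by gcongr; exact hCA x)
  intro s hs t ht e
  rcases le_total s t with hst | hst
  · exact main s hs t ht hst e
  · rw [norm_sub_rev, abs_sub_comm]
    exact main t ht s hs hst e

/-- The path s ↦ T x (t - s) (T x₀ s (j e)) joins T x t to T x₀ t and has right derivative T x (t -
s) applied to (A x₀ - A x)(U x₀ s e). Strong continuity of `A` and dominated convergence let the
integral of its norm tend to 0 as x → x₀. -/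
theorem continuous_in_parameter (h : RegularFamily j A T U) [CompleteSpace F] {t : ℝ} (ht : 0 ≤ t)
    (e : E) : Continuous fun x => T x t (j e) := by
  obtain ⟨M, m, hg⟩ := exists_growth h.semigroup h.bounded
  obtain ⟨C, hC⟩ := h.bounded t
  obtain ⟨CA, hCA⟩ := h.regular.bounded
  obtain ⟨CU, hCU⟩ := h.bounded' t
  have hC0 : 0 ≤ C := (norm_nonneg _).trans (hC 0 0 ⟨le_rfl, ht⟩)
  have hCA0 : 0 ≤ CA := (norm_nonneg _).trans (hCA 0)
  rw [continuous_iff_continuousAt]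
  intro x₀
  set q : ℝ → ℝ → F := fun x s => A x (U x₀ (max s 0) e) with hq
  have hqm : ∀ x, StronglyMeasurable (q x) := fun x => h.stronglyMeasurable_orbit x₀ x e
  have hqb : ∀ x, ∀ s ∈ Icc 0 t, ‖q x s‖ ≤ CA * (CU * ‖e‖) := by
    intro x s hs
    refine ((A x).le_opNorm _).trans (mul_le_mul (hCA x) ?_ (norm_nonneg _) hCA0)
    rw [max_eq_left hs.1]
    exact ((U x₀ s).le_opNorm e).trans (by gcongr; exact hCU x₀ s hs)
  have hcl := fun x => (h.semigroup x).continuous_clamp (hg x)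
  have hdiff : ∀ x, ‖T x₀ t (j e) - T x t (j e)‖ ≤ ∫ s in (0 : ℝ)..t, C * ‖q x₀ s - q x s‖ := by
    intro x
    have hm : StronglyMeasurable fun s => T x (max (t - s) 0) (q x₀ s - q x s) :=
      (hcl x).comp_stronglyMeasurable ((continuous_const.sub
        continuous_id).stronglyMeasurable.prodMk ((hqm x₀).sub (hqm x)))
    have hle : ∀ s ∈ Icc 0 t, ‖T x (max (t - s) 0) (q x₀ s - q x s)‖ ≤ C * ‖q x₀ s - q x s‖ := by
      intro s hs
      refine ((T x _).le_opNorm _).trans ?_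
      gcongr
      exact hC x _ ⟨le_max_right _ _, max_le (by linarith [hs.1]) ht⟩
    have hi : IntervalIntegrable (fun s => C * ‖q x₀ s - q x s‖) volume 0 t := by
      rw [intervalIntegrable_iff_integrableOn_Ioc_of_le ht]
      refine Integrable.mono' (g := fun _ => C * (CA * (CU * ‖e‖) + CA * (CU * ‖e‖)))
        (integrable_const _)
        (((hqm x₀).sub (hqm x)).norm.const_mul C).aestronglyMeasurable ?_
      filter_upwards [ae_restrict_mem measurableSet_Ioc] with s hs
      have hs' : s ∈ Icc 0 t := ⟨hs.1.le, hs.2⟩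
      rw [Real.norm_of_nonneg (by positivity)]
      gcongr
      exact (_root_.norm_sub_le _ _).trans (add_le_add (hqb _ s hs') (hqb _ s hs'))
    have hi2 : IntervalIntegrable (fun s => T x (max (t - s) 0) (q x₀ s - q x s)) volume 0 t := by
      refine hi.mono_fun hm.aestronglyMeasurable ?_
      rw [uIoc_of_le ht]
      filter_upwards [ae_restrict_mem measurableSet_Ioc] with s hs
      exact (hle s ⟨hs.1.le, hs.2⟩).trans (le_abs_self _)
    -- Only one-sided derivatives are available from the generators, so the version of the
    -- fundamental theorem with right derivatives is used.
    have hftc := intervalIntegral.integral_eq_sub_of_hasDeriv_right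
      (f := fun s => T x (max (t - s) 0) (T x₀ (max s 0) (j e)))
      (f' := fun s => T x (max (t - s) 0) (q x₀ s - q x s)) (a := 0) (b := t)
      ((hcl x).comp ((continuous_const.sub continuous_id).prodMk ((hcl x₀).comp
        (continuous_id.prodMk continuous_const)))).continuousOn (fun s hs => ?_) hi2
    · simp only [sub_self, max_self, sub_zero, max_eq_left ht, (h.semigroup _).zero,
        ContinuousLinearMap.id_apply] at hftc
      rw [← hftc]
      exact intervalIntegral.norm_integral_le_of_norm_le ht
        (ae_of_all _ fun s hs => hle s ⟨hs.1.le, hs.2⟩) hi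
    · rw [min_eq_left ht, max_eq_right ht] at hs
      refine hasDerivWithinAt_Ioi_of_tendsto ?_
      have h1 := (h.tendsto_orbit x₀ x₀ hs.1.le e).sub (h.tendsto_orbit x₀ x hs.1.le e)
      have h2 : Tendsto (fun r : ℝ => (t - (s + r), r⁻¹ • (T x₀ r (T x₀ s (j e)) - T x₀ s (j e)) -
          r⁻¹ • (T x r (T x₀ s (j e)) - T x₀ s (j e)))) (𝓝[>] 0)
          (𝓝 (t - s, q x₀ s - q x s)) := by
        simp only [hq, max_eq_left hs.1.le]
        refine Tendsto.prodMk_nhds ?_ h1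
        have : Continuous fun r : ℝ => t - (s + r) := by fun_prop
        simpa using (this.tendsto 0).mono_left (nhdsWithin_le_nhds (s := Ioi (0 : ℝ)))
      refine (((hcl x).tendsto (t - s, q x₀ s - q x s)).comp h2).congr' ?_
      filter_upwards [self_mem_nhdsWithin, nhdsWithin_le_nhds
        (eventually_lt_nhds (sub_pos.2 hs.2))] with r hr hrt
      have hr0 : (0 : ℝ) < r := hr
      have h3 : 0 ≤ t - (s + r) := by linarith
      simp only [Function.comp_apply]
      rw [max_eq_left h3, max_eq_left hs.1.le, max_eq_left (sub_nonneg.2 hs.2.le),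
        max_eq_left (add_nonneg hs.1.le hr0.le), add_comm s r, (h.semigroup x₀).add r s hr0.le hs.1.le,
        show t - s = (t - (r + s)) + r by ring,
        (h.semigroup x).add _ r (by linarith) hr0.le, ← smul_sub, map_smul]
      simp only [ContinuousLinearMap.comp_apply, map_sub]
      congr 1
      abel
  have hlim : Tendsto (fun x => ∫ s in (0 : ℝ)..t, C * ‖q x₀ s - q x s‖) (𝓝 x₀) (𝓝 0) := by
    suffices hs : Tendsto (fun x => ∫ s in (0 : ℝ)..t, C * ‖q x₀ s - q x s‖) (𝓝 x₀)
        (𝓝 (∫ s in (0 : ℝ)..t, (0 : ℝ))) by simpa using hs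
    refine intervalIntegral.tendsto_integral_filter_of_dominated_convergence
      (fun _ => C * (CA * (CU * ‖e‖) + CA * (CU * ‖e‖))) (Eventually.of_forall fun x =>
        (((hqm x₀).sub (hqm x)).norm.const_mul C).aestronglyMeasurable)
      (Eventually.of_forall fun x => ae_of_all _ fun s hs => ?_)
      (continuous_const.intervalIntegrable _ _) (ae_of_all _ fun s _ => ?_)
    · rw [uIoc_of_le ht] at hs
      have hs' : s ∈ Icc 0 t := ⟨hs.1.le, hs.2⟩
      rw [Real.norm_of_nonneg (by positivity)]
      gcongr
      exact (_root_.norm_sub_le _ _).trans (add_le_add (hqb _ s hs') (hqb _ s hs'))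
    · have h1 := (h.regular.cont (U x₀ (max s 0) e)).tendsto x₀
      have h2 := ((tendsto_const_nhds (x := q x₀ s)).sub h1).norm.const_mul C
      simpa [hq] using h2
  rw [ContinuousAt, tendsto_iff_norm_sub_tendsto_zero]
  refine squeeze_zero (fun _ => norm_nonneg _) (fun x => ?_) hlim
  rw [norm_sub_rev]
  exact hdiff x

theorem locally_bounded_clamp (h : RegularFamily j A T U) (p₀ : ℝ × ℝ) :
    ∃ C, ∀ᶠ p in 𝓝 p₀, ‖T p.1 (max p.2 0)‖ ≤ C := by
  obtain ⟨C, hC⟩ := h.bounded (max (p₀.2 + 1) 0)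
  refine ⟨C, ?_⟩
  filter_upwards [(continuous_snd.tendsto p₀).eventually
    (eventually_le_nhds (show p₀.2 < p₀.2 + 1 by linarith))] with p hp
  exact hC _ _ ⟨le_max_right _ _, max_le_max_right _ hp⟩

/-- On the dense range of `j` the uniform Lipschitz bound in time combines with continuity in the
parameter; local boundedness extends this to all vectors. -/
theorem continuous_clamp (h : RegularFamily j A T U) [CompleteSpace F] :
    Continuous fun p : (ℝ × ℝ) × F => T p.1.1 (max p.1.2 0) p.2 := by
  refine continuous_apply_of_locally_bounded (Q := fun p : ℝ × ℝ => T p.1 (max p.2 0))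
    h.locally_bounded_clamp (continuous_apply_of_denseRange h.locally_bounded_clamp h.dense ?_)
  intro e
  rw [continuous_iff_continuousAt]
  rintro ⟨x₀, t₀⟩
  obtain ⟨C, hC⟩ := h.norm_sub_le (max (t₀ + 1) 0)
  rw [ContinuousAt, tendsto_iff_norm_sub_tendsto_zero]
  have h1 : Tendsto (fun p : ℝ × ℝ => C * ‖e‖ * |max p.2 0 - max t₀ 0| +
      ‖T p.1 (max t₀ 0) (j e) - T x₀ (max t₀ 0) (j e)‖) (𝓝 (x₀, t₀)) (𝓝 0) := by
    have h2 := h.continuous_in_parameter (le_max_right t₀ 0) e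
    have h3 : Continuous fun p : ℝ × ℝ => C * ‖e‖ * |max p.2 0 - max t₀ 0| +
      ‖T p.1 (max t₀ 0) (j e) - T x₀ (max t₀ 0) (j e)‖ :=
      (continuous_const.mul ((continuous_snd.max continuous_const).sub continuous_const).abs).add
        (((h2.comp continuous_fst).sub continuous_const).norm)
    simpa using h3.tendsto (x₀, t₀)
  refine squeeze_zero' (Eventually.of_forall fun _ => norm_nonneg _) ?_ h1
  filter_upwards [(continuous_snd.tendsto (x₀, t₀)).eventually
    (eventually_le_nhds (show t₀ < t₀ + 1 by linarith))] with p hp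
  rw [← sub_add_sub_cancel _ (T p.1 (max t₀ 0) (j e))]
  refine (norm_add_le _ _).trans ?_
  gcongr
  exact hC p.1 _ ⟨le_max_right _ _, max_le_max_right _ (by linarith)⟩ _
    ⟨le_max_right _ _, max_le_max_right _ hp⟩ e

end RegularFamily

end Regularity

/-! ### The pointwise semigroup on functions vanishing at infinity -/

section FunctionSpace

variable {E F G : Type*} [NormedAddCommGroup E] [NormedSpace ℝ E]
  [NormedAddCommGroup F] [NormedSpace ℝ F] [NormedAddCommGroup G] [NormedSpace ℝ G]

namespace ZeroAtInftyContinuousMap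

omit [NormedSpace ℝ E] in
theorem norm_apply_le (f : C₀(ℝ, E)) (x : ℝ) : ‖f x‖ ≤ ‖f‖ :=
  (BoundedContinuousFunction.norm_coe_le_norm f.toBCF x)

omit [NormedSpace ℝ E] in
theorem norm_le_of_forall {f : C₀(ℝ, E)} {C : ℝ} (hC : 0 ≤ C) (h : ∀ x, ‖f x‖ ≤ C) : ‖f‖ ≤ C :=
  (BoundedContinuousFunction.norm_le (f := f.toBCF) hC).2 h

/-- Evaluation at a point as a continuous linear map. -/
noncomputable def evalCLM (E : Type*) [NormedAddCommGroup E] [NormedSpace ℝ E] (x : ℝ) :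
    C₀(ℝ, E) →L[ℝ] E :=
  LinearMap.mkContinuous
    { toFun := fun f => f x, map_add' := fun _ _ => rfl, map_smul' := fun _ _ => rfl } 1
    fun f => by simpa using f.norm_apply_le x

@[simp] theorem evalCLM_apply (x : ℝ) (f : C₀(ℝ, E)) : evalCLM E x f = f x := rfl

end ZeroAtInftyContinuousMap

open ZeroAtInftyContinuousMap

theorem IsBoundedStronglyContinuous.continuous_apply {P : ℝ → E →L[ℝ] F}
    (hP : IsBoundedStronglyContinuous P) : Continuous fun p : ℝ × E => P p.1 p.2 := by
  obtain ⟨C, hC⟩ := hP.bounded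
  exact continuous_apply_of_locally_bounded (fun _ => ⟨C, Eventually.of_forall hC⟩) hP.cont

/-- The operator `f ↦ P(·) f(·)` on functions vanishing at infinity. -/
noncomputable def pointwiseCLM (P : ℝ → E →L[ℝ] F) (hP : IsBoundedStronglyContinuous P) :
    C₀(ℝ, E) →L[ℝ] C₀(ℝ, F) :=
  LinearMap.mkContinuousOfExistsBound
    { toFun := fun f =>
        { toFun := fun x => P x (f x)
          continuous_toFun := hP.continuous_apply.comp (continuous_id.prodMk f.continuous)
          zero_at_infty' := by
            obtain ⟨C, hC⟩ := hP.bounded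
            have h1 := (zero_at_infty f).norm.const_mul C
            rw [norm_zero, mul_zero] at h1
            exact squeeze_zero_norm (fun x => ((P x).le_opNorm _).trans
              (mul_le_mul_of_nonneg_right (hC x) (norm_nonneg _))) h1 }
      map_add' := fun f g => by ext x; simp
      map_smul' := fun r f => by ext x; simp }
    (by
      obtain ⟨C, hC⟩ := hP.bounded
      have hC0 : 0 ≤ C := (norm_nonneg _).trans (hC 0)
      refine ⟨C, fun f => norm_le_of_forall (by positivity) fun x => ?_⟩
      exact ((P x).le_opNorm _).trans (mul_le_mul (hC x) (f.norm_apply_le x) (norm_nonneg _) hC0))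

@[simp] theorem pointwiseCLM_apply (P : ℝ → E →L[ℝ] F) (hP : IsBoundedStronglyContinuous P)
    (f : C₀(ℝ, E)) (x : ℝ) : pointwiseCLM P hP f x = P x (f x) := rfl

theorem norm_pointwiseCLM_le {P : ℝ → E →L[ℝ] F} (hP : IsBoundedStronglyContinuous P) {C : ℝ}
    (hC : ∀ x, ‖P x‖ ≤ C) : ‖pointwiseCLM P hP‖ ≤ C := by
  have hC0 : 0 ≤ C := (norm_nonneg _).trans (hC 0)
  refine ContinuousLinearMap.opNorm_le_bound _ hC0 fun f =>
    norm_le_of_forall (by positivity) fun x => ?_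
  exact ((P x).le_opNorm _).trans (mul_le_mul (hC x) (f.norm_apply_le x) (norm_nonneg _) hC0)

theorem isBoundedStronglyContinuous_const (j : E →L[ℝ] F) :
    IsBoundedStronglyContinuous fun _ : ℝ => j :=
  ⟨⟨‖j‖, fun _ => le_rfl⟩, fun _ => continuous_const⟩

/-- Functions with values in a dense subspace are dense. -/
theorem denseRange_pointwiseCLM_const {j : E →L[ℝ] F} (hj : DenseRange j) :
    DenseRange (pointwiseCLM (fun _ => j) (isBoundedStronglyContinuous_const j)) := by
  rw [Metric.denseRange_iff]
  intro f ε hε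
  have h0 : ∀ᶠ x in cocompact ℝ, ‖f x‖ < ε / 2 := by
    have := (zero_at_infty f).norm
    rw [norm_zero] at this
    exact this.eventually_lt_const (by linarith)
  obtain ⟨K, hK, hKf⟩ := mem_cocompact.1 h0
  obtain ⟨r, hr⟩ := hK.isBounded.subset_closedBall 0
  have hout : ∀ x : ℝ, r < |x| → ‖f x‖ < ε / 2 := by
    intro x hx
    refine hKf fun hxK => ?_
    have := hr hxK
    rw [mem_closedBall_zero_iff, Real.norm_eq_abs] at this
    linarith
  -- Admissible values at x form a convex set: ε/2-close to f x, and zero for |x| > r + 1. Near a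
  -- point with |x| > r the constant 0 is admissible; near any other point an approximant of f x is,
  -- since nearby points stay below r + 1. Hence a continuous selection exists.
  let t : ℝ → Set E := fun x => {d | ‖j d - f x‖ < ε / 2 ∧ (r + 1 < |x| → d = 0)}
  have ht : ∀ x, Convex ℝ (t x) := by
    intro x
    have h1 : Convex ℝ {d | ‖j d - f x‖ < ε / 2} := by
      have h2 := (convex_ball (f x) (ε / 2)).linear_preimage j.toLinearMap
      convert h2 using 1
      ext d
      simp [dist_eq_norm]
    refine h1.inter fun a ha b hb s t hs ht hst hx => ?_
    rw [ha hx, hb hx]; simp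
  have hloc : ∀ x : ℝ, ∃ c : E, ∀ᶠ y in 𝓝 x, c ∈ t y := by
    intro x
    by_cases hx : r < |x|
    · refine ⟨0, ?_⟩
      filter_upwards [(continuous_abs.tendsto x).eventually (lt_mem_nhds hx)] with y hy
      exact ⟨by simpa using hout y hy, fun _ => rfl⟩
    · obtain ⟨d, hd⟩ := Metric.denseRange_iff.1 hj (f x) (ε / 2) (by linarith)
      have hc : Continuous fun y => ‖j d - f y‖ := (continuous_const.sub f.continuous).norm
      have hd' : ‖j d - f x‖ < ε / 2 := by rwa [dist_comm, dist_eq_norm] at hd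
      refine ⟨d, ?_⟩
      filter_upwards [(hc.tendsto x).eventually (gt_mem_nhds hd'),
        (continuous_abs.tendsto x).eventually (gt_mem_nhds (show |x| < r + 1 by linarith))]
        with y hy1 hy2
      exact ⟨hy1, fun h => absurd h (not_lt.2 hy2.le)⟩
  obtain ⟨g, hg⟩ := exists_continuous_forall_mem_convex_of_local_const ht hloc
  refine ⟨⟨g, ?_⟩, ?_⟩
  · refine tendsto_const_nhds.congr' ?_
    filter_upwards [(isCompact_closedBall (0 : ℝ) (r + 1)).compl_mem_cocompact] with x hx
    rw [mem_compl_iff, mem_closedBall_zero_iff, Real.norm_eq_abs, not_le] at hx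
    exact ((hg x).2 hx).symm
  · rw [dist_comm, dist_eq_norm]
    refine (norm_le_of_forall (by positivity) fun x => ?_).trans_lt (half_lt_self hε)
    exact (hg x).1.le

variable {T : ℝ → ℝ → F →L[ℝ] F}

/-- The semigroup `f ↦ T(·, t) f(·)` acting pointwise. -/
noncomputable def multSemigroup (T : ℝ → ℝ → F →L[ℝ] F)
    (hc : ∀ t, IsBoundedStronglyContinuous fun x => T x (max t 0)) (t : ℝ) :
    C₀(ℝ, F) →L[ℝ] C₀(ℝ, F) :=
  pointwiseCLM _ (hc t)

theorem multSemigroup_apply (hc : ∀ t, IsBoundedStronglyContinuous fun x => T x (max t 0)) (t : ℝ)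
    (f : C₀(ℝ, F)) (x : ℝ) : multSemigroup T hc t f x = T x (max t 0) (f x) := rfl

theorem hasGrowth_multSemigroup
    (hc : ∀ t, IsBoundedStronglyContinuous fun x => T x (max t 0)) {M m : ℝ}
    (hg : ∀ x, HasGrowth (T x) M m) : HasGrowth (multSemigroup T hc) M m := by
  intro t ht
  refine norm_pointwiseCLM_le _ fun x => ?_
  rw [max_eq_left ht]
  exact hg x t ht

theorem evalCLM_multSemigroup (hc : ∀ t, IsBoundedStronglyContinuous fun x => T x (max t 0))
    (x t : ℝ) (ht : 0 ≤ t) (f : C₀(ℝ, F)) :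
    evalCLM F x (multSemigroup T hc t f) = T x t (evalCLM F x f) := by
  simp [multSemigroup_apply, max_eq_left ht]

theorem RegularFamily.isBoundedStronglyContinuous [CompleteSpace F] {j : E →L[ℝ] F}
    {A : ℝ → E →L[ℝ] F} {U : ℝ → ℝ → E →L[ℝ] E} (h : RegularFamily j A T U) (t : ℝ) :
    IsBoundedStronglyContinuous fun x => T x (max t 0) := by
  obtain ⟨C, hC⟩ := h.bounded (max t 0)
  refine ⟨⟨C, fun x => hC x _ ⟨le_max_right _ _, le_rfl⟩⟩, fun v => ?_⟩
  exact h.continuous_clamp.comp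
    ((continuous_id.prodMk continuous_const).prodMk continuous_const)

/-- Strong continuity in the sup norm needs uniformity in x. The Lipschitz bound provides it for
E-valued functions, which are dense, and local boundedness in time does the rest. -/
theorem RegularFamily.isC0Semigroup_mult [CompleteSpace F] {j : E →L[ℝ] F}
    {A : ℝ → E →L[ℝ] F} {U : ℝ → ℝ → E →L[ℝ] E} (h : RegularFamily j A T U) :
    IsC0Semigroup (multSemigroup T h.isBoundedStronglyContinuous) := by
  obtain ⟨M, m, hg⟩ := exists_growth h.semigroup h.bounded
  have hgm := hasGrowth_multSemigroup h.isBoundedStronglyContinuous hg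
  have hclamp : ∀ t : ℝ, multSemigroup T h.isBoundedStronglyContinuous (max t 0) =
      multSemigroup T h.isBoundedStronglyContinuous t := by
    intro t
    ext f x
    simp [multSemigroup_apply]
  refine ⟨?_, fun s t hs ht => ?_, fun f => Continuous.continuousOn ?_⟩
  · ext f x
    simp [multSemigroup_apply, (h.semigroup x).zero]
  · ext f x
    simp [multSemigroup_apply, max_eq_left hs, max_eq_left ht, max_eq_left (add_nonneg hs ht),
      (h.semigroup x).add s t hs ht]
  · refine continuous_apply_of_denseRange (fun t₀ => ?_)
      (denseRange_pointwiseCLM_const h.dense) (fun g => ?_) f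
    · obtain ⟨C, hC⟩ := hgm.locally_bounded (max (t₀ + 1) 0)
      refine ⟨C, ?_⟩
      filter_upwards [eventually_le_nhds (show t₀ < t₀ + 1 by linarith)] with t ht
      rw [← hclamp]
      exact hC _ ⟨le_max_right _ _, max_le_max_right _ ht⟩
    · rw [continuous_iff_continuousAt]
      intro t₀
      obtain ⟨C, hC⟩ := h.norm_sub_le (max (t₀ + 1) 0)
      have hC' : ∀ e : E, ∀ x, ∀ s ∈ Icc (0 : ℝ) (max (t₀ + 1) 0),
          ∀ t ∈ Icc (0 : ℝ) (max (t₀ + 1) 0), ‖T x t (j e) - T x s (j e)‖ ≤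
            |C| * ‖e‖ * |t - s| := fun e x s hs t ht => (hC x s hs t ht e).trans
          (by gcongr; exact le_abs_self C)
      have h1 : Tendsto (fun t : ℝ => |C| * ‖g‖ * |max t 0 - max t₀ 0|) (𝓝 t₀) (𝓝 0) := by
        have : Continuous fun t : ℝ => |C| * ‖g‖ * |max t 0 - max t₀ 0| := by fun_prop
        simpa using this.tendsto t₀
      rw [ContinuousAt, tendsto_iff_norm_sub_tendsto_zero]
      refine squeeze_zero' (Eventually.of_forall fun _ => norm_nonneg _) ?_ h1
      filter_upwards [eventually_le_nhds (show t₀ < t₀ + 1 by linarith)] with t ht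
      refine norm_le_of_forall (by positivity) fun x => ?_
      refine (hC' (g x) x _ ⟨le_max_right _ _, max_le_max_right _ (by linarith)⟩ _
        ⟨le_max_right _ _, max_le_max_right _ ht⟩).trans ?_
      gcongr
      exact g.norm_apply_le x

/-- The generator of the pointwise semigroup acts pointwise, on its natural domain. -/
theorem mem_genGraph_mult [CompleteSpace F]
    {hc : ∀ t, IsBoundedStronglyContinuous fun x => T x (max t 0)}
    (hC0 : IsC0Semigroup (multSemigroup T hc)) (hT : ∀ x, IsC0Semigroup (T x)) {M m : ℝ}
    (hg : ∀ x, HasGrowth (T x) M m) {f h : C₀(ℝ, F)} :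
    (f, h) ∈ genGraph (multSemigroup T hc) ↔ ∀ x, (f x, h x) ∈ genGraph (T x) := by
  refine ⟨fun hf x => genGraph_map (evalCLM F x) (evalCLM_multSemigroup hc x) hf, fun hf => ?_⟩
  -- For the converse no uniform limit is proved directly: f and R((m+1)f - h) solve the same
  -- resolvent equation at every x, hence agree, and the latter lies in the domain.
  obtain ⟨R, -, hR, -⟩ := exists_resolvent hC0 (hasGrowth_multSemigroup hc hg) (lt_add_one m)
  have h1 := hR ((m + 1) • f - h)
  have h2 : f = R ((m + 1) • f - h) := by
    ext x
    obtain ⟨Rx, -, -, hRx⟩ := exists_resolvent (hT x) (hg x) (lt_add_one m)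
    have h3 := genGraph_map (evalCLM F x) (evalCLM_multSemigroup hc x) h1
    have h4 := (hRx ((m + 1) • f x - h x) (R ((m + 1) • f - h) x)).1 h3
    have h5 := (hRx ((m + 1) • f x - h x) (f x)).1 (by rw [sub_sub_cancel]; exact hf x)
    rw [h5]
    exact h4.symm
  rwa [← h2, sub_sub_cancel] at h1

/-- The graph is the solution set of f = R(cf - h) with R bounded. -/
theorem isClosed_genGraph [CompleteSpace F] {T : ℝ → F →L[ℝ] F} (hT : IsC0Semigroup T)
    {M m : ℝ} (hg : HasGrowth T M m) : IsClosed (genGraph T) := by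
  obtain ⟨R, -, -, hR⟩ := exists_resolvent hT hg (lt_add_one m)
  have : genGraph T = {p : F × F | p.1 = R ((m + 1) • p.1 - p.2)} := by
    ext ⟨f, h⟩
    have := hR ((m + 1) • f - h) f
    rwa [sub_sub_cancel] at this
  rw [this]
  exact isClosed_eq continuous_fst
    (R.continuous.comp ((continuous_fst.const_smul _).sub continuous_snd))

/-- A densely and continuously embedded space on which the semigroup restricts to a strongly
continuous semigroup contains a core of the generator. -/
theorem genGraph_subset_closure_of_restrict [CompleteSpace E] [CompleteSpace F]
    {T : ℝ → F →L[ℝ] F} {U : ℝ → E →L[ℝ] E} (hT : IsC0Semigroup T) (hU : IsC0Semigroup U)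
    {M m M' m' : ℝ} (hg : HasGrowth T M m) (hg' : HasGrowth U M' m') {J : E →L[ℝ] F}
    (hJ : DenseRange J) (hJU : ∀ t, 0 ≤ t → ∀ e, J (U t e) = T t (J e)) :
    genGraph T ⊆ closure {p | p ∈ genGraph T ∧ p.1 ∈ range J} := by
  set c := max m m' + 1 with hcdef
  have hc : m < c := (le_max_left m m').trans_lt (lt_add_one _)
  have hc' : m' < c := (le_max_right m m').trans_lt (lt_add_one _)
  obtain ⟨R, -, hRg, hR⟩ := exists_resolvent hT hg hc
  obtain ⟨R', -, hRg', -⟩ := exists_resolvent hU hg' hc'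
  rintro ⟨f, h⟩ hf
  have h1 := (hR (c • f - h) f).1 (by rwa [sub_sub_cancel])
  -- Θ parametrises the graph continuously by the datum of the resolvent equation. Data in the dense
  -- range of `J` give elements of that range, because R J = J R'.
  let Θ : F → F × F := fun u => (R u, c • R u - u)
  have hΘ : Continuous Θ :=
    R.continuous.prodMk ((R.continuous.const_smul c).sub continuous_id)
  have h2 : (f, h) = Θ (c • f - h) := by
    simp only [Θ]
    rw [← h1, sub_sub_cancel]
  rw [h2]
  have h3 := mem_closure_image hΘ.continuousAt (hJ (c • f - h))
  refine closure_mono ?_ h3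
  rintro _ ⟨_, ⟨g, rfl⟩, rfl⟩
  refine ⟨hRg _, R' g, ?_⟩
  have h4 := genGraph_map J hJU (hRg' g)
  rw [map_sub, map_smul] at h4
  exact (hR _ _).1 h4

end FunctionSpace

/-! ### C_∞(ℝ, D) as a core of the pointwise generator -/

section Generator

open ZeroAtInftyContinuousMap

variable {B D D' : Type*}
    [NormedAddCommGroup B] [NormedSpace ℝ B] [CompleteSpace B]
    [NormedAddCommGroup D] [NormedSpace ℝ D] [CompleteSpace D]
    [NormedAddCommGroup D'] [NormedSpace ℝ D']
    {ι : D →L[ℝ] B} {κ : D' →L[ℝ] D}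
    {A : ℝ → D →L[ℝ] B} {A' : ℝ → D' →L[ℝ] D}
    {S : ℝ → ℝ → B →L[ℝ] B} {SD : ℝ → ℝ → D →L[ℝ] D} {SD' : ℝ → ℝ → D' →L[ℝ] D'}

omit [CompleteSpace B] [CompleteSpace D] in
theorem GeneratingFamily.regularFamily_big (hspaces : ThreeSpaces ι κ)
    (hA : GeneratingFamily ι κ A A' S SD SD') : RegularFamily ι A S SD where
  dense := by
    refine hspaces.dense_big.mono ?_
    rintro _ ⟨e, rfl⟩
    exact ⟨κ e, rfl⟩
  regular := hA.regular
  semigroup := hA.semigroup_B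
  bounded := hA.bounded_B
  gen x d := by
    rw [hA.core_B x]
    exact subset_closure ⟨d, rfl⟩
  restrict := hA.restrict_D
  bounded' := hA.bounded_D

-- The pair (D', D) makes the pointwise semigroup strongly continuous on D-valued functions, which
-- is what the core argument requires.
omit [CompleteSpace B] [CompleteSpace D] in
theorem GeneratingFamily.regularFamily_mid (hspaces : ThreeSpaces ι κ)
    (hA : GeneratingFamily ι κ A A' S SD SD') : RegularFamily κ A' SD SD' where
  dense := hspaces.dense_mid
  regular := hA.regular'
  semigroup := hA.semigroup_D
  bounded := hA.bounded_D
  gen x d := by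
    rw [hA.core_D x]
    exact subset_closure ⟨d, rfl⟩
  restrict := hA.restrict_D'
  bounded' := hA.bounded_D'

/-- `C_∞(ℝ, D)` is a core for the generator of the pointwise semigroup in `C_∞(ℝ, B)`. -/
theorem GeneratingFamily.genGraph_mult (hspaces : ThreeSpaces ι κ)
    (hA : GeneratingFamily ι κ A A' S SD SD') :
    genGraph (multSemigroup S (hA.regularFamily_big hspaces).isBoundedStronglyContinuous) =
      closure {p : C₀(ℝ, B) × C₀(ℝ, B) | ∃ F : C₀(ℝ, D),
        (∀ x, p.1 x = ι (F x)) ∧ ∀ x, p.2 x = A x (F x)} := by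
  have hB := hA.regularFamily_big hspaces
  have hD := hA.regularFamily_mid hspaces
  obtain ⟨M, m, hg⟩ := exists_growth hB.semigroup hB.bounded
  obtain ⟨M', m', hg'⟩ := exists_growth hD.semigroup hD.bounded
  have hpt := fun f h => mem_genGraph_mult (f := f) (h := h) hB.isC0Semigroup_mult hB.semigroup hg
  refine Subset.antisymm ?_ (closure_minimal ?_ (isClosed_genGraph hB.isC0Semigroup_mult
    (hasGrowth_multSemigroup hB.isBoundedStronglyContinuous hg)))
  · refine (genGraph_subset_closure_of_restrict hB.isC0Semigroup_mult hD.isC0Semigroup_mult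
      (hasGrowth_multSemigroup _ hg) (hasGrowth_multSemigroup _ hg')
      (denseRange_pointwiseCLM_const hB.dense) fun t ht F => ?_).trans (closure_mono ?_)
    · ext x
      simp only [pointwiseCLM_apply, multSemigroup_apply]
      exact hB.restrict x _ (le_max_right _ _) _
    · rintro ⟨f, h⟩ ⟨hfh, F, hF⟩
      refine ⟨F, fun x => ?_, fun x => ?_⟩
      · rw [← hF]; rfl
      · have h1 := (hpt f h).1 hfh x
        have h2 : f x = ι (F x) := by
          have : f = pointwiseCLM (fun _ => ι) (isBoundedStronglyContinuous_const ι) F := hF.symm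
          rw [this]; rfl
        rw [h2] at h1
        exact genGraph_unique h1 (hB.gen x (F x))
  · rintro ⟨f, h⟩ ⟨F, hF1, hF2⟩
    refine (hpt f h).2 fun x => ?_
    have h1 := hB.gen x (F x)
    rwa [← hF1, ← hF2] at h1

end Generator

open ZeroAtInftyContinuousMap

/-! ### The jump operator and its weighted bounds -/

section JumpOperator

variable {B : Type*} [NormedAddCommGroup B] [NormedSpace ℝ B]

omit [NormedSpace ℝ B] in
theorem ZeroAtInftyContinuousMap.integrable_shift (ν : Measure ℝ) [IsFiniteMeasure ν]
    (f : C₀(ℝ, B)) (x : ℝ) : Integrable (fun y => f (x - y)) ν :=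
  Integrable.mono' (integrable_const ‖f‖)
    (f.continuous.comp (continuous_const.sub continuous_id)).aestronglyMeasurable
    (ae_of_all _ fun y => f.norm_apply_le (x - y))

/-- The jump operator `f ↦ ∫ f(· - y) ν(dy)`. -/
noncomputable def jumpCLM (B : Type*) [NormedAddCommGroup B] [NormedSpace ℝ B]
    (ν : Measure ℝ) [IsFiniteMeasure ν] : C₀(ℝ, B) →L[ℝ] C₀(ℝ, B) :=
  LinearMap.mkContinuous
    { toFun := fun f =>
        { toFun := fun x => ∫ y, f (x - y) ∂ν
          continuous_toFun := continuous_of_dominated (bound := fun _ => ‖f‖)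
            (fun x => (f.integrable_shift ν x).aestronglyMeasurable)
            (fun x => ae_of_all _ fun y => f.norm_apply_le (x - y)) (integrable_const _)
            (ae_of_all _ fun y => f.continuous.comp (continuous_id.sub continuous_const))
          zero_at_infty' := by
            have h0 : ∫ _ : ℝ, (0 : B) ∂ν = 0 := integral_zero _ _
            rw [← h0]
            have : (cocompact ℝ).IsCountablyGenerated := by
              rw [cocompact_eq_atBot_atTop]
              infer_instance
            refine tendsto_integral_filter_of_dominated_convergence (fun _ => ‖f‖)
              (Eventually.of_forall fun x => (f.integrable_shift ν x).aestronglyMeasurable)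
              (Eventually.of_forall fun x => ae_of_all _ fun y => f.norm_apply_le (x - y))
              (integrable_const _) (ae_of_all _ fun y => ?_)
            exact (zero_at_infty f).comp (Homeomorph.subRight y).isClosedEmbedding.tendsto_cocompact }
      map_add' := fun f g => by
        ext x
        exact integral_add (f.integrable_shift ν x) (g.integrable_shift ν x)
      map_smul' := fun r f => by
        ext x
        exact integral_smul r fun y => f (x - y) }
    (ν.real univ) fun f => norm_le_of_forall (by positivity) fun x => by
      refine (norm_integral_le_of_norm_le (integrable_const ‖f‖)
        (ae_of_all _ fun y => f.norm_apply_le (x - y))).trans_eq ?_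
      simp

variable (ν : Measure ℝ) [IsFiniteMeasure ν]

theorem jumpCLM_apply (f : C₀(ℝ, B)) (x : ℝ) : jumpCLM B ν f x = ∫ y, f (x - y) ∂ν := rfl

theorem levyOp_eq [CompleteSpace B] (f : C₀(ℝ, B)) (x : ℝ) :
    levyOp ν f x = jumpCLM B ν f x - ν.real univ • f x := by
  rw [levyOp, integral_sub (f.integrable_shift ν x) (integrable_const _), integral_const,
    jumpCLM_apply]

/-- The bounded operator `L'_ν`. -/
noncomputable def levyCLM (B : Type*) [NormedAddCommGroup B] [NormedSpace ℝ B]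
    (ν : Measure ℝ) [IsFiniteMeasure ν] : C₀(ℝ, B) →L[ℝ] C₀(ℝ, B) :=
  jumpCLM B ν - ν.real univ • ContinuousLinearMap.id ℝ _

theorem levyCLM_apply (f : C₀(ℝ, B)) (x : ℝ) :
    levyCLM B ν f x = jumpCLM B ν f x - ν.real univ • f x := rfl

/-- The Laplace transform `∫ e^{-θ y} ν(dy)`. -/
noncomputable def laplaceMass (ν : Measure ℝ) (θ : ℝ) : ℝ := ∫ y, Real.exp (-θ * y) ∂ν

variable {ν}

omit [IsFiniteMeasure ν] in
theorem ae_pos_of_null (hν : ν (Iic 0) = 0) : ∀ᵐ y ∂ν, 0 < y := by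
  rw [ae_iff]
  simpa [Iic] using hν

theorem integrable_exp_neg (hν : ν (Iic 0) = 0) {θ : ℝ} (hθ : 0 ≤ θ) :
    Integrable (fun y => Real.exp (-θ * y)) ν := by
  refine Integrable.mono' (integrable_const 1) (by fun_prop) ?_
  filter_upwards [ae_pos_of_null hν] with y hy
  rw [Real.norm_of_nonneg (Real.exp_pos _).le, Real.exp_le_one_iff]
  nlinarith

theorem laplaceMass_nonneg (ν : Measure ℝ) (θ : ℝ) : 0 ≤ laplaceMass ν θ :=
  integral_nonneg fun _ => (Real.exp_pos _).le

theorem laplaceMass_zero (ν : Measure ℝ) : laplaceMass ν 0 = ν.real univ := by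
  simp [laplaceMass]

/-- The deficit is ∫ (1 - e^{-θy}) ν(dy), whose integrand is positive ν-almost everywhere. This
strict gain admits the endpoint of the range of λ on [a,b]. -/
theorem laplaceMass_lt (hν : ν (Iic 0) = 0) (h0 : ν ≠ 0) {θ : ℝ} (hθ : 0 < θ) :
    laplaceMass ν θ < ν.real univ := by
  have h1 : ν.real univ - laplaceMass ν θ = ∫ y, (1 - Real.exp (-θ * y)) ∂ν := by
    rw [integral_sub (integrable_const _) (integrable_exp_neg hν hθ.le), laplaceMass]
    simp
  have hpos : ∀ᵐ y ∂ν, 0 < 1 - Real.exp (-θ * y) := by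
    filter_upwards [ae_pos_of_null hν] with y hy
    rw [sub_pos, Real.exp_lt_one_iff]
    nlinarith
  have h2 : 0 < ∫ y, (1 - Real.exp (-θ * y)) ∂ν := by
    rw [integral_pos_iff_support_of_nonneg_ae (hpos.mono fun y hy => hy.le)
      ((integrable_const _).sub (integrable_exp_neg hν hθ.le))]
    have h3 : Function.support (fun y => 1 - Real.exp (-θ * y)) =ᵐ[ν] univ := by
      rw [eventuallyEq_univ]
      exact hpos.mono fun y hy => hy.ne'
    rw [measure_congr h3]
    exact Measure.measure_univ_pos.2 h0
  linarith

/-- A jump of size y lowers the weight e^{θx} by the factor e^{-θy}, so in the weighted norm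
`laplaceMass ν θ` takes the place of the total mass. -/
theorem norm_jumpCLM_apply_le (hν : ν (Iic 0) = 0) {θ C : ℝ} (hθ : 0 ≤ θ) {f : C₀(ℝ, B)}
    (hf : ∀ x, ‖f x‖ ≤ C * Real.exp (θ * x)) (x : ℝ) :
    ‖jumpCLM B ν f x‖ ≤ laplaceMass ν θ * C * Real.exp (θ * x) := by
  rw [jumpCLM_apply]
  have hi := (integrable_exp_neg hν hθ).const_mul (C * Real.exp (θ * x))
  refine (norm_integral_le_of_norm_le hi (ae_of_all _ fun y => (hf (x - y)).trans_eq ?_)).trans_eq ?_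
  · rw [mul_assoc, ← Real.exp_add]; ring_nf
  · rw [integral_const_mul, laplaceMass]; ring

theorem jumpCLM_congr (hν : ν (Iic 0) = 0) {f g : C₀(ℝ, B)} {b : ℝ} (h : ∀ x ≤ b, f x = g x)
    {x : ℝ} (hx : x ≤ b) : jumpCLM B ν f x = jumpCLM B ν g x := by
  rw [jumpCLM_apply, jumpCLM_apply]
  refine integral_congr_ae ?_
  filter_upwards [ae_pos_of_null hν] with y hy
  exact h _ (by linarith)

theorem jumpCLM_mem_CKill (hν : ν (Iic 0) = 0) {f : C₀(ℝ, B)} {a : ℝ} (hf : f ∈ CKill B a) :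
    jumpCLM B ν f ∈ CKill B a := by
  intro x hx
  have := jumpCLM_congr (g := 0) hν hf hx
  simpa using this

theorem levyCLM_mem_CKill (hν : ν (Iic 0) = 0) {f : C₀(ℝ, B)} {a : ℝ} (hf : f ∈ CKill B a) :
    levyCLM B ν f ∈ CKill B a := by
  intro x hx
  have h1 := jumpCLM_mem_CKill hν hf x hx
  rw [levyCLM_apply, h1, hf x hx]
  simp

/-- On functions vanishing to the left of `a` the Riemann-Liouville derivative is `-L'_ν`. -/
theorem derivRL_eq [CompleteSpace B] (hν : ν (Iic 0) = 0) {f : C₀(ℝ, B)} {a : ℝ}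
    (hf : f ∈ CKill B a) {u : ℝ → B} {x : ℝ} (hx : a ≤ x) (hu : ∀ y ∈ Icc a x, u y = f y) :
    derivRL ν a u x = -levyCLM B ν f x := by
  have hux := hu x ⟨hx, le_rfl⟩
  have hi : Integrable (fun y => f (x - y) - f x) ν :=
    (f.integrable_shift ν x).sub (integrable_const _)
  rw [levyCLM_apply, ← levyOp_eq, levyOp]
  have h1 : ∫ y, (f (x - y) - f x) ∂ν = ∫ y in Ioi 0, (f (x - y) - f x) ∂ν := by
    rw [← setIntegral_univ]
    exact setIntegral_congr_set (eventuallyEq_univ.2 (ae_pos_of_null hν)).symm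
  -- Jumps are split at x - a: longer ones land where f vanishes and contribute only -f x.
  rw [h1, ← Ioc_union_Ioi_eq_Ioi (sub_nonneg.2 hx), setIntegral_union
    Ioc_disjoint_Ioi_same measurableSet_Ioi
    hi.integrableOn hi.integrableOn, derivRL, neg_add]
  congr 1
  · congr 1
    refine setIntegral_congr_fun measurableSet_Ioc fun y hy => ?_
    simp only [hux]
    rw [hu _ ⟨by linarith [hy.2], by linarith [hy.1]⟩]
  · rw [← integral_neg]
    refine setIntegral_congr_fun measurableSet_Ioi fun y hy => ?_
    have hy' : x - a < y := hy
    simp only [hux]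
    rw [hf (x - y) (by linarith)]
    simp

omit [IsFiniteMeasure ν] in
theorem derivCaputo_eq_derivRL {u : ℝ → B} {a : ℝ} (hu : u a = 0) (x : ℝ) :
    derivCaputo ν a u x = derivRL ν a u x := by
  simp only [derivCaputo, derivRL, hu, zero_sub, integral_neg, sub_neg_eq_add]

end JumpOperator

/-! ### Killed function spaces, restriction and extension -/

section KilledSpaces

variable {B : Type*} [NormedAddCommGroup B] [NormedSpace ℝ B]

theorem isClosed_CKill (a : ℝ) : IsClosed (CKill B a : Set C₀(ℝ, B)) := by
  have : (CKill B a : Set C₀(ℝ, B)) = ⋂ x ∈ Iic a, {f | evalCLM B x f = 0} := by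
    ext f
    simp only [mem_iInter]
    rfl
  rw [this]
  exact isClosed_biInter fun x _ => isClosed_eq (evalCLM B x).continuous continuous_const

theorem isClosed_CKillIcc (a b : ℝ) : IsClosed (CKillIcc B a b : Set C(Icc a b, B)) := by
  have : (CKillIcc B a b : Set C(Icc a b, B)) =
      ⋂ x ∈ {x : Icc a b | (x : ℝ) = a}, {f : C(Icc a b, B) | f x = 0} := by
    ext f
    simp only [mem_iInter]
    rfl
  rw [this]
  exact isClosed_biInter fun x _ => isClosed_eq (continuous_eval_const x)
    continuous_const

instance completeSpace_CKill [CompleteSpace B] (a : ℝ) : CompleteSpace (CKill B a) :=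
  (isClosed_CKill a).completeSpace_coe

instance completeSpace_CKillIcc [CompleteSpace B] (a b : ℝ) : CompleteSpace (CKillIcc B a b) :=
  (isClosed_CKillIcc a b).completeSpace_coe

/-- Restriction of functions to `[a,b]`. -/
noncomputable def restrictIcc (B : Type*) [NormedAddCommGroup B] [NormedSpace ℝ B] (a b : ℝ) :
    CKill B a →L[ℝ] CKillIcc B a b :=
  LinearMap.mkContinuous
    { toFun := fun f => ⟨⟨fun x => (f : C₀(ℝ, B)) x,
        (f : C₀(ℝ, B)).continuous.comp continuous_subtype_val⟩, fun x hx => f.2 x hx.le⟩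
      map_add' := fun _ _ => rfl
      map_smul' := fun _ _ => rfl } 1
    fun f => by
      rw [one_mul]
      exact (ContinuousMap.norm_le _ (norm_nonneg _)).2 fun x =>
        (f : C₀(ℝ, B)).norm_apply_le x

@[simp] theorem restrictIcc_apply {a b : ℝ} (f : CKill B a) (x : Icc a b) :
    (restrictIcc B a b f : C(Icc a b, B)) x = (f : C₀(ℝ, B)) x := rfl

theorem norm_cutoff_smul_le (b x : ℝ) (v : B) : ‖max 0 (1 - (x - min x b)) • v‖ ≤ ‖v‖ := by
  rw [norm_smul, Real.norm_of_nonneg (le_max_left _ _)]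
  exact mul_le_of_le_one_left (norm_nonneg v)
    (max_le zero_le_one (by linarith [min_le_left x b]))

/-- Extension of functions on `[a,b]` vanishing at `a`: by zero to the left, and to a function of
compact support to the right. -/
noncomputable def extendIcc (B : Type*) [NormedAddCommGroup B] [NormedSpace ℝ B] {a b : ℝ}
    (hab : a ≤ b) : CKillIcc B a b →L[ℝ] CKill B a :=
  LinearMap.mkContinuous
    { toFun := fun f =>
        -- The scalar factor is 1 up to b, decreases linearly, and is 0 from b + 1 on.
        ⟨{ toFun := fun x => max 0 (1 - (x - min x b)) •
            (f : C(Icc a b, B)) (projIcc a b hab x)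
           continuous_toFun := by
            refine Continuous.smul (by fun_prop) ?_
            exact (f : C(Icc a b, B)).continuous.comp continuous_projIcc
           zero_at_infty' := by
            refine tendsto_const_nhds.congr' ?_
            filter_upwards [(isCompact_Icc (a := a) (b := b + 1)).compl_mem_cocompact] with x hx
            rw [mem_compl_iff, mem_Icc, not_and_or, not_le, not_le] at hx
            rcases hx with hx | hx
            · rw [f.2 _ (by rw [projIcc_of_le_left hab hx.le]), smul_zero]
            · rw [max_eq_left, zero_smul]
              rw [min_eq_right (by linarith)]
              linarith },
          fun x hx => by
            change max 0 (1 - (x - min x b)) • (f : C(Icc a b, B)) (projIcc a b hab x) = 0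
            rw [f.2 _ (by rw [projIcc_of_le_left hab hx]), smul_zero]⟩
      map_add' := fun f g => by
        ext x
        exact smul_add _ _ _
      map_smul' := fun r f => by
        ext x
        exact smul_comm _ _ _ } 1
    fun f => by
      rw [one_mul]
      exact norm_le_of_forall (norm_nonneg _) fun x =>
        (norm_cutoff_smul_le b x _).trans ((f : C(Icc a b, B)).norm_coe_le_norm _)

theorem norm_extendIcc_le {a b : ℝ} (hab : a ≤ b) (f : CKillIcc B a b) :
    ‖(extendIcc B hab f : C₀(ℝ, B))‖ ≤ ‖f‖ :=
  norm_le_of_forall (norm_nonneg _) fun x =>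
    (norm_cutoff_smul_le b x _).trans ((f : C(Icc a b, B)).norm_coe_le_norm _)

theorem extendIcc_apply {a b : ℝ} (hab : a ≤ b) (f : CKillIcc B a b) (x : Icc a b) :
    (extendIcc B hab f : C₀(ℝ, B)) x = (f : C(Icc a b, B)) x := by
  change max 0 (1 - ((x : ℝ) - min (x : ℝ) b)) • (f : C(Icc a b, B)) (projIcc a b hab x) = _
  rw [min_eq_left x.2.2, projIcc_val]
  simp

theorem restrictIcc_extendIcc {a b : ℝ} (hab : a ≤ b) (f : CKillIcc B a b) :
    restrictIcc B a b (extendIcc B hab f) = f := by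
  ext x
  exact extendIcc_apply hab f x

theorem extendZero_eq_extendIcc {a b : ℝ} (hab : a ≤ b) (f : CKillIcc B a b) {x : ℝ}
    (hx : x ≤ b) : extendZero (f : C(Icc a b, B)) x = (extendIcc B hab f : C₀(ℝ, B)) x := by
  by_cases h : x ∈ Icc a b
  · rw [extendZero, dif_pos h]
    exact (extendIcc_apply hab f ⟨x, h⟩).symm
  · rw [extendZero, dif_neg h, (extendIcc B hab f).2 x]
    by_contra h'
    exact h ⟨(not_le.1 h').le, hx⟩

theorem extendIcc_restrictIcc {a b : ℝ} (hab : a ≤ b) (f : CKill B a) {x : ℝ} (hx : x ≤ b) :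
    (extendIcc B hab (restrictIcc B a b f) : C₀(ℝ, B)) x = (f : C₀(ℝ, B)) x := by
  by_cases h : a ≤ x
  · exact extendIcc_apply hab _ ⟨x, h, hx⟩
  · rw [(extendIcc B hab _).2 x (not_le.1 h).le, f.2 x (not_le.1 h).le]

end KilledSpaces

/-! ### Path space and conditioning on the first jump -/

section PathMeasure

variable {B : Type*} [NormedAddCommGroup B] [NormedSpace ℝ B]

/-- Restarting the clock at the first jump leaves a path with one jump fewer; the inductions over
the number of jumps use this. -/
theorem mem_timeSimplex_succ {n : ℕ} {t : ℝ} {s : Fin (n + 1) → ℝ} :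
    s ∈ timeSimplex (n + 1) t ↔
      s 0 ∈ Ioo 0 t ∧ (fun i : Fin n => s i.succ - s 0) ∈ timeSimplex n (t - s 0) := by
  constructor
  · rintro ⟨h1, h2⟩
    refine ⟨h2 0, fun i j hij => sub_lt_sub_right (h1 (Fin.succ_lt_succ_iff.2 hij)) _,
      fun i => ⟨sub_pos.2 (h1 i.succ_pos), sub_lt_sub_right (h2 _).2 _⟩⟩
  · rintro ⟨h0, h1, h2⟩
    have h3 : ∀ i : Fin n, s 0 < s i.succ := fun i => sub_pos.1 (h2 i).1
    refine ⟨fun i j => ?_, fun i => ?_⟩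
    · refine Fin.cases ?_ (fun i => ?_) i <;> refine Fin.cases ?_ (fun j => ?_) j
      · intro h; exact absurd h (lt_irrefl _)
      · intro _; exact h3 j
      · intro h; exact absurd h (Fin.not_lt_zero _)
      · intro h
        have := h1 (Fin.succ_lt_succ_iff.1 h)
        simpa using this
    · refine Fin.cases h0 (fun i => ?_) i
      exact ⟨h0.1.trans (h3 i), by have := (h2 i).2; simp only at this; linarith⟩

theorem measurableSet_timeSimplex (n : ℕ) (t : ℝ) : MeasurableSet (timeSimplex n t) := by
  have : timeSimplex n t = (⋂ i, ⋂ j, ⋂ _ : i < j, {s : Fin n → ℝ | s i < s j}) ∩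
      ⋂ i, {s : Fin n → ℝ | s i ∈ Ioo 0 t} := by
    ext s
    simp [timeSimplex, StrictMono]
  rw [this]
  refine MeasurableSet.inter (MeasurableSet.iInter fun i => MeasurableSet.iInter fun j =>
    MeasurableSet.iInter fun _ => measurableSet_lt (measurable_pi_apply i) (measurable_pi_apply j))
    (MeasurableSet.iInter fun i => measurable_pi_apply i measurableSet_Ioo)

theorem volume_timeSimplex_lt_top (n : ℕ) (t : ℝ) : volume (timeSimplex n t) < ⊤ := by
  refine (measure_mono (t := Set.pi univ fun _ : Fin n => Ioo (0 : ℝ) t) fun s hs i _ =>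
    hs.2 i).trans_lt ?_
  rw [volume_pi_pi]
  exact ENNReal.prod_lt_top fun i _ => by simp

/-- The measure on jump times and jump sizes of the paths with `n` jumps. -/
noncomputable def simplexMeasure (ν : Measure ℝ) (n : ℕ) (t : ℝ) :
    Measure ((Fin n → ℝ) × (Fin n → ℝ)) :=
  (volume.restrict (timeSimplex n t)).prod (Measure.pi fun _ : Fin n => ν)

variable (ν : Measure ℝ) [IsFiniteMeasure ν]

instance isFiniteMeasure_simplexMeasure (n : ℕ) (t : ℝ) :
    IsFiniteMeasure (simplexMeasure ν n t) := by
  have : IsFiniteMeasure (volume.restrict (timeSimplex n t)) :=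
    isFiniteMeasure_restrict.2 (volume_timeSimplex_lt_top n t).ne
  unfold simplexMeasure
  infer_instance

theorem simplexMeasure_eq_restrict (n : ℕ) (t : ℝ) : simplexMeasure ν n t =
    (volume.prod (Measure.pi fun _ : Fin n => ν)).restrict (timeSimplex n t ×ˢ univ) := by
  rw [← Measure.prod_restrict, Measure.restrict_univ, simplexMeasure]

theorem ae_simplexMeasure (n : ℕ) (t : ℝ) :
    ∀ᵐ q ∂simplexMeasure ν n t, q.1 ∈ timeSimplex n t := by
  rw [simplexMeasure_eq_restrict]
  filter_upwards [ae_restrict_mem ((measurableSet_timeSimplex n t).prod MeasurableSet.univ)]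
    with q hq
  exact hq.1

variable {ν} in
theorem ae_simplexMeasure_pos (hν : ν (Iic 0) = 0) (n : ℕ) (t : ℝ) :
    ∀ᵐ q ∂simplexMeasure ν n t, ∀ i, 0 < q.2 i := by
  have h1 : ∀ᵐ z ∂(Measure.pi fun _ : Fin n => ν), ∀ i, 0 < z i :=
    ae_all_iff.2 fun i => Measure.tendsto_eval_ae_ae.eventually (ae_pos_of_null hν)
  exact Measure.quasiMeasurePreserving_snd.ae h1

/-- Split off the first jump time and the first jump size. -/
def consPath (n : ℕ) (q : (ℝ × ℝ) × ((Fin n → ℝ) × (Fin n → ℝ))) :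
    (Fin (n + 1) → ℝ) × (Fin (n + 1) → ℝ) :=
  (Fin.cons q.1.1 fun i => q.2.1 i + q.1.1, Fin.cons q.1.2 q.2.2)

theorem measurePreserving_prodProdProdComm {α β γ δ : Type*} [MeasurableSpace α]
    [MeasurableSpace β] [MeasurableSpace γ] [MeasurableSpace δ] (μa : Measure α) (μb : Measure β)
    (μc : Measure γ) (μd : Measure δ) [SFinite μa] [SFinite μb] [SFinite μc] [SFinite μd] :
    MeasurePreserving (fun q : (α × β) × (γ × δ) => ((q.1.1, q.2.1), (q.1.2, q.2.2)))
      ((μa.prod μb).prod (μc.prod μd)) ((μa.prod μc).prod (μb.prod μd)) := by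
  have h1 := measurePreserving_prodAssoc μa μb (μc.prod μd)
  have h2 := (MeasurePreserving.id μa).prod
    ((measurePreserving_prodAssoc μb μc μd).symm MeasurableEquiv.prodAssoc)
  have h3 := (MeasurePreserving.id μa).prod ((Measure.measurePreserving_swap (μ := μb)
    (ν := μc)).prod (MeasurePreserving.id μd))
  have h4 := (MeasurePreserving.id μa).prod (measurePreserving_prodAssoc μc μb μd)
  have h5 := (measurePreserving_prodAssoc μa μc (μb.prod μd)).symm MeasurableEquiv.prodAssoc
  exact h5.comp (h4.comp (h3.comp (h2.comp h1)))

theorem measurePreserving_piCons {n : ℕ} (μ : Measure ℝ) [SigmaFinite μ] :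
    MeasurePreserving (fun q : ℝ × (Fin n → ℝ) => (Fin.cons q.1 q.2 : Fin (n + 1) → ℝ))
      (μ.prod (Measure.pi fun _ : Fin n => μ)) (Measure.pi fun _ : Fin (n + 1) => μ) := by
  have h := (measurePreserving_piFinSuccAbove (fun _ : Fin (n + 1) => μ) 0).symm
    (MeasurableEquiv.piFinSuccAbove _ 0)
  convert h using 1
  ext q i
  refine Fin.cases ?_ (fun i => ?_) i <;> simp [MeasurableEquiv.piFinSuccAbove]

/-- The map regroups times with times and sizes with sizes, translates the remaining times by the
first one (a fibrewise translation, preserving Lebesgue measure), and then prepends. -/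
theorem measurePreserving_consPath (n : ℕ) :
    MeasurePreserving (consPath n)
      ((volume.prod ν).prod (volume.prod (Measure.pi fun _ : Fin n => ν)))
      (volume.prod (Measure.pi fun _ : Fin (n + 1) => ν)) := by
  have h1 := measurePreserving_prodProdProdComm (volume : Measure ℝ) ν
    (volume : Measure (Fin n → ℝ)) (Measure.pi fun _ : Fin n => ν)
  have h2 : MeasurePreserving (fun q : ℝ × (Fin n → ℝ) => (q.1, fun i => q.2 i + q.1))
      (volume.prod volume) (volume.prod volume) := by
    refine (MeasurePreserving.id (volume : Measure ℝ)).skew_product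
      (g := fun (a : ℝ) (s : Fin n → ℝ) i => s i + a) ?_ (ae_of_all _ fun a => ?_)
    · exact measurable_pi_lambda _ fun i =>
        ((measurable_pi_apply i).comp measurable_snd).add measurable_fst
    · exact (measurePreserving_add_right (volume : Measure (Fin n → ℝ)) fun _ => a).map_eq
  have h3 : MeasurePreserving (fun q : ℝ × (Fin n → ℝ) => (Fin.cons q.1 q.2 : Fin (n + 1) → ℝ))
      (volume.prod volume) volume := measurePreserving_piCons volume
  exact ((h3.comp h2).prod (measurePreserving_piCons ν)).comp h1

theorem consPath_fst_mem {n : ℕ} {t : ℝ} (q : (ℝ × ℝ) × ((Fin n → ℝ) × (Fin n → ℝ))) :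
    (consPath n q).1 ∈ timeSimplex (n + 1) t ↔
      q.1.1 ∈ Ioo 0 t ∧ q.2.1 ∈ timeSimplex n (t - q.1.1) := by
  rw [mem_timeSimplex_succ]
  simp [consPath]

/-- The path functional `P x s₁ P (x - z₁) (s₂ - s₁) ⋯ g (x - z₁ - ⋯ - zₙ)`. -/
def pathProd (P : ℝ → ℝ → B →L[ℝ] B) (g : ℝ → B) :
    (n : ℕ) → ℝ → ℝ → (Fin n → ℝ) → (Fin n → ℝ) → B
  | 0, x, t, _, _ => P x t (g x)
  | n + 1, x, t, s, z => P x (s 0) (pathProd P g n (x - z 0) (t - s 0)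
      (fun i => s i.succ - s 0) (fun i => z i.succ))

variable {P : ℝ → ℝ → B →L[ℝ] B} {g : ℝ → B}

theorem continuous_pathProd (hP : Continuous fun p : (ℝ × ℝ) × B => P p.1.1 p.1.2 p.2)
    (hg : Continuous g) (n : ℕ) :
    Continuous fun q : (ℝ × ℝ) × ((Fin n → ℝ) × (Fin n → ℝ)) =>
      pathProd P g n q.1.1 q.1.2 q.2.1 q.2.2 := by
  induction n with
  | zero =>
    exact hP.comp ((continuous_fst.fst.prodMk continuous_fst.snd).prodMk
      (hg.comp continuous_fst.fst))
  | succ n ih =>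
    have h1 := ih.comp (f := fun q : (ℝ × ℝ) × ((Fin (n + 1) → ℝ) × (Fin (n + 1) → ℝ)) =>
      ((q.1.1 - q.2.2 0, q.1.2 - q.2.1 0),
        ((fun i : Fin n => q.2.1 i.succ - q.2.1 0), fun i : Fin n => q.2.2 i.succ)))
      (by fun_prop)
    exact hP.comp (f := fun q : (ℝ × ℝ) × ((Fin (n + 1) → ℝ) × (Fin (n + 1) → ℝ)) =>
      ((q.1.1, q.2.1 0), pathProd P g n (q.1.1 - q.2.2 0) (q.1.2 - q.2.1 0)
        (fun i => q.2.1 i.succ - q.2.1 0) (fun i => q.2.2 i.succ)))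
      ((by fun_prop : Continuous fun q : (ℝ × ℝ) × ((Fin (n + 1) → ℝ) × (Fin (n + 1) → ℝ)) =>
        (q.1.1, q.2.1 0)).prodMk h1)

/-- A path with n jumps has n + 1 pieces, each costing a factor M, while the exponentials multiply
to e^{tm} because the durations add up to t. -/
theorem norm_pathProd_le {M m C : ℝ} (hb : ∀ x, HasGrowth (P x) M m) (hC : ∀ x, ‖g x‖ ≤ C) (n : ℕ) :
    ∀ (x t : ℝ), 0 ≤ t → ∀ s ∈ timeSimplex n t, ∀ z : Fin n → ℝ,
      ‖pathProd P g n x t s z‖ ≤ M ^ (n + 1) * C * Real.exp (t * m) := by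
  have hM := (hb 0).nonneg
  have hC0 : 0 ≤ C := (norm_nonneg _).trans (hC 0)
  induction n with
  | zero =>
    intro x t ht s _ z
    refine ((hb x).apply_le ht (g x)).trans ?_
    calc _ ≤ M * Real.exp (t * m) * C := by gcongr; exact hC x
      _ = _ := by ring
  | succ n ih =>
    intro x t ht s hs z
    obtain ⟨h0, h1⟩ := mem_timeSimplex_succ.1 hs
    refine ((hb x).apply_le h0.1.le _).trans ?_
    calc _ ≤ M * Real.exp (s 0 * m) * (M ^ (n + 1) * C * Real.exp ((t - s 0) * m)) := by
          gcongr
          exact ih _ _ (sub_nonneg.2 h0.2.le) _ h1 _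
      _ = M ^ (n + 1 + 1) * C * (Real.exp (s 0 * m) * Real.exp ((t - s 0) * m)) := by ring
      _ = _ := by rw [← Real.exp_add]; ring_nf

theorem integrable_pathProd (hP : Continuous fun p : (ℝ × ℝ) × B => P p.1.1 p.1.2 p.2)
    (hg : Continuous g) {M m C : ℝ} (hb : ∀ x, HasGrowth (P x) M m) (hC : ∀ x, ‖g x‖ ≤ C) (n : ℕ)
    (x : ℝ) {t : ℝ} (ht : 0 ≤ t) :
    Integrable (fun q => pathProd P g n x t q.1 q.2) (simplexMeasure ν n t) := by
  refine Integrable.mono' (integrable_const (M ^ (n + 1) * C * Real.exp (t * m))) ?_ ?_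
  · exact ((continuous_pathProd hP hg n).comp
      ((continuous_const (y := (x, t))).prodMk continuous_id)).aestronglyMeasurable
  · filter_upwards [ae_simplexMeasure ν n t] with q hq
    exact norm_pathProd_le hb hC n x t ht q.1 hq q.2

/-- Conditioning on the first jump. -/
theorem integral_pathProd_succ [CompleteSpace B]
    (hP : Continuous fun p : (ℝ × ℝ) × B => P p.1.1 p.1.2 p.2)
    (hg : Continuous g) {M m C : ℝ} (hb : ∀ x, HasGrowth (P x) M m) (hC : ∀ x, ‖g x‖ ≤ C) (n : ℕ)
    (x : ℝ) {t : ℝ} (ht : 0 ≤ t) :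
    ∫ q, pathProd P g (n + 1) x t q.1 q.2 ∂simplexMeasure ν (n + 1) t =
      ∫ s in Ioo 0 t, ∫ z, P x s (∫ q, pathProd P g n (x - z) (t - s) q.1 q.2
        ∂simplexMeasure ν n (t - s)) ∂ν := by
  have hms : ∀ n t, MeasurableSet (timeSimplex n t ×ˢ (univ : Set (Fin n → ℝ))) := fun n t =>
    (measurableSet_timeSimplex n t).prod MeasurableSet.univ
  -- Extending by zero off the simplex puts the integral on a full product space, where `consPath`
  -- preserves measure and Fubini applies.
  set H : (Fin (n + 1) → ℝ) × (Fin (n + 1) → ℝ) → B :=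
    (timeSimplex (n + 1) t ×ˢ univ).indicator fun q => pathProd P g (n + 1) x t q.1 q.2 with hH
  have hHi : Integrable H (volume.prod (Measure.pi fun _ : Fin (n + 1) => ν)) := by
    have := integrable_pathProd ν hP hg hb hC (n + 1) x ht
    rw [simplexMeasure_eq_restrict] at this
    exact (integrable_indicator_iff (hms _ _)).2 this
  have hΘ := measurePreserving_consPath ν n
  have hHΘ : Integrable (H ∘ consPath n)
      ((volume.prod ν).prod (volume.prod (Measure.pi fun _ : Fin n => ν))) :=
    hΘ.integrable_comp_of_integrable hHi
  have hinner : ∀ p : ℝ × ℝ, ∫ q, H (consPath n (p, q)) ∂(volume.prod (Measure.pi fun _ => ν)) =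
      (Ioo 0 t).indicator (fun s => P x s (∫ q, pathProd P g n (x - p.2) (t - s) q.1 q.2
        ∂simplexMeasure ν n (t - s))) p.1 := by
    rintro ⟨s, z⟩
    by_cases hs : s ∈ Ioo 0 t
    · rw [indicator_of_mem hs, ← ContinuousLinearMap.integral_comp_comm _
        (integrable_pathProd ν hP hg hb hC n _ (sub_nonneg.2 hs.2.le)),
        simplexMeasure_eq_restrict, ← integral_indicator (hms _ _)]
      congr 1
      ext q
      by_cases hq : q.1 ∈ timeSimplex n (t - s)
      · rw [indicator_of_mem (show q ∈ timeSimplex n (t - s) ×ˢ univ from ⟨hq, mem_univ _⟩), hH,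
          indicator_of_mem (show consPath n ((s, z), q) ∈ timeSimplex (n + 1) t ×ˢ univ from
            ⟨(consPath_fst_mem ((s, z), q)).2 ⟨hs, hq⟩, mem_univ _⟩)]
        simp [pathProd, consPath]
      · rw [indicator_of_notMem fun h => hq h.1, hH, indicator_of_notMem fun h => hq
          ((consPath_fst_mem ((s, z), q)).1 h.1).2]
    · rw [indicator_of_notMem hs]
      refine integral_eq_zero_of_ae (ae_of_all _ fun q => ?_)
      exact indicator_of_notMem (fun h => hs ((consPath_fst_mem ((s, z), q)).1 h.1).1) _
  have h1 := hHΘ.integral_prod_left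
  simp only [Function.comp_apply, hinner] at h1
  rw [simplexMeasure_eq_restrict, ← integral_indicator (hms _ _), ← hΘ.map_eq,
    integral_map hΘ.measurable.aemeasurable (by rw [hΘ.map_eq]; exact hHi.aestronglyMeasurable)]
  change ∫ q, (H ∘ consPath n) q ∂_ = _
  rw [integral_prod _ hHΘ]
  simp only [Function.comp_apply, hinner]
  rw [integral_prod _ h1, ← integral_indicator measurableSet_Ioo]
  congr 1
  ext s
  by_cases hs : s ∈ Ioo 0 t
  · simp only [indicator_of_mem hs]
  · simp only [indicator_of_notMem hs, integral_zero]

theorem integral_sub_pow (n : ℕ) (t : ℝ) :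
    ∫ s in (0 : ℝ)..t, (t - s) ^ n = t ^ (n + 1) / (n + 1) := by
  rw [intervalIntegral.integral_comp_sub_left (fun s => s ^ n)]
  simp

/-- The mass is the path integral of the constant 1 under the trivial semigroup on ℝ, so the
first-jump recursion computes it. -/
theorem simplexMeasure_real_univ (n : ℕ) :
    ∀ t : ℝ, 0 ≤ t → (simplexMeasure ν n t).real univ = (ν.real univ * t) ^ n / n.factorial := by
  set Q : ℝ → ℝ → ℝ →L[ℝ] ℝ := fun _ _ => ContinuousLinearMap.id ℝ ℝ with hQ
  have hQc : Continuous fun p : (ℝ × ℝ) × ℝ => Q p.1.1 p.1.2 p.2 := continuous_snd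
  have hQb : ∀ x, HasGrowth (Q x) 1 0 := by
    intro x t _
    simpa using ContinuousLinearMap.norm_id_le
  have hone : ∀ (n : ℕ) (x t : ℝ) (s z : Fin n → ℝ), pathProd Q (fun _ => 1) n x t s z = 1 := by
    intro n
    induction n with
    | zero => intro x t s z; rfl
    | succ n ih => intro x t s z; exact ih _ _ _ _
  have hint : ∀ (n : ℕ) (x t : ℝ), (simplexMeasure ν n t).real univ =
      ∫ q, pathProd Q (fun _ => 1) n x t q.1 q.2 ∂simplexMeasure ν n t := by
    intro n x t
    simp [hone]
  induction n with
  | zero =>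
    intro t _
    rw [simplexMeasure, Measure.real, ← univ_prod_univ, Measure.prod_prod, Measure.restrict_apply_univ]
    have : timeSimplex 0 t = univ := by
      ext s
      simp [timeSimplex, StrictMono]
    rw [this]
    simp [volume_pi]
  | succ n ih =>
    intro t ht
    rw [hint (n + 1) 0 t, integral_pathProd_succ ν hQc continuous_const hQb (C := 1) (by simp) n 0 ht,
      ← integral_Ioc_eq_integral_Ioo, ← intervalIntegral.integral_of_le ht]
    have h1 : ∀ s ∈ uIcc 0 t, (∫ z, Q 0 s (∫ q, pathProd Q (fun _ => 1) n (0 - z) (t - s) q.1 q.2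
        ∂simplexMeasure ν n (t - s)) ∂ν) =
        ν.real univ ^ (n + 1) / n.factorial * (t - s) ^ n := by
      intro s hs
      rw [uIcc_of_le ht] at hs
      have e : ∀ z, ∫ q, pathProd Q (fun _ => 1) n (0 - z) (t - s) q.1 q.2
          ∂simplexMeasure ν n (t - s) = (ν.real univ * (t - s)) ^ n / n.factorial := fun z => by
        rw [← hint n (0 - z), ih _ (sub_nonneg.2 hs.2)]
      simp only [e]
      simp only [hQ, ContinuousLinearMap.id_apply, integral_const, smul_eq_mul]
      rw [mul_pow]
      ring
    rw [intervalIntegral.integral_congr h1, intervalIntegral.integral_const_mul, integral_sub_pow,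
      Nat.factorial_succ]
    push_cast
    rw [mul_pow]
    field_simp

end PathMeasure

/-! ### Recursion for the time-ordered exponential; sorting paths by number of jumps -/

section PathDecomposition

variable {B : Type*} [NormedAddCommGroup B] [NormedSpace ℝ B]

theorem pathPos_zero (x : ℝ) (n : ℕ) (s z : Fin n → ℝ) :
    pathPos x (⟨n, (s, z)⟩ : JumpPath) (0 : Fin (n + 1)) = x := by
  simp [pathPos]

/-- Positions depend on the jump sizes alone, hence the free times `s'`; likewise the sizes are free
in `pathTime_succ`. -/
theorem pathPos_succ (x : ℝ) (n : ℕ) (s z : Fin (n + 1) → ℝ) (s' : Fin n → ℝ) (k : Fin (n + 1)) :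
    pathPos x (⟨n + 1, (s, z)⟩ : JumpPath) k.succ =
      pathPos (x - z 0) (⟨n, (s', fun i => z i.succ)⟩ : JumpPath) k := by
  simp only [pathPos]
  rw [Fin.sum_univ_succ]
  have h1 : ((0 : Fin (n + 1)).castSucc < k.succ) := by
    rw [Fin.castSucc_zero]
    exact k.succ_pos
  have h2 : ∀ i : Fin n, ((i.succ).castSucc < k.succ) ↔ i.castSucc < k := fun i => by
    rw [← Fin.succ_castSucc, Fin.succ_lt_succ_iff]
  rw [if_pos h1, sub_add_eq_sub_sub]
  simp only [h2]

theorem pathTime_zero (t : ℝ) (n : ℕ) (s z : Fin n → ℝ) :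
    pathTime t (⟨n, (s, z)⟩ : JumpPath) (0 : Fin (n + 2)) = 0 := rfl

theorem pathTime_succ (t : ℝ) (n : ℕ) (s z : Fin (n + 1) → ℝ) (z' : Fin n → ℝ) (k : Fin (n + 2)) :
    pathTime t (⟨n + 1, (s, z)⟩ : JumpPath) k.succ =
      s 0 + pathTime (t - s 0) (⟨n, (fun i => s i.succ - s 0, z')⟩ : JumpPath) k := by
  have h0 : pathTime t (⟨n + 1, (s, z)⟩ : JumpPath) k.succ =
      (Fin.snoc s t : Fin (n + 2) → ℝ) k := rfl
  rw [h0]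
  refine Fin.cases ?_ (fun i => ?_) k
  · rw [pathTime_zero, add_zero, ← Fin.castSucc_zero]
    exact Fin.snoc_castSucc (α := fun _ => ℝ) t s 0
  · have h1 : pathTime (t - s 0) (⟨n, (fun i => s i.succ - s 0, z')⟩ : JumpPath) i.succ =
        (Fin.snoc (fun i => s i.succ - s 0) (t - s 0) : Fin (n + 1) → ℝ) i := rfl
    rw [h1]
    refine Fin.lastCases ?_ (fun j => ?_) i
    · rw [Fin.succ_last, Fin.snoc_last, Fin.snoc_last]
      ring
    · rw [Fin.succ_castSucc, Fin.snoc_castSucc, Fin.snoc_castSucc]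
      ring

theorem timeOrderedExp_zero (S : ℝ → ℝ → B →L[ℝ] B) (x t : ℝ) (s z : Fin 0 → ℝ) :
    timeOrderedExp S x t (⟨0, (s, z)⟩ : JumpPath) = S x t := by
  change (List.ofFn fun k : Fin 1 =>
    S (pathPos x (⟨0, (s, z)⟩ : JumpPath) k) (pathTime t (⟨0, (s, z)⟩ : JumpPath) k.succ -
      pathTime t (⟨0, (s, z)⟩ : JumpPath) k.castSucc)).prod = _
  rw [List.ofFn_succ, List.ofFn_zero, List.prod_singleton, pathPos_zero]
  congr 1
  change (Fin.snoc s t : Fin 1 → ℝ) 0 - 0 = t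
  rw [sub_zero]
  exact Fin.snoc_last (α := fun _ => ℝ) t s

theorem timeOrderedExp_succ (S : ℝ → ℝ → B →L[ℝ] B) (x t : ℝ) (n : ℕ) (s z : Fin (n + 1) → ℝ) :
    timeOrderedExp S x t (⟨n + 1, (s, z)⟩ : JumpPath) = S x (s 0) *
      timeOrderedExp S (x - z 0) (t - s 0)
        (⟨n, (fun i => s i.succ - s 0, fun i => z i.succ)⟩ : JumpPath) := by
  have h : timeOrderedExp S x t (⟨n + 1, (s, z)⟩ : JumpPath) =
    (List.ofFn fun k : Fin (n + 2) =>
      S (pathPos x (⟨n + 1, (s, z)⟩ : JumpPath) k)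
        (pathTime t (⟨n + 1, (s, z)⟩ : JumpPath) k.succ -
        pathTime t (⟨n + 1, (s, z)⟩ : JumpPath) k.castSucc)).prod := rfl
  rw [h, List.ofFn_succ, List.prod_cons, pathPos_zero]
  congr 1
  · rw [pathTime_succ (z' := fun i => z i.succ), Fin.castSucc_zero, pathTime_zero, pathTime_zero]
    simp
  · unfold timeOrderedExp
    congr 2
    ext1 k
    rw [pathPos_succ (s' := fun i => s i.succ - s 0), pathTime_succ (z' := fun i => z i.succ),
      ← Fin.succ_castSucc, pathTime_succ (z' := fun i => z i.succ), add_sub_add_left_eq_sub]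

theorem pathEnd_succ (x : ℝ) (n : ℕ) (s z : Fin (n + 1) → ℝ) :
    pathEnd x (⟨n + 1, (s, z)⟩ : JumpPath) = pathEnd (x - z 0)
      (⟨n, (fun i => s i.succ - s 0, fun i => z i.succ)⟩ : JumpPath) := by
  have h : pathEnd x (⟨n + 1, (s, z)⟩ : JumpPath) =
    pathPos x (⟨n + 1, (s, z)⟩ : JumpPath) (Fin.last n).succ := rfl
  rw [h, pathPos_succ (s' := fun i => s i.succ - s 0)]
  rfl

/-- Peeling off the first factor gives the recursion defining `pathProd`. On the simplex all time
increments are nonnegative, so clamping changes nothing. -/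
theorem timeOrderedExp_apply_eq_pathProd (S : ℝ → ℝ → B →L[ℝ] B) (g : ℝ → B) (n : ℕ) :
    ∀ (x t : ℝ), 0 ≤ t → ∀ s ∈ timeSimplex n t, ∀ z : Fin n → ℝ,
      timeOrderedExp S x t (⟨n, (s, z)⟩ : JumpPath) (g (pathEnd x (⟨n, (s, z)⟩ : JumpPath))) =
        pathProd (fun x t => S x (max t 0)) g n x t s z := by
  induction n with
  | zero =>
    intro x t ht s _ z
    rw [timeOrderedExp_zero]
    simp only [pathProd, max_eq_left ht]
    congr 2
    exact pathPos_zero x 0 s z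
  | succ n ih =>
    intro x t ht s hs z
    obtain ⟨h0, h1⟩ := mem_timeSimplex_succ.1 hs
    rw [timeOrderedExp_succ, pathEnd_succ, mul_apply_eq_comp, ih _ _ (sub_nonneg.2 h0.2.le) _ h1]
    simp only [pathProd, max_eq_left h0.1.le]

theorem pathEnd_le {x : ℝ} {n : ℕ} {s z : Fin n → ℝ} (hz : ∀ i, 0 < z i) :
    pathEnd x (⟨n, (s, z)⟩ : JumpPath) ≤ x := by
  refine sub_le_self _ (Finset.sum_nonneg fun i _ => ?_)
  split_ifs
  · exact (hz i).le
  · exact le_rfl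

theorem jumpPath_mk_injective (n : ℕ) :
    Function.Injective fun p : (Fin n → ℝ) × (Fin n → ℝ) => (⟨n, p⟩ : JumpPath) :=
  fun _ _ h => eq_of_heq (Sigma.mk.inj h).2

theorem measurableEmbedding_sigmaMk (n : ℕ) :
    MeasurableEmbedding fun p : (Fin n → ℝ) × (Fin n → ℝ) => (⟨n, p⟩ : JumpPath) where
  injective := jumpPath_mk_injective n
  measurable := measurable_iff_le_map.2 (iInf_le _ n)
  measurableSet_image' := by
    intro A hA
    have key : ∀ m, MeasurableSet ((fun p => (⟨m, p⟩ : JumpPath)) ⁻¹'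
        ((fun p : (Fin n → ℝ) × (Fin n → ℝ) => (⟨n, p⟩ : JumpPath)) '' A)) := by
      intro m
      by_cases h : m = n
      · subst h
        rwa [preimage_image_eq _ (jumpPath_mk_injective m)]
      · convert MeasurableSet.empty
        rw [eq_empty_iff_forall_notMem]
        rintro p ⟨q, _, hq⟩
        exact h (congrArg Sigma.fst hq).symm
    exact MeasurableSpace.measurableSet_iInf.2 key

theorem pcMeasure_eq (ν : Measure ℝ) (t : ℝ) : pcMeasure ν t = Measure.sum fun n =>
    Measure.map (fun p : (Fin n → ℝ) × (Fin n → ℝ) => (⟨n, p⟩ : JumpPath))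
      (simplexMeasure ν n t) := rfl

variable (ν : Measure ℝ) [IsFiniteMeasure ν]

-- The n-jump part has mass (‖ν‖t)ⁿ/n!, which absorbs geometric growth of the integrand in n.
omit [NormedSpace ℝ B] in
theorem integrable_pcMeasure {t : ℝ} (ht : 0 ≤ t) {f : JumpPath → B}
    (hf : ∀ n, Integrable (fun q => f ⟨n, q⟩) (simplexMeasure ν n t)) {C M : ℝ}
    (hb : ∀ n, ∀ᵐ q ∂simplexMeasure ν n t, ‖f ⟨n, q⟩‖ ≤ C * M ^ n) :
    Integrable f (pcMeasure ν t) := by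
  rw [pcMeasure_eq]
  refine integrable_sum_measure (fun n => (measurableEmbedding_sigmaMk n).integrable_map_iff.2
    (hf n)) ?_
  refine Summable.of_nonneg_of_le (fun n => integral_nonneg fun _ => norm_nonneg _) (fun n => ?_)
    ((Real.summable_pow_div_factorial (M * (ν.real univ * t))).mul_left C)
  rw [(measurableEmbedding_sigmaMk n).integral_map]
  calc _ ≤ ∫ q, C * M ^ n ∂simplexMeasure ν n t :=
        integral_mono_ae (hf n).norm (integrable_const _) (hb n)
    _ = C * ((M * (ν.real univ * t)) ^ n / n.factorial) := by
        rw [integral_const, simplexMeasure_real_univ ν n t ht, smul_eq_mul, mul_pow M]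
        ring

omit [IsFiniteMeasure ν] in
theorem hasSum_integral_pcMeasure {t : ℝ} {f : JumpPath → B}
    (hf : Integrable f (pcMeasure ν t)) :
    HasSum (fun n => ∫ q, f ⟨n, q⟩ ∂simplexMeasure ν n t) (∫ ω, f ω ∂pcMeasure ν t) := by
  rw [pcMeasure_eq] at hf ⊢
  have := hasSum_integral_measure hf
  simpa only [(measurableEmbedding_sigmaMk _).integral_map] using this

end PathDecomposition

/-! ### The Dyson series and its Laplace transform -/

section Dyson

variable {E : Type*} [NormedAddCommGroup E] [NormedSpace ℝ E]

/-- The terms of the Dyson series of a perturbed semigroup. -/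
noncomputable def dyson (T : ℝ → E →L[ℝ] E) (N : E →L[ℝ] E) (g : E) : ℕ → ℝ → E
  | 0, t => T (max t 0) g
  | n + 1, t => ∫ s in (0 : ℝ)..max t 0, T (max s 0) (N (dyson T N g n (max t 0 - s)))

variable {T : ℝ → E →L[ℝ] E} {N : E →L[ℝ] E} {M m : ℝ}

theorem continuous_dyson_integrand (hT : IsC0Semigroup T) (hg : HasGrowth T M m) {u : ℝ → E}
    (hu : Continuous u) : Continuous fun p : ℝ × ℝ => T (max p.2 0) (N (u (p.1 - p.2))) :=
  (hT.continuous_clamp hg).comp (continuous_snd.prodMk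
    (N.continuous.comp (hu.comp (continuous_fst.sub continuous_snd))))

theorem continuous_dyson (hT : IsC0Semigroup T) (hg : HasGrowth T M m) (g : E) (n : ℕ) :
    Continuous (dyson T N g n) := by
  induction n with
  | zero => exact (hT.continuous_clamp hg).comp (continuous_id.prodMk continuous_const)
  | succ n ih =>
    refine intervalIntegral.continuous_parametric_intervalIntegral_of_continuous
      (f := fun t s => T (max s 0) (N (dyson T N g n (max t 0 - s)))) ?_
      (continuous_id.max continuous_const)
    exact (continuous_dyson_integrand hT hg ih).comp
      (((continuous_fst (X := ℝ) (Y := ℝ)).max continuous_const).prodMk continuous_snd)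

theorem dyson_succ_apply {t : ℝ} (ht : 0 ≤ t) (g : E) (n : ℕ) :
    dyson T N g (n + 1) t = ∫ s in (0 : ℝ)..t, T (max s 0) (N (dyson T N g n (t - s))) := by
  simp only [dyson, max_eq_left ht]

/-- The Laplace transform of a Volterra convolution with the semigroup. -/
theorem laplace_convolution [CompleteSpace E] (hT : IsC0Semigroup T) (hg : HasGrowth T M m) {c : ℝ}
    (hc : m < c) {R : E →L[ℝ] E}
    (hR : ∀ u, R u = ∫ t in Ioi (0 : ℝ), Real.exp (-c * t) • T (max t 0) u) {φ : ℝ → E}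
    (hφ : Continuous φ) (hφi : IntegrableOn (fun t => Real.exp (-c * t) • φ t) (Ioi 0)) :
    IntegrableOn (fun t => Real.exp (-c * t) •
        ∫ s in (0 : ℝ)..max t 0, T (max s 0) (N (φ (max t 0 - s)))) (Ioi 0) ∧
      ∫ t in Ioi (0 : ℝ), Real.exp (-c * t) •
        ∫ s in (0 : ℝ)..max t 0, T (max s 0) (N (φ (max t 0 - s))) =
      R (N (∫ t in Ioi (0 : ℝ), Real.exp (-c * t) • φ t)) := by
  have hM := hg.nonneg
  -- In the variables (r, s) = (t - s, s) the convolution decouples over the quadrant, and the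
  -- exponential splits as e^{-cr} e^{-cs}.
  set ψ : ℝ × ℝ → E := fun p => Real.exp (-c * (p.1 + p.2)) • T (max p.2 0) (N (φ p.1)) with hψ
  have hψc : Continuous ψ := by
    refine Continuous.smul (by fun_prop) ?_
    exact (hT.continuous_clamp hg).comp (continuous_snd.prodMk
      (N.continuous.comp (hφ.comp continuous_fst)))
  have hψi : Integrable ψ ((volume.restrict (Ioi 0)).prod (volume.restrict (Ioi 0))) := by
    have hi : IntegrableOn (fun t : ℝ => M * Real.exp ((m - c) * t)) (Ioi 0) :=
      (integrableOn_exp_mul_Ioi (by linarith) 0).const_mul M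
    refine (Integrable.mul_prod (hφi.norm.const_mul ‖N‖) hi).mono' hψc.aestronglyMeasurable ?_
    rw [Measure.prod_restrict]
    filter_upwards [ae_restrict_mem (measurableSet_Ioi.prod measurableSet_Ioi)] with p hp
    have h2 : (0 : ℝ) < p.2 := hp.2
    simp only [hψ]
    rw [norm_smul, norm_smul, Real.norm_of_nonneg (Real.exp_pos _).le,
      Real.norm_of_nonneg (Real.exp_pos _).le, max_eq_left h2.le]
    calc _ ≤ Real.exp (-c * (p.1 + p.2)) * (M * Real.exp (p.2 * m) * (‖N‖ * ‖φ p.1‖)) := by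
          gcongr
          refine (hg.apply_le h2.le _).trans ?_
          gcongr
          exact N.le_opNorm _
      _ = ‖N‖ * ‖φ p.1‖ * M * (Real.exp (-c * (p.1 + p.2)) * Real.exp (p.2 * m)) := by ring
      _ = ‖N‖ * ‖φ p.1‖ * M * (Real.exp (-c * p.1) * Real.exp ((m - c) * p.2)) := by
          rw [← Real.exp_add, ← Real.exp_add]; ring_nf
      _ = _ := by ring
  set χ : ℝ × ℝ → E := (Ioi (0 : ℝ) ×ˢ Ioi (0 : ℝ)).indicator ψ with hχ
  have hms : MeasurableSet (Ioi (0 : ℝ) ×ˢ Ioi (0 : ℝ)) := measurableSet_Ioi.prod measurableSet_Ioi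
  have hχi : Integrable χ (volume.prod volume) := by
    rw [Measure.prod_restrict] at hψi
    exact (integrable_indicator_iff hms).2 hψi
  have hshear := measurePreserving_sub_prod (volume : Measure ℝ) (volume : Measure ℝ)
  have hHi := hshear.integrable_comp_of_integrable hχi
  have hinner : ∀ t : ℝ, ∫ s, χ (t - s, s) = (Ioi (0 : ℝ)).indicator (fun t =>
      Real.exp (-c * t) • ∫ s in (0 : ℝ)..max t 0, T (max s 0) (N (φ (max t 0 - s)))) t := by
    intro t
    by_cases ht : 0 < t
    · rw [indicator_of_mem (mem_Ioi.2 ht), max_eq_left ht.le, intervalIntegral.integral_of_le ht.le,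
        integral_Ioc_eq_integral_Ioo, ← integral_smul, ← integral_indicator measurableSet_Ioo]
      congr 1
      ext s
      by_cases hs : s ∈ Ioo 0 t
      · rw [indicator_of_mem hs, hχ, indicator_of_mem (show (t - s, s) ∈ Ioi (0 : ℝ) ×ˢ Ioi (0 : ℝ)
          from ⟨sub_pos.2 hs.2, hs.1⟩)]
        simp [hψ]
      · rw [indicator_of_notMem hs, hχ, indicator_of_notMem fun h => hs ⟨h.2, sub_pos.1 h.1⟩]
    · rw [indicator_of_notMem (by simpa using ht)]
      refine integral_eq_zero_of_ae (ae_of_all _ fun s => ?_)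
      refine indicator_of_notMem (fun h => ht ?_) _
      have h1 : 0 < t - s := h.1
      have h2 : 0 < s := h.2
      linarith
  constructor
  · rw [← integrable_indicator_iff measurableSet_Ioi]
    have h1 := hHi.integral_prod_left
    simp only [Function.comp_apply, hinner] at h1
    exact h1
  · rw [← integral_indicator measurableSet_Ioi]
    simp only [← hinner]
    have h1 := integral_prod _ hHi
    simp only [Function.comp_apply] at h1
    rw [← h1]
    have h2 : ∫ z : ℝ × ℝ, χ (z.1 - z.2, z.2) ∂(volume.prod volume) =
        ∫ z, χ z ∂(volume.prod volume) := by
      conv_rhs => rw [← hshear.map_eq]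
      rw [integral_map hshear.measurable.aemeasurable
        (by rw [hshear.map_eq]; exact hχi.aestronglyMeasurable)]
    rw [h2, hχ, integral_indicator hms, ← Measure.prod_restrict, integral_prod _ hψi,
      ← ContinuousLinearMap.integral_comp_comm N hφi, ← ContinuousLinearMap.integral_comp_comm R
        (N.integrable_comp hφi)]
    congr 1
    ext r
    rw [hR, hψ]
    congr 1
    ext s
    simp only [map_smul]
    rw [smul_smul, ← Real.exp_add]
    ring_nf

/-- Each term is the convolution of the semigroup with N applied to the preceding one, and the
Laplace transform turns that convolution into the product R N. -/
theorem laplace_dyson [CompleteSpace E] (hT : IsC0Semigroup T) (hg : HasGrowth T M m) {c : ℝ}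
    (hc : m < c) {R : E →L[ℝ] E}
    (hR : ∀ u, R u = ∫ t in Ioi (0 : ℝ), Real.exp (-c * t) • T (max t 0) u)
    (hRi : ∀ u, IntegrableOn (fun t => Real.exp (-c * t) • T (max t 0) u) (Ioi 0))
    (g : E) (n : ℕ) :
    IntegrableOn (fun t => Real.exp (-c * t) • dyson T N g n t) (Ioi 0) ∧
      ∫ t in Ioi (0 : ℝ), Real.exp (-c * t) • dyson T N g n t = ((R * N) ^ n) (R g) := by
  induction n with
  | zero => exact ⟨hRi g, (hR g).symm⟩
  | succ n ih =>
    have h := laplace_convolution (N := N) hT hg hc hR (continuous_dyson hT hg g n) ih.1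
    refine ⟨h.1, h.2.trans ?_⟩
    rw [ih.2, pow_succ']
    rfl

end Dyson

open ZeroAtInftyContinuousMap

/-! ### Path integrals as Dyson terms -/

section PathFormula

variable {B D : Type*} [NormedAddCommGroup B] [NormedSpace ℝ B] [CompleteSpace B]
  [NormedAddCommGroup D] [NormedSpace ℝ D] {j : D →L[ℝ] B} {A : ℝ → D →L[ℝ] B}
  {S : ℝ → ℝ → B →L[ℝ] B} {U : ℝ → ℝ → D →L[ℝ] D}

/-- The pointwise semigroup on `C_∞(ℝ, B)` of a regular family. -/
noncomputable def RegularFamily.mult (h : RegularFamily j A S U) : ℝ → C₀(ℝ, B) →L[ℝ] C₀(ℝ, B) :=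
  multSemigroup S h.isBoundedStronglyContinuous

theorem RegularFamily.mult_apply (h : RegularFamily j A S U) (t : ℝ) (f : C₀(ℝ, B)) (x : ℝ) :
    h.mult t f x = S x (max t 0) (f x) := rfl

variable (ν : Measure ℝ) [IsFiniteMeasure ν] {M m : ℝ}

omit [CompleteSpace B] in
theorem hasGrowth_clamp (hg : ∀ x, HasGrowth (S x) M m) (x : ℝ) :
    HasGrowth (fun t => S x (max t 0)) M m := by
  intro t ht
  simp only [max_eq_left ht]
  exact hg x t ht

theorem RegularFamily.dyson_succ_apply (h : RegularFamily j A S U) (g : C₀(ℝ, B)) (n : ℕ) (x : ℝ)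
    {t : ℝ} (ht : 0 ≤ t) :
    dyson h.mult (jumpCLM B ν) g (n + 1) t x =
      ∫ s in (0 : ℝ)..t, S x (max s 0) (jumpCLM B ν (dyson h.mult (jumpCLM B ν) g n (t - s)) x) := by
  obtain ⟨M, m, hg⟩ := exists_growth h.semigroup h.bounded
  have hgm := hasGrowth_multSemigroup h.isBoundedStronglyContinuous hg
  rw [_root_.dyson_succ_apply ht]
  have hc : Continuous fun s : ℝ =>
      h.mult (max s 0) (jumpCLM B ν (dyson h.mult (jumpCLM B ν) g n (t - s))) :=
    (continuous_dyson_integrand h.isC0Semigroup_mult hgm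
      (continuous_dyson h.isC0Semigroup_mult hgm g n)).comp
      ((continuous_const (y := t)).prodMk continuous_id)
  have h1 := (evalCLM B x).intervalIntegral_comp_comm (hc.intervalIntegrable (μ := volume) 0 t)
  rw [evalCLM_apply] at h1
  rw [← h1]
  refine intervalIntegral.integral_congr fun s _ => ?_
  simp only [evalCLM_apply, h.mult_apply, max_eq_left (le_max_right s (0 : ℝ))]

/-- Both sides obey the same recursion: evolve for time s, jump by z, continue for the remaining
time t - s. Averaging over z is the jump operator. -/
theorem RegularFamily.integral_pathProd (h : RegularFamily j A S U) (hg : ∀ x, HasGrowth (S x) M m)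
    (g : C₀(ℝ, B)) (n : ℕ) :
    ∀ (x t : ℝ), 0 ≤ t →
      ∫ q, pathProd (fun x t => S x (max t 0)) g n x t q.1 q.2 ∂simplexMeasure ν n t =
        dyson h.mult (jumpCLM B ν) g n t x := by
  induction n with
  | zero =>
    intro x t ht
    have h1 := simplexMeasure_real_univ ν 0 t ht
    simp only [pathProd, integral_const, h1]
    simp [dyson, h.mult_apply]
  | succ n ih =>
    intro x t ht
    rw [integral_pathProd_succ (g := g) ν h.continuous_clamp (map_continuous g) (hasGrowth_clamp hg)
      g.norm_apply_le n x ht, h.dyson_succ_apply ν g n x ht,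
      intervalIntegral.integral_of_le ht, integral_Ioc_eq_integral_Ioo]
    refine setIntegral_congr_fun measurableSet_Ioo fun s hs => ?_
    simp only [ih _ _ (sub_nonneg.2 hs.2.le)]
    rw [jumpCLM_apply, ContinuousLinearMap.integral_comp_comm _
      (ZeroAtInftyContinuousMap.integrable_shift ν _ x)]

variable {ν}

/-- Along the recursion e^{sm} and e^{(t-s)m} combine to e^{tm}, and ∫₀ᵗ (t-s)ⁿ ds supplies the
factorial. The sum over n grows like e^{t(m + Mκ)} with κ the Laplace mass at θ. -/
theorem RegularFamily.norm_dyson_le (h : RegularFamily j A S U) (hg : ∀ x, HasGrowth (S x) M m)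
    (hν : ν (Iic 0) = 0) {θ C : ℝ} (hθ : 0 ≤ θ) {g : C₀(ℝ, B)}
    (hC : ∀ x, ‖g x‖ ≤ C * Real.exp (θ * x)) (n : ℕ) :
    ∀ (t : ℝ), 0 ≤ t → ∀ x, ‖dyson h.mult (jumpCLM B ν) g n t x‖ ≤
      M * Real.exp (t * m) * ((M * laplaceMass ν θ * t) ^ n / n.factorial) * C *
        Real.exp (θ * x) := by
  have hM := (hg 0).nonneg
  have hK := laplaceMass_nonneg ν θ
  have hC0 : 0 ≤ C := by
    have := (norm_nonneg _).trans (hC 0)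
    simpa using this
  induction n with
  | zero =>
    intro t ht x
    simp only [dyson, h.mult_apply, max_eq_left ht]
    refine ((hg x).apply_le ht _).trans ?_
    calc _ ≤ M * Real.exp (t * m) * (C * Real.exp (θ * x)) := by gcongr; exact hC x
      _ = _ := by simp; ring
  | succ n ih =>
    intro t ht x
    rw [h.dyson_succ_apply ν g n x ht]
    set L := M * Real.exp (t * m) * C * Real.exp (θ * x) * (M * laplaceMass ν θ) ^ (n + 1) /
      n.factorial with hL
    have hc : Continuous fun s : ℝ => L * (t - s) ^ n := by fun_prop
    refine (intervalIntegral.norm_integral_le_of_norm_le ht (ae_of_all _ fun s hs => ?_)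
      (hc.intervalIntegrable _ _)).trans_eq ?_
    · have hts : 0 ≤ t - s := sub_nonneg.2 hs.2
      have h1 := norm_jumpCLM_apply_le hν hθ (ih (t - s) hts) x
      rw [max_eq_left hs.1.le]
      refine ((hg x).apply_le hs.1.le _).trans ?_
      refine (mul_le_mul_of_nonneg_left h1 (by positivity)).trans_eq ?_
      rw [hL, mul_pow (M * laplaceMass ν θ) (t - s), pow_succ (M * laplaceMass ν θ),
        show t * m = s * m + (t - s) * m by ring, Real.exp_add]
      ring
    · rw [intervalIntegral.integral_const_mul, integral_sub_pow, hL, Nat.factorial_succ,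
        mul_pow (M * laplaceMass ν θ) t]
      push_cast
      field_simp

theorem RegularFamily.integrable_timeOrderedExp (h : RegularFamily j A S U)
    (hg : ∀ x, HasGrowth (S x) M m) (g : C₀(ℝ, B)) (x : ℝ) {t : ℝ} (ht : 0 ≤ t) :
    Integrable (fun ω => timeOrderedExp S x t ω (g (pathEnd x ω))) (pcMeasure ν t) := by
  have heq : ∀ n, ∀ᵐ q ∂simplexMeasure ν n t,
      timeOrderedExp S x t (⟨n, q⟩ : JumpPath) (g (pathEnd x (⟨n, q⟩ : JumpPath))) =
        pathProd (fun x t => S x (max t 0)) g n x t q.1 q.2 := by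
    intro n
    filter_upwards [ae_simplexMeasure ν n t] with q hq
    exact timeOrderedExp_apply_eq_pathProd S g n x t ht q.1 hq q.2
  refine integrable_pcMeasure ν ht (fun n => ?_) (C := M * ‖g‖ * Real.exp (t * m)) (M := M)
    fun n => ?_
  · exact (integrable_pathProd ν h.continuous_clamp g.continuous (hasGrowth_clamp hg)
      g.norm_apply_le n x ht).congr ((heq n).mono fun q hq => hq.symm)
  · filter_upwards [heq n, ae_simplexMeasure ν n t] with q hq hq'
    rw [hq]
    refine (norm_pathProd_le (hasGrowth_clamp hg) g.norm_apply_le n x t ht q.1 hq' q.2).trans_eq ?_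
    ring

theorem RegularFamily.hasSum_pathExpectation (h : RegularFamily j A S U)
    (hg : ∀ x, HasGrowth (S x) M m) (g : C₀(ℝ, B)) (x : ℝ) {t : ℝ} (ht : 0 ≤ t) :
    HasSum (fun n => Real.exp (-t * ν.real univ) • dyson h.mult (jumpCLM B ν) g n t x)
      (pathExpectation ν S g x t) := by
  have h1 := (hasSum_integral_pcMeasure ν (h.integrable_timeOrderedExp (ν := ν) hg g x ht)).const_smul
    (Real.exp (-t * ν.real univ))
  rw [pathExpectation, pathProb, integral_smul_measure, ENNReal.toReal_ofReal (Real.exp_pos _).le]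
  convert h1 using 2 with n
  rw [← h.integral_pathProd ν hg g n x t ht]
  congr 1
  refine integral_congr_ae ?_
  filter_upwards [ae_simplexMeasure ν n t] with q hq
  exact (timeOrderedExp_apply_eq_pathProd S g n x t ht q.1 hq q.2).symm

theorem hasSum_pow_div_factorial (r : ℝ) : HasSum (fun n : ℕ => r ^ n / n.factorial) (Real.exp r) := by
  rw [Real.exp_eq_exp_ℝ]
  exact NormedSpace.expSeries_div_hasSum_exp r

/-- The Laplace transform of the path integral is the Neumann series of the resolvent. -/
theorem RegularFamily.isLaplacePathIntegral (h : RegularFamily j A S U)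
    (hg : ∀ x, HasGrowth (S x) M m) (hν : ν (Iic 0) = 0) {lam θ C : ℝ} (hθ : 0 ≤ θ)
    {g : C₀(ℝ, B)} (hC : ∀ x, ‖g x‖ ≤ C * Real.exp (θ * x))
    (hlam : m + M * laplaceMass ν θ < lam + ν.real univ) {R : C₀(ℝ, B) →L[ℝ] C₀(ℝ, B)}
    (hR : ∀ u, IntegrableOn (fun t => Real.exp (-(lam + ν.real univ) * t) • h.mult (max t 0) u)
      (Ioi 0) ∧ R u = ∫ t in Ioi (0 : ℝ), Real.exp (-(lam + ν.real univ) * t) • h.mult (max t 0) u)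
    {x : ℝ} {v : B} (hv : HasSum (fun n => ((R * jumpCLM B ν) ^ n) (R g) x) v) :
    IsLaplacePathIntegral ν S lam g x v := by
  have hM := (hg 0).nonneg
  have hK := laplaceMass_nonneg ν θ
  have hC0 : 0 ≤ C := by
    have := (norm_nonneg _).trans (hC 0)
    simpa using this
  -- The normalising factor e^{-t‖ν‖} of the path measure shifts the Laplace variable from λ to λ +
  -- ‖ν‖.
  set c := lam + ν.real univ with hcdef
  have hc : m < c := (le_add_of_nonneg_right (mul_nonneg hM hK)).trans_lt hlam
  have hgm := hasGrowth_multSemigroup h.isBoundedStronglyContinuous hg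
  have hlap := laplace_dyson (N := jumpCLM B ν) h.isC0Semigroup_mult hgm hc
    (fun u => (hR u).2) (fun u => (hR u).1) g
  set F : ℕ → ℝ → B := fun n t => Real.exp (-c * t) • dyson h.mult (jumpCLM B ν) g n t x with hF
  have hFint : ∀ n, ∫ t in Ioi (0 : ℝ), F n t = ((R * jumpCLM B ν) ^ n) (R g) x := by
    intro n
    have h1 := (evalCLM B x).integral_comp_comm (hlap n).1
    have h2 := (hlap n).2
    change ∫ t in Ioi (0 : ℝ), Real.exp (-c * t) • dyson h.mult (jumpCLM B ν) g n t = _ at h2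
    rw [← evalCLM_apply, ← h2]
    exact h1
  have hFc : ∀ n, Continuous (F n) := by
    intro n
    refine Continuous.smul (by fun_prop) ?_
    exact (evalCLM B x).continuous.comp (continuous_dyson h.isC0Semigroup_mult hgm g n)
  have hFsum : ∀ᵐ t ∂(volume.restrict (Ioi (0 : ℝ))), HasSum (fun n => F n t)
      (Real.exp (-lam * t) • pathExpectation ν S g x t) := by
    filter_upwards [ae_restrict_mem measurableSet_Ioi] with t ht
    have h1 := (h.hasSum_pathExpectation (ν := ν) hg g x (le_of_lt ht)).const_smul
      (Real.exp (-lam * t))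
    convert h1 using 2 with n
    rw [smul_smul, ← Real.exp_add, hF]
    simp only
    congr 2
    rw [hcdef]; ring
  set bound : ℕ → ℝ → ℝ := fun n t => Real.exp (-c * t) * (M * Real.exp (t * m) *
    ((M * laplaceMass ν θ * t) ^ n / n.factorial) * C * Real.exp (θ * x)) with hbound
  -- The summed majorant is one exponential whose rate is negative precisely by `hlam`.
  have hbsum : ∀ t, HasSum (fun n => bound n t)
      (M * C * Real.exp (θ * x) * Real.exp ((m + M * laplaceMass ν θ - c) * t)) := by
    intro t
    have h1 := (hasSum_pow_div_factorial (M * laplaceMass ν θ * t)).mul_left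
      (Real.exp (-c * t) * (M * Real.exp (t * m)) * C * Real.exp (θ * x))
    have h2 : M * C * Real.exp (θ * x) * Real.exp ((m + M * laplaceMass ν θ - c) * t) =
        Real.exp (-c * t) * (M * Real.exp (t * m)) * C * Real.exp (θ * x) *
          Real.exp (M * laplaceMass ν θ * t) := by
      rw [show (m + M * laplaceMass ν θ - c) * t = -c * t + t * m + M * laplaceMass ν θ * t by ring,
        Real.exp_add, Real.exp_add]
      ring
    rw [h2]
    refine h1.congr_fun fun n => ?_
    simp only [hbound]
    ring
  have hFb : ∀ n, ∀ᵐ t ∂(volume.restrict (Ioi (0 : ℝ))), ‖F n t‖ ≤ bound n t := by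
    intro n
    filter_upwards [ae_restrict_mem measurableSet_Ioi] with t ht
    rw [hF, hbound]
    simp only
    rw [norm_smul, Real.norm_of_nonneg (Real.exp_pos _).le]
    gcongr
    exact h.norm_dyson_le hg hν hθ hC n t (le_of_lt ht) x
  have hbi : Integrable (fun t => M * C * Real.exp (θ * x) *
      Real.exp ((m + M * laplaceMass ν θ - c) * t)) (volume.restrict (Ioi (0 : ℝ))) :=
    (integrableOn_exp_mul_Ioi (by linarith) 0).const_mul _
  refine ⟨fun t ht => ?_, ?_, ?_⟩
  · exact (h.integrable_timeOrderedExp hg g x ht).smul_measure ENNReal.ofReal_ne_top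
  · refine hbi.mono' ?_ ?_
    · refine aestronglyMeasurable_of_tendsto_ae atTop
        (f := fun (n : ℕ) t => ∑ i ∈ Finset.range n, F i t) (fun n => ?_) ?_
      · exact (continuous_finsetSum _ fun i _ => hFc i).aestronglyMeasurable
      · filter_upwards [hFsum] with t ht
        exact ht.tendsto_sum_nat
    · filter_upwards [hFsum, ae_all_iff.2 hFb] with t ht hb
      rw [← ht.tsum_eq]
      exact tsum_of_norm_bounded (hbsum t) hb
  · have h1 := hasSum_integral_of_dominated_convergence bound
      (fun n => (hFc n).aestronglyMeasurable) hFb (ae_of_all _ fun t => (hbsum t).summable)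
      (by simpa only [fun t => (hbsum t).tsum_eq] using hbi) hFsum
    simp only [hFint] at h1
    exact hv.unique h1

omit [CompleteSpace B] in
/-- The path integral only depends on the values of the function to the left of the starting
point. -/
theorem IsLaplacePathIntegral.congr (hν : ν (Iic 0) = 0) {lam : ℝ} {g g' : ℝ → B} {x : ℝ} {v : B}
    (h : IsLaplacePathIntegral ν S lam g x v) (hgg' : ∀ y ≤ x, g y = g' y) :
    IsLaplacePathIntegral ν S lam g' x v := by
  have hae : ∀ t, (fun ω => timeOrderedExp S x t ω (g (pathEnd x ω))) =ᵐ[pathProb ν t]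
      fun ω => timeOrderedExp S x t ω (g' (pathEnd x ω)) := by
    intro t
    refine Measure.ae_smul_measure ?_ _
    rw [pcMeasure_eq]
    refine Measure.ae_sum_iff.2 fun n => ?_
    rw [(measurableEmbedding_sigmaMk n).ae_map_iff]
    filter_upwards [ae_simplexMeasure_pos hν n t] with q hq
    rw [hgg' _ (pathEnd_le hq)]
  have hE : ∀ t, pathExpectation ν S g x t = pathExpectation ν S g' x t := fun t =>
    integral_congr_ae (hae t)
  refine ⟨fun t ht => (h.1 t ht).congr (hae t), ?_, ?_⟩
  · simpa only [hE] using h.2.1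
  · simpa only [hE] using h.2.2

end PathFormula

open ZeroAtInftyContinuousMap

/-! ### Neumann series on a quotient -/

section Neumann

variable {X Y : Type*} [NormedAddCommGroup X] [NormedSpace ℝ X] [NormedAddCommGroup Y]
  [NormedSpace ℝ Y] [CompleteSpace Y]

/-- Neumann series for an operator on a quotient `Y` of `X` with a continuous lift. -/
theorem exists_neumann {res : X →L[ℝ] Y} {ext : Y →L[ℝ] X} (hre : ∀ y, res (ext y) = y)
    {Q : X →L[ℝ] X} (hQ : ∀ f, res (Q (ext (res f))) = res (Q f)) (R₀ : X →L[ℝ] X)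
    {C q : ℝ} (hC : 0 ≤ C) (hq0 : 0 ≤ q) (hq1 : q < 1)
    (hs : ∀ (n : ℕ) y, ‖res ((Q ^ n) (ext y))‖ ≤ q ^ n * C * ‖y‖) :
    ∃ R : Y →L[ℝ] Y, (∀ g h, h = R g ↔ h = res (Q (ext h)) + res (R₀ (ext g))) ∧
      ∀ g, HasSum (fun n => res ((Q ^ n) (R₀ (ext g)))) (R g) := by
  set P : Y →L[ℝ] Y := res.comp (Q.comp ext)
  have hQn : ∀ (n : ℕ) f, res ((Q ^ n) (ext (res f))) = res ((Q ^ n) f) := by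
    intro n
    induction n with
    | zero => intro f; exact hre _
    | succ n ih =>
      intro f
      rw [pow_succ', mul_apply_eq_comp, mul_apply_eq_comp, ← hQ, ih, hQ]
  have hPn : ∀ n : ℕ, P ^ n = res.comp ((Q ^ n).comp ext) := by
    intro n
    induction n with
    | zero => ext y; exact (hre y).symm
    | succ n ih =>
      ext y
      rw [pow_succ', mul_apply_eq_comp, ih, pow_succ']
      exact hQ _
  -- P itself may have norm at least 1 when C > 1; only its powers decay geometrically. The constant
  -- C leaves room for the comparison of weighted and unweighted norms.
  have hs' : Summable fun n : ℕ => P ^ n :=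
    .of_norm_bounded ((summable_geometric_of_lt_one hq0 hq1).mul_right C) fun n => by
      rw [hPn]
      exact ContinuousLinearMap.opNorm_le_bound _ (by positivity) (hs n)
  have h1 : (1 - P) * ∑' n : ℕ, P ^ n = 1 := hs'.one_sub_mul_tsum_pow
  have h2 : (∑' n : ℕ, P ^ n) * (1 - P) = 1 := hs'.tsum_pow_mul_one_sub
  refine ⟨(∑' n : ℕ, P ^ n).comp (res.comp (R₀.comp ext)), fun g h => ⟨?_, fun hh => ?_⟩,
    fun g => ?_⟩
  · rintro rfl
    have h3 := DFunLike.congr_fun h1 (res (R₀ (ext g)))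
    rw [mul_apply_eq_comp] at h3
    exact sub_eq_iff_eq_add'.1 h3
  · have h3 := DFunLike.congr_fun h2 h
    rw [mul_apply_eq_comp] at h3
    have h4 : (1 - P) h = res (R₀ (ext g)) := sub_eq_iff_eq_add'.2 hh
    rw [h4] at h3
    exact h3.symm
  · have h3 := hs'.hasSum.mapL (ContinuousLinearMap.apply ℝ Y (res (R₀ (ext g))))
    refine h3.congr_fun fun n => ?_
    rw [ContinuousLinearMap.apply_apply, hPn]
    exact (hQn n _).symm

end Neumann

/-! ### Restricted and induced semigroups -/

section KilledSemigroups

variable {B : Type*} [NormedAddCommGroup B] [NormedSpace ℝ B] {a b : ℝ}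

/-- An operator on `C_∞(ℝ, B)` preserving `C_{kill(a)}`, restricted to this subspace. -/
noncomputable def killedCLM (T : C₀(ℝ, B) →L[ℝ] C₀(ℝ, B)) (hT : ∀ f ∈ CKill B a, T f ∈ CKill B a) :
    CKill B a →L[ℝ] CKill B a :=
  (T.comp (CKill B a).subtypeL).codRestrict (CKill B a) fun f => hT f f.2

@[simp] theorem coe_killedCLM (T : C₀(ℝ, B) →L[ℝ] C₀(ℝ, B))
    (hT : ∀ f ∈ CKill B a, T f ∈ CKill B a) (f : CKill B a) :
    (killedCLM T hT f : C₀(ℝ, B)) = T f := rfl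

theorem coe_killedCLM_pow (T : C₀(ℝ, B) →L[ℝ] C₀(ℝ, B))
    (hT : ∀ f ∈ CKill B a, T f ∈ CKill B a) (n : ℕ) (f : CKill B a) :
    ((killedCLM T hT ^ n) f : C₀(ℝ, B)) = (T ^ n) f := by
  induction n with
  | zero => rfl
  | succ n ih => rw [pow_succ', pow_succ', mul_apply_eq_comp, mul_apply_eq_comp, coe_killedCLM, ih]

variable {Φ : ℝ → C₀(ℝ, B) →L[ℝ] C₀(ℝ, B)}

/-- The restriction of a semigroup to `C_{kill(a)}([a,∞), B)`. -/
noncomputable def killedSemigroup (Φ : ℝ → C₀(ℝ, B) →L[ℝ] C₀(ℝ, B))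
    (hinv : ∀ t, 0 ≤ t → ∀ f ∈ CKill B a, Φ t f ∈ CKill B a) (t : ℝ) :
    CKill B a →L[ℝ] CKill B a :=
  killedCLM (Φ (max t 0)) (hinv _ (le_max_right t 0))

theorem coe_killedSemigroup (hinv : ∀ t, 0 ≤ t → ∀ f ∈ CKill B a, Φ t f ∈ CKill B a) {t : ℝ}
    (ht : 0 ≤ t) (f : CKill B a) : (killedSemigroup Φ hinv t f : C₀(ℝ, B)) = Φ t f := by
  rw [killedSemigroup, coe_killedCLM, max_eq_left ht]

theorem isC0Semigroup_killedSemigroup (hΦ : IsC0Semigroup Φ)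
    (hinv : ∀ t, 0 ≤ t → ∀ f ∈ CKill B a, Φ t f ∈ CKill B a) :
    IsC0Semigroup (killedSemigroup Φ hinv) where
  zero := by
    ext1 f
    apply Subtype.ext
    rw [coe_killedSemigroup hinv le_rfl, hΦ.zero]
    rfl
  add s t hs ht := by
    ext1 f
    apply Subtype.ext
    rw [coe_killedSemigroup hinv (add_nonneg hs ht), hΦ.add s t hs ht,
      ContinuousLinearMap.comp_apply, ContinuousLinearMap.comp_apply, coe_killedSemigroup hinv hs,
      coe_killedSemigroup hinv ht]
  cont f := by
    rw [Topology.IsInducing.subtypeVal.continuousOn_iff]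
    exact (hΦ.cont f).congr fun t ht => coe_killedSemigroup hinv ht f

theorem mem_genGraph_killedSemigroup
    (hinv : ∀ t, 0 ≤ t → ∀ f ∈ CKill B a, Φ t f ∈ CKill B a) {f k : CKill B a} :
    (f, k) ∈ genGraph (killedSemigroup Φ hinv) ↔ ((f : C₀(ℝ, B)), (k : C₀(ℝ, B))) ∈ genGraph Φ := by
  refine Topology.IsInducing.subtypeVal.tendsto_nhds_iff.trans (tendsto_congr' ?_)
  filter_upwards [self_mem_nhdsWithin] with t ht
  simp [coe_killedSemigroup hinv (le_of_lt ht)]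

/-- The semigroup induced on `C_{kill(a)}([a,b], B)`. -/
noncomputable def killedIccSemigroup (Ψ : ℝ → CKill B a →L[ℝ] CKill B a) (hab : a ≤ b) (t : ℝ) :
    CKillIcc B a b →L[ℝ] CKillIcc B a b :=
  (restrictIcc B a b).comp ((Ψ t).comp (extendIcc B hab))

/-- `T f` restricted to `(-∞, b]` only depends on `f` restricted to `(-∞, b]`. -/
theorem apply_eq_of_eqOn_Iic {T : C₀(ℝ, B) →L[ℝ] C₀(ℝ, B)}
    (hT : ∀ f ∈ CKill B b, T f ∈ CKill B b) {f g : C₀(ℝ, B)} (hfg : ∀ x ≤ b, f x = g x) {x : ℝ}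
    (hx : x ≤ b) : T f x = T g x := by
  have h1 : f - g ∈ CKill B b := fun y hy => by
    rw [ZeroAtInftyContinuousMap.sub_apply, hfg y hy, sub_self]
  have h2 := hT _ h1 x hx
  rw [map_sub, ZeroAtInftyContinuousMap.sub_apply] at h2
  exact sub_eq_zero.1 h2

/-- Invariance of `CKill B b` means that the past of b determines the result up to b. The operator
thus descends to [a,b] whatever extension to the right is chosen. -/
theorem restrictIcc_killedCLM {T : C₀(ℝ, B) →L[ℝ] C₀(ℝ, B)} (hab : a ≤ b)
    (hT : ∀ f ∈ CKill B a, T f ∈ CKill B a) (hT' : ∀ f ∈ CKill B b, T f ∈ CKill B b)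
    (f : CKill B a) :
    restrictIcc B a b (killedCLM T hT (extendIcc B hab (restrictIcc B a b f))) =
      restrictIcc B a b (killedCLM T hT f) := by
  ext x
  exact apply_eq_of_eqOn_Iic hT' (fun y hy => extendIcc_restrictIcc hab f hy) x.2.2

theorem restrictIcc_killedSemigroup
    (hinv : ∀ a t, 0 ≤ t → ∀ f ∈ CKill B a, Φ t f ∈ CKill B a) (hab : a ≤ b) (t : ℝ)
    (f : CKill B a) :
    restrictIcc B a b (killedSemigroup Φ (hinv a) t f) =
      killedIccSemigroup (killedSemigroup Φ (hinv a)) hab t (restrictIcc B a b f) :=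
  (restrictIcc_killedCLM hab _ (hinv b _ (le_max_right t 0)) f).symm

theorem isC0Semigroup_killedIccSemigroup (hΦ : IsC0Semigroup Φ)
    (hinv : ∀ a t, 0 ≤ t → ∀ f ∈ CKill B a, Φ t f ∈ CKill B a) (hab : a ≤ b) :
    IsC0Semigroup (E := CKillIcc B a b)
      (killedIccSemigroup (killedSemigroup Φ (hinv a)) hab) := by
  have hK := isC0Semigroup_killedSemigroup hΦ (hinv a)
  refine ⟨?_, fun s t hs ht => ?_, fun f => ?_⟩
  · ext1 f
    simp only [killedIccSemigroup, hK.zero, ContinuousLinearMap.comp_apply,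
      ContinuousLinearMap.id_apply, restrictIcc_extendIcc]
  · ext1 f
    rw [ContinuousLinearMap.comp_apply]
    change restrictIcc B a b (killedSemigroup Φ (hinv a) (s + t) (extendIcc B hab f)) = _
    rw [hK.add s t hs ht, ContinuousLinearMap.comp_apply,
      restrictIcc_killedSemigroup hinv hab]
    rfl
  · exact (restrictIcc B a b).continuous.comp_continuousOn (hK.cont (extendIcc B hab f))

end KilledSemigroups

/-! ### The perturbed generator and pointwise resolvents -/

section Resolvents

variable {B D : Type*} [NormedAddCommGroup B] [NormedSpace ℝ B] [CompleteSpace B]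
  [NormedAddCommGroup D] [NormedSpace ℝ D] {j : D →L[ℝ] B} {A : ℝ → D →L[ℝ] B}
  {S : ℝ → ℝ → B →L[ℝ] B} {U : ℝ → ℝ → D →L[ℝ] D} {M m c : ℝ}
  {ν : Measure ℝ} [IsFiniteMeasure ν] {Φ : ℝ → C₀(ℝ, B) →L[ℝ] C₀(ℝ, B)} {a b : ℝ}

/-- The resolvent of the pointwise semigroup acts pointwise. -/
theorem RegularFamily.exists_resolvent (h : RegularFamily j A S U)
    (hg : ∀ x, HasGrowth (S x) M m) (hc : m < c) :
    ∃ (R : C₀(ℝ, B) →L[ℝ] C₀(ℝ, B)) (r : ℝ → B →L[ℝ] B),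
      (∀ u, IntegrableOn (fun t => Real.exp (-c * t) • h.mult (max t 0) u) (Ioi 0) ∧
        R u = ∫ t in Ioi (0 : ℝ), Real.exp (-c * t) • h.mult (max t 0) u) ∧
      (∀ u, (R u, c • R u - u) ∈ genGraph h.mult) ∧
      (∀ u x, R u x = r x (u x)) ∧ (∀ x, IsResolvent (S x) c (r x)) ∧
      ∀ x v, ‖r x v‖ ≤ M / (c - m) * ‖v‖ := by
  obtain ⟨R, hR1, hR2, -⟩ := _root_.exists_resolvent h.isC0Semigroup_mult
    (hasGrowth_multSemigroup h.isBoundedStronglyContinuous hg) hc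
  choose r hr1 _ hr3 using fun x => _root_.exists_resolvent (h.semigroup x) (hg x) hc
  refine ⟨R, r, fun u => ⟨(hR1 u).1, (hR1 u).2.1⟩, hR2, fun u x => ?_, hr3,
    fun x v => (hr1 x v).2.2⟩
  have h3 := genGraph_map (evalCLM B x)
    (evalCLM_multSemigroup h.isBoundedStronglyContinuous x) (hR2 u)
  exact (hr3 x (u x) (R u x)).1 h3

-- R acts at each point separately and ignores the weight, so each factor R N costs L times the
-- Laplace mass.
omit [CompleteSpace B] in
theorem norm_pow_apply_le {R : C₀(ℝ, B) →L[ℝ] C₀(ℝ, B)} {r : ℝ → B →L[ℝ] B}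
    (hRr : ∀ u x, R u x = r x (u x)) {L : ℝ} (hL : 0 ≤ L) (hr : ∀ x v, ‖r x v‖ ≤ L * ‖v‖)
    (hν : ν (Iic 0) = 0) {θ C : ℝ} (hθ : 0 ≤ θ) {f : C₀(ℝ, B)}
    (hf : ∀ x, ‖f x‖ ≤ C * Real.exp (θ * x)) (n : ℕ) :
    ∀ x, ‖((R * jumpCLM B ν) ^ n) f x‖ ≤ (L * laplaceMass ν θ) ^ n * C * Real.exp (θ * x) := by
  induction n with
  | zero => intro x; simpa using hf x
  | succ n ih =>
    intro x
    rw [pow_succ', mul_apply_eq_comp, mul_apply_eq_comp, hRr]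
    refine (hr x _).trans ((mul_le_mul_of_nonneg_left
      (norm_jumpCLM_apply_le hν hθ ih x) hL).trans_eq ?_)
    ring

-- The weight e^{θ(x-a)} is at least 1 for x ≥ a and irrelevant where f vanishes; this is where
-- killing at a makes growing weights admissible.
omit [CompleteSpace B] in
theorem CKill.norm_apply_le {f : C₀(ℝ, B)} (hf : f ∈ CKill B a) {θ : ℝ} (hθ : 0 ≤ θ) (x : ℝ) :
    ‖f x‖ ≤ ‖f‖ * Real.exp (-θ * a) * Real.exp (θ * x) := by
  rcases le_total x a with hx | hx
  · rw [hf x hx, norm_zero]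
    positivity
  · rw [mul_assoc, ← Real.exp_add]
    refine (f.norm_apply_le x).trans (le_mul_of_one_le_right (norm_nonneg f) ?_)
    rw [Real.one_le_exp_iff]
    nlinarith

omit [CompleteSpace B] in
/-- The pointwise resolvent equation as a fixed point equation. -/
theorem mem_genGraph_iff_fixedPoint {lam K : ℝ} {T : ℝ → B →L[ℝ] B} {r : B →L[ℝ] B}
    (hr : IsResolvent T (lam + K) r) (v w g : B) :
    (v, lam • v - g - (w - K • v)) ∈ genGraph T ↔ v = r w + r g := by
  rw [← map_add, ← hr (w + g) v]
  have : lam • v - g - (w - K • v) = (lam + K) • v - (w + g) := by module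
  rw [this]

/-- The semigroup generated by `L'_ν + A(·)`: first order expansion and invariant subspaces. -/
structure IsLevyPerturbation (h : RegularFamily j A S U) (ν : Measure ℝ) [IsFiniteMeasure ν]
    (Φ : ℝ → C₀(ℝ, B) →L[ℝ] C₀(ℝ, B)) : Prop where
  semigroup : IsC0Semigroup Φ
  expansion : ∀ f, Tendsto (fun t : ℝ => t⁻¹ • (Φ t f - h.mult t f)) (𝓝[>] 0) (𝓝 (levyCLM B ν f))
  invariant : ∀ a t, 0 ≤ t → ∀ f ∈ CKill B a, Φ t f ∈ CKill B a

theorem RegularFamily.exists_levyPerturbation (h : RegularFamily j A S U) (hν : ν (Iic 0) = 0) :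
    ∃ Φ, IsLevyPerturbation h ν Φ := by
  obtain ⟨M, m, hg⟩ := exists_growth h.semigroup h.bounded
  obtain ⟨Φ, h1, h2, h3⟩ := exists_perturbation h.isC0Semigroup_mult
    (hasGrowth_multSemigroup h.isBoundedStronglyContinuous hg) (levyCLM B ν)
  refine ⟨Φ, h1, h2, fun a => h3 _ (isClosed_CKill a) (fun t _ f hf x hx => ?_)
    fun f hf => levyCLM_mem_CKill hν hf⟩
  rw [multSemigroup_apply, hf x hx, map_zero]

namespace IsLevyPerturbation

variable {h : RegularFamily j A S U}

/-- This equates the generator sense of a solution with the pointwise sense. -/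
theorem mem_genGraph (hΦ : IsLevyPerturbation h ν Φ) {f k : C₀(ℝ, B)} :
    (f, k) ∈ genGraph Φ ↔ ∀ x, (f x, k x - levyCLM B ν f x) ∈ genGraph (S x) := by
  obtain ⟨M, m, hg⟩ := exists_growth h.semigroup h.bounded
  rw [mem_genGraph_perturbation (hΦ.expansion f)]
  exact mem_genGraph_mult h.isC0Semigroup_mult h.semigroup hg

theorem mem_genGraph_killed (hΦ : IsLevyPerturbation h ν Φ) {f k : CKill B a} :
    (f, k) ∈ genGraph (killedSemigroup Φ (hΦ.invariant a)) ↔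
      ∀ x, ((f : C₀(ℝ, B)) x, (k : C₀(ℝ, B)) x - levyCLM B ν f x) ∈ genGraph (S x) := by
  rw [mem_genGraph_killedSemigroup, hΦ.mem_genGraph]

/-- Evaluation at x gives one direction. For the other, `extendIcc B hab f` need not lie in the
domain on the half-line, so a different extension of f that does is produced with the pointwise
resolvent and then pushed down by restriction. -/
theorem mem_genGraph_killedIcc (hΦ : IsLevyPerturbation h ν Φ) (hν : ν (Iic 0) = 0) (hab : a ≤ b)
    {f k : CKillIcc B a b} :
    (f, k) ∈ genGraph (E := CKillIcc B a b)
        (killedIccSemigroup (killedSemigroup Φ (hΦ.invariant a)) hab) ↔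
      ∀ x : Icc a b, ((extendIcc B hab f : C₀(ℝ, B)) x, (k : C(Icc a b, B)) x -
        levyCLM B ν (extendIcc B hab f : C₀(ℝ, B)) x) ∈ genGraph (S x) := by
  constructor
  · intro hf x
    let e : CKillIcc B a b → B := fun u => (u : C(Icc a b, B)) x
    have he : Continuous e := (continuous_eval_const x).comp continuous_subtype_val
    have h1 := (he.tendsto k).comp (show Tendsto _ _ _ from hf)
    have h2 := ((evalCLM B (x : ℝ)).continuous.tendsto _).comp
      (hΦ.expansion (extendIcc B hab f : C₀(ℝ, B)))
    refine (h1.sub h2).congr' ?_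
    filter_upwards [self_mem_nhdsWithin] with t ht
    have ht0 : (0 : ℝ) < t := ht
    have h3 : (e (t⁻¹ • (killedIccSemigroup (killedSemigroup Φ (hΦ.invariant a)) hab t f - f))) =
        t⁻¹ • ((killedSemigroup Φ (hΦ.invariant a) t (extendIcc B hab f) : C₀(ℝ, B)) x -
          (f : C(Icc a b, B)) x) := rfl
    have h4 : evalCLM B (x : ℝ) (t⁻¹ • (Φ t (extendIcc B hab f : C₀(ℝ, B)) -
        h.mult t (extendIcc B hab f : C₀(ℝ, B)))) = t⁻¹ • (Φ t (extendIcc B hab f : C₀(ℝ, B)) x -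
        S x (max t 0) ((extendIcc B hab f : C₀(ℝ, B)) x)) := rfl
    simp only [Function.comp_apply]
    rw [h3, h4, coe_killedSemigroup _ ht0.le, ← smul_sub, max_eq_left ht0.le, extendIcc_apply]
    congr 1
    abel
  · intro hf
    obtain ⟨M, m, hg⟩ := exists_growth h.semigroup h.bounded
    obtain ⟨R, r, -, hRg, hRr, hr, -⟩ := h.exists_resolvent hg (lt_add_one m)
    set c := m + 1
    set L : CKill B a →L[ℝ] CKill B a :=
      killedCLM (levyCLM B ν) fun f hf => levyCLM_mem_CKill hν hf with hL
    -- u is the datum whose pointwise resolvent is f on [a,b]; resolving an extension of u gives the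
    -- extension p of f in the domain.
    set u : CKillIcc B a b := c • f - (k - restrictIcc B a b (L (extendIcc B hab f))) with hu
    have hRK : ∀ f ∈ CKill B a, R f ∈ CKill B a := fun f hf x hx => by
      rw [hRr, hf x hx, map_zero]
    set p : CKill B a := killedCLM R hRK (extendIcc B hab u) with hp
    have hpf : restrictIcc B a b p = f := by
      ext x
      have h1 : (u : C(Icc a b, B)) x = c • (extendIcc B hab f : C₀(ℝ, B)) x -
          ((k : C(Icc a b, B)) x - levyCLM B ν (extendIcc B hab f : C₀(ℝ, B)) x) := by
        rw [extendIcc_apply]; rfl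
      have h2 := (hr x ((u : C(Icc a b, B)) x) ((extendIcc B hab f : C₀(ℝ, B)) x)).1 (by
        rw [h1, sub_sub_cancel]; exact hf x)
      rw [extendIcc_apply] at h2
      rw [h2, restrictIcc_apply, hp, coe_killedCLM, hRr, extendIcc_apply]
    have hLp : restrictIcc B a b (L p) = restrictIcc B a b (L (extendIcc B hab f)) := by
      rw [← hpf, hL, restrictIcc_killedCLM hab _ fun f hf => levyCLM_mem_CKill hν hf]
    have h1 : (p, c • p - extendIcc B hab u + L p) ∈
        genGraph (killedSemigroup Φ (hΦ.invariant a)) := by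
      rw [mem_genGraph_killedSemigroup, mem_genGraph_perturbation (hΦ.expansion _)]
      have h2 := hRg (extendIcc B hab u : C₀(ℝ, B))
      have h3 : ((c • p - extendIcc B hab u + L p : CKill B a) : C₀(ℝ, B)) - levyCLM B ν p =
          c • R (extendIcc B hab u) - extendIcc B hab u := add_sub_cancel_right _ _
      rw [h3]
      exact h2
    have h2 := genGraph_map (F := CKillIcc B a b)
      (U := killedIccSemigroup (killedSemigroup Φ (hΦ.invariant a)) hab)
      (restrictIcc B a b)
      (fun t _ f => restrictIcc_killedSemigroup hΦ.invariant hab t f) h1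
    rw [map_add, map_sub, map_smul, hpf, restrictIcc_extendIcc, hLp] at h2
    convert h2 using 2
    rw [hu]
    abel

end IsLevyPerturbation

end Resolvents

open ZeroAtInftyContinuousMap

/-! ### Core, resolvents and classical solutions for the perturbed semigroup -/

section LevyPerturbation

variable {B D : Type*} [NormedAddCommGroup B] [NormedSpace ℝ B] [CompleteSpace B]
  [NormedAddCommGroup D] [NormedSpace ℝ D] {j : D →L[ℝ] B} {A : ℝ → D →L[ℝ] B}
  {S : ℝ → ℝ → B →L[ℝ] B} {U : ℝ → ℝ → D →L[ℝ] D} {M m lam θ : ℝ}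
  {ν : Measure ℝ} [IsFiniteMeasure ν] {Φ : ℝ → C₀(ℝ, B) →L[ℝ] C₀(ℝ, B)} {a b : ℝ}

/-- Subtracting a bounded operator in the second component maps the graph of an operator to the
graph of its perturbation. -/
noncomputable def graphShear {E : Type*} [NormedAddCommGroup E] [NormedSpace ℝ E]
    (L : E →L[ℝ] E) : E × E ≃ₜ E × E where
  toFun p := (p.1, p.2 - L p.1)
  invFun p := (p.1, p.2 + L p.1)
  left_inv p := by simp
  right_inv p := by simp
  continuous_toFun := by fun_prop
  continuous_invFun := by fun_prop

/-- Adding a bounded operator shears the graph by a homeomorphism, so a core of the pointwise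
generator remains a core. -/
theorem IsLevyPerturbation.isGeneratedByLevyPlus {D' : Type*} [CompleteSpace D]
    [NormedAddCommGroup D'] [NormedSpace ℝ D'] [CompleteSpace D'] {κ : D' →L[ℝ] D}
    {A' : ℝ → D' →L[ℝ] D} {SD' : ℝ → ℝ → D' →L[ℝ] D'} (hspaces : ThreeSpaces j κ)
    (hA : GeneratingFamily j κ A A' S U SD')
    (hΦ : IsLevyPerturbation (hA.regularFamily_big hspaces) ν Φ) :
    IsGeneratedByLevyPlus ν j A Φ := by
  have h1 : genGraph Φ = graphShear (levyCLM B ν) ⁻¹'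
      genGraph (hA.regularFamily_big hspaces).mult := by
    ext ⟨f, k⟩
    exact mem_genGraph_perturbation (hΦ.expansion f) k
  have h2 : genGraph (hA.regularFamily_big hspaces).mult = _ := hA.genGraph_mult hspaces
  rw [IsGeneratedByLevyPlus, h1, h2, Homeomorph.preimage_closure]
  congr 1
  ext ⟨f, k⟩
  refine exists_congr fun F => and_congr_right fun _ => forall_congr' fun x => ?_
  change k x - levyCLM B ν f x = _ ↔ k x = _
  rw [levyOp_eq, ← levyCLM_apply, sub_eq_iff_eq_add']

-- For B ≠ 0 the identity at t = 0 forces M ≥ 1, so M times the Laplace mass drops strictly for θ =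
-- 1 and leaves slack at the endpoint. Under strict inequality θ = 0 suffices. For B = 0 the given M
-- may be smaller than 1, but any constants serve.
omit [CompleteSpace B] in
theorem exists_growth_of_le (hS : IsC0Semigroup (S 0)) (hν : ν (Iic 0) = 0)
    (hg : ∀ x, HasGrowth (S x) M m) (hle : m + ν.real univ * (M - 1) ≤ lam)
    (hlt : ν ≠ 0 ∨ m + ν.real univ * (M - 1) < lam) :
    ∃ M m θ, 0 ≤ θ ∧ (∀ x, HasGrowth (S x) M m) ∧ m + M * laplaceMass ν θ < lam + ν.real univ := by
  rcases subsingleton_or_nontrivial B with hB | hB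
  · refine ⟨1, lam - 1, 0, le_rfl, fun x t _ => ?_, by rw [laplaceMass_zero]; linarith⟩
    rw [Subsingleton.elim (S x t) 0, norm_zero]
    positivity
  · rcases hlt with h0 | hlt
    · have hM : 1 ≤ M := by
        have := hg 0 0 le_rfl
        rw [hS.zero, ContinuousLinearMap.norm_id] at this
        simpa using this
      have := mul_lt_mul_of_pos_left (laplaceMass_lt hν h0 one_pos) (one_pos.trans_le hM)
      exact ⟨M, m, 1, zero_le_one, hg, by linarith⟩
    · exact ⟨M, m, 0, le_rfl, hg, by rw [laplaceMass_zero]; linarith⟩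

namespace IsLevyPerturbation

variable {h : RegularFamily j A S U}

theorem exists_resolvent_killed (hΦ : IsLevyPerturbation h ν Φ) (hν : ν (Iic 0) = 0)
    (hg : ∀ x, HasGrowth (S x) M m) (hlam : m + M * laplaceMass ν 0 < lam + ν.real univ) :
    ∃ R : CKill B a →L[ℝ] CKill B a,
      IsResolvent (killedSemigroup Φ (hΦ.invariant a)) lam R ∧
      (∀ (g : CKill B a) (x : ℝ),
        IsLaplacePathIntegral ν S lam (g : C₀(ℝ, B)) x ((R g : C₀(ℝ, B)) x)) ∧
      ∀ g μ : CKill B a,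
        SolvesRL ν S a lam (Ici a) (g : C₀(ℝ, B)) (μ : C₀(ℝ, B)) ↔ μ = R g := by
  have hM := (hg 0).nonneg
  have hK := laplaceMass_nonneg ν 0
  set c := lam + ν.real univ with hc
  have hmc : m < c := (le_add_of_nonneg_right (mul_nonneg hM hK)).trans_lt hlam
  obtain ⟨P, r, hP, -, hPr, hr, hL⟩ := h.exists_resolvent hg hmc
  set L := M / (c - m) with hLdef
  have hL0 : 0 ≤ L := div_nonneg hM (sub_pos.2 hmc).le
  -- With L = M / (c - m) this is `hlam` rearranged.
  have hq : L * laplaceMass ν 0 < 1 := by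
    rw [hLdef, div_mul_eq_mul_div, div_lt_one (sub_pos.2 hmc)]
    linarith
  have hPK : ∀ f ∈ CKill B a, P f ∈ CKill B a := fun f hf x hx => by rw [hPr, hf x hx, map_zero]
  have hQK : ∀ f ∈ CKill B a, (P * jumpCLM B ν) f ∈ CKill B a := fun f hf =>
    hPK _ (jumpCLM_mem_CKill hν hf)
  have hs : ∀ (n : ℕ) (f : CKill B a), ‖(killedCLM (P * jumpCLM B ν) hQK ^ n) f‖ ≤
      (L * laplaceMass ν 0) ^ n * 1 * ‖f‖ := by
    intro n f
    refine norm_le_of_forall (by positivity) fun x => ?_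
    have h1 := norm_pow_apply_le hPr hL0 hL hν le_rfl (CKill.norm_apply_le f.2 le_rfl) n x
    rw [← coe_killedCLM_pow _ hQK] at h1
    simpa using h1
  obtain ⟨R, hR1, hR2⟩ := exists_neumann (res := .id ℝ (CKill B a)) (ext := .id ℝ (CKill B a))
    (fun _ => rfl) (fun _ => rfl) (killedCLM P hPK) zero_le_one (mul_nonneg hL0 hK) hq hs
  have hkey : ∀ g μ : CKill B a, (∀ x, ((μ : C₀(ℝ, B)) x, lam • (μ : C₀(ℝ, B)) x -
      (g : C₀(ℝ, B)) x - levyCLM B ν μ x) ∈ genGraph (S x)) ↔ μ = R g := by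
    intro g μ
    rw [hR1, Subtype.ext_iff, DFunLike.ext_iff]
    refine forall_congr' fun x => ?_
    rw [levyCLM_apply, mem_genGraph_iff_fixedPoint (hr x)]
    change _ ↔ (μ : C₀(ℝ, B)) x = P (jumpCLM B ν μ) x + P g x
    rw [hPr, hPr]
  refine ⟨R, fun g μ => ?_, fun g x => ?_, fun g μ => ?_⟩
  · rw [hΦ.mem_genGraph_killed, ← hkey]
    rfl
  · refine h.isLaplacePathIntegral hg hν le_rfl (CKill.norm_apply_le g.2 le_rfl) hlam hP ?_
    have h1 := (hR2 g).mapL ((evalCLM B x).comp (CKill B a).subtypeL)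
    refine h1.congr_fun fun n => ?_
    change _ = ((killedCLM (P * jumpCLM B ν) hQK ^ n) (killedCLM P hPK g) : C₀(ℝ, B)) x
    rw [coe_killedCLM_pow, coe_killedCLM]
  · rw [← hkey]
    have h1 : ∀ x, a ≤ x → lam • (μ : C₀(ℝ, B)) x + derivRL ν a (μ : C₀(ℝ, B)) x -
        (g : C₀(ℝ, B)) x = lam • (μ : C₀(ℝ, B)) x - (g : C₀(ℝ, B)) x - levyCLM B ν μ x := by
      intro x hx
      rw [derivRL_eq hν μ.2 hx fun _ _ => rfl]
      abel
    refine ⟨fun h2 x => ?_, fun h2 => ⟨μ.2 a le_rfl, fun x hx => ?_⟩⟩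
    -- To the left of a every term vanishes, so the equation on [a,∞) already gives it on ℝ.
    · rcases le_total x a with hx | hx
      · rw [μ.2 x hx, g.2 x hx, levyCLM_mem_CKill hν μ.2 x hx]
        simp [genGraph]
      · rw [← h1 x hx]
        exact h2.2 x hx
    · rw [h1 x hx]
      exact h2 x

theorem exists_resolvent_killedIcc (hΦ : IsLevyPerturbation h ν Φ) (hν : ν (Iic 0) = 0)
    (hg : ∀ x, HasGrowth (S x) M m) (hθ : 0 ≤ θ)
    (hlam : m + M * laplaceMass ν θ < lam + ν.real univ) (hab : a ≤ b) :
    ∃ R : CKillIcc B a b →L[ℝ] CKillIcc B a b,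
      IsResolvent (E := CKillIcc B a b)
        (killedIccSemigroup (killedSemigroup Φ (hΦ.invariant a)) hab) lam R ∧
      (∀ (g : CKillIcc B a b) (x : Icc a b),
        IsLaplacePathIntegral ν S lam (extendZero (g : C(Icc a b, B))) x
          ((R g : C(Icc a b, B)) x)) ∧
      ∀ g μ : CKillIcc B a b, SolvesRL ν S a lam (Icc a b) (extendZero (g : C(Icc a b, B)))
        (extendZero (μ : C(Icc a b, B))) ↔ μ = R g := by
  have hM := (hg 0).nonneg
  have hK := laplaceMass_nonneg ν θ
  set c := lam + ν.real univ with hc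
  have hmc : m < c := (le_add_of_nonneg_right (mul_nonneg hM hK)).trans_lt hlam
  obtain ⟨P, r, hP, -, hPr, hr, hL⟩ := h.exists_resolvent hg hmc
  set L := M / (c - m) with hLdef
  have hL0 : 0 ≤ L := div_nonneg hM (sub_pos.2 hmc).le
  have hq : L * laplaceMass ν θ < 1 := by
    rw [hLdef, div_mul_eq_mul_div, div_lt_one (sub_pos.2 hmc)]
    linarith
  have hPK : ∀ a, ∀ f ∈ CKill B a, P f ∈ CKill B a := fun a f hf x hx => by
    rw [hPr, hf x hx, map_zero]
  have hQK : ∀ a, ∀ f ∈ CKill B a, (P * jumpCLM B ν) f ∈ CKill B a := fun a f hf =>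
    hPK a _ (jumpCLM_mem_CKill hν hf)
  -- The constant e^{θ(b-a)} compares the weighted norm with the sup norm on [a,b]; it is finite
  -- because b is.
  have hs : ∀ (n : ℕ) (f : CKillIcc B a b),
      ‖restrictIcc B a b ((killedCLM (P * jumpCLM B ν) (hQK a) ^ n) (extendIcc B hab f))‖ ≤
        (L * laplaceMass ν θ) ^ n *
          (Real.exp (-θ * a) * Real.exp (θ * b)) * ‖f‖ := by
    intro n f
    refine (ContinuousMap.norm_le _ (by positivity)).2 fun x => ?_
    have h1 := norm_pow_apply_le hPr hL0 hL hν hθ (CKill.norm_apply_le (extendIcc B hab f).2 hθ) n x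
    rw [← coe_killedCLM_pow _ (hQK a)] at h1
    refine h1.trans ?_
    have h2 := norm_extendIcc_le hab f
    have h3 : Real.exp (θ * x) ≤ Real.exp (θ * b) :=
      Real.exp_le_exp.2 (mul_le_mul_of_nonneg_left x.2.2 hθ)
    calc _ ≤ (L * laplaceMass ν θ) ^ n * (‖f‖ * Real.exp (-θ * a)) *
          Real.exp (θ * b) := by gcongr
      _ = _ := by ring
  have hneumann := @exists_neumann (CKill B a) (CKillIcc B a b) _ _ _ _ _ (restrictIcc B a b)
    (extendIcc B hab) (restrictIcc_extendIcc hab) (killedCLM (P * jumpCLM B ν) (hQK a))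
  obtain ⟨R, hR1, hR2⟩ := hneumann (restrictIcc_killedCLM hab (hQK a) (hQK b))
    (killedCLM P (hPK a)) (C := Real.exp (-θ * a) * Real.exp (θ * b)) (q := L * laplaceMass ν θ)
    (by positivity) (mul_nonneg hL0 hK) hq hs
  have hkey : ∀ g μ : CKillIcc B a b, (∀ x : Icc a b, ((extendIcc B hab μ : C₀(ℝ, B)) x,
      lam • (extendIcc B hab μ : C₀(ℝ, B)) x - (extendIcc B hab g : C₀(ℝ, B)) x -
        levyCLM B ν (extendIcc B hab μ : C₀(ℝ, B)) x) ∈ genGraph (S x)) ↔ μ = R g := by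
    intro g μ
    rw [hR1, Subtype.ext_iff, DFunLike.ext_iff]
    refine forall_congr' fun x => ?_
    rw [levyCLM_apply, mem_genGraph_iff_fixedPoint (hr x), extendIcc_apply hab μ]
    change _ ↔ (μ : C(Icc a b, B)) x = P (jumpCLM B ν (extendIcc B hab μ : C₀(ℝ, B))) x +
      P (extendIcc B hab g : C₀(ℝ, B)) x
    rw [hPr, hPr]
  have hzero : ∀ (μ : CKillIcc B a b), ∀ x ≤ b, extendZero (μ : C(Icc a b, B)) x =
      (extendIcc B hab μ : C₀(ℝ, B)) x := fun μ x hx => extendZero_eq_extendIcc hab μ hx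
  refine ⟨R, fun g μ => ?_, fun g x => ?_, fun g μ => ?_⟩
  · rw [hΦ.mem_genGraph_killedIcc hν hab, ← hkey]
    refine forall_congr' fun x => ?_
    rw [extendIcc_apply hab g, extendIcc_apply hab μ]
    rfl
  -- The two extensions of g differ only to the right of b, where no path started at x ≤ b arrives.
  · refine (h.isLaplacePathIntegral hg hν hθ (CKill.norm_apply_le (extendIcc B hab g).2 hθ) hlam hP
      ?_).congr hν fun y hy => (hzero g y (hy.trans x.2.2)).symm
    have h1 := ContinuousMap.hasSum_apply ((hR2 g).mapL (CKillIcc B a b).subtypeL) x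
    refine h1.congr_fun fun n => ?_
    change _ = ((killedCLM (P * jumpCLM B ν) (hQK a) ^ n)
      (killedCLM P (hPK a) (extendIcc B hab g)) : C₀(ℝ, B)) x
    rw [coe_killedCLM_pow, coe_killedCLM]
  · rw [← hkey]
    have h0 : extendZero (μ : C(Icc a b, B)) a = 0 := by
      rw [hzero μ a hab]
      exact (extendIcc B hab μ).2 a le_rfl
    rw [SolvesRL, and_iff_right h0, Subtype.forall]
    refine forall₂_congr fun x hx => ?_
    rw [derivRL_eq hν (extendIcc B hab μ).2 hx.1 fun y hy => hzero μ y (hy.2.trans hx.2),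
      hzero μ x hx.2, hzero g x hx.2, sub_right_comm, sub_eq_add_neg _ (levyCLM B ν _ x)]

end IsLevyPerturbation

end LevyPerturbation

/-! ### The main theorem -/

theorem mainTheorem10 {B D D' : Type*}
    [NormedAddCommGroup B] [NormedSpace ℝ B] [CompleteSpace B]
    [NormedAddCommGroup D] [NormedSpace ℝ D] [CompleteSpace D]
    [NormedAddCommGroup D'] [NormedSpace ℝ D'] [CompleteSpace D']
    (ι : D →L[ℝ] B) (κ : D' →L[ℝ] D) (hspaces : ThreeSpaces ι κ)
    (A : ℝ → D →L[ℝ] B) (A' : ℝ → D' →L[ℝ] D)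
    (S : ℝ → ℝ → B →L[ℝ] B) (SD : ℝ → ℝ → D →L[ℝ] D) (SD' : ℝ → ℝ → D' →L[ℝ] D')
    (hA : GeneratingFamily ι κ A A' S SD SD')
    (ν : Measure ℝ) [IsFiniteMeasure ν] (hν : ν (Iic 0) = 0) :
    -- the semigroup generated by `L'_ν + A(·)` in `C_∞(ℝ, B)`
    ∃ Φ : ℝ → C₀(ℝ, B) →L[ℝ] C₀(ℝ, B),
      IsC0Semigroup Φ ∧ IsGeneratedByLevyPlus ν ι A Φ ∧
      ∀ a : ℝ,
        -- its restriction to `C_{kill(a)}([a,∞), B)`, and the resolvent there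
        (∃ Φa : ℝ → CKill B a →L[ℝ] CKill B a,
          IsC0Semigroup Φa ∧
          (∀ t : ℝ, 0 ≤ t → ∀ f : CKill B a, (Φa t f : C₀(ℝ, B)) = Φ t f) ∧
          ∀ MB mB : ℝ, (∀ x t : ℝ, 0 ≤ t → ‖S x t‖ ≤ MB * Real.exp (t * mB)) →
          ∀ lam : ℝ, mB + ν.real univ * (MB - 1) < lam →
            ∃ R : CKill B a →L[ℝ] CKill B a,
              IsResolvent Φa lam R ∧
              (∀ (g : CKill B a) (x : ℝ),
                IsLaplacePathIntegral ν S lam (g : C₀(ℝ, B)) x ((R g : C₀(ℝ, B)) x)) ∧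
              ∀ g μ : CKill B a,
                SolvesRL ν S a lam (Ici a) (g : C₀(ℝ, B)) (μ : C₀(ℝ, B)) ↔ μ = R g) ∧
        -- the semigroup on `C_{kill(a)}([a,b], B)`, and the resolvent there
        ∀ b : ℝ, a < b →
          ∃ Φab : ℝ → CKillIcc B a b →L[ℝ] CKillIcc B a b,
            IsC0Semigroup Φab ∧
            (∀ t : ℝ, 0 ≤ t → ∀ (f : CKill B a) (f₀ : CKillIcc B a b),
              (∀ x : Icc a b, (f₀ : C(Icc a b, B)) x = (f : C₀(ℝ, B)) x) →
              ∀ x : Icc a b, (Φab t f₀ : C(Icc a b, B)) x = Φ t f x) ∧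
            (∀ MB mB : ℝ, (∀ x t : ℝ, 0 ≤ t → ‖S x t‖ ≤ MB * Real.exp (t * mB)) →
              ∀ lam : ℝ, mB + ν.real univ * (MB - 1) ≤ lam →
              (ν ≠ 0 ∨ mB + ν.real univ * (MB - 1) < lam) →
              ∃ R : CKillIcc B a b →L[ℝ] CKillIcc B a b,
                IsResolvent Φab lam R ∧
                (∀ (g : CKillIcc B a b) (x : Icc a b),
                  IsLaplacePathIntegral ν S lam (extendZero (g : C(Icc a b, B))) x
                    ((R g : C(Icc a b, B)) x)) ∧
                ∀ g μ : CKillIcc B a b,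
                  SolvesRL ν S a lam (Icc a b) (extendZero (g : C(Icc a b, B)))
                    (extendZero (μ : C(Icc a b, B))) ↔ μ = R g) ∧
            -- contraction semigroups: unique classical solution, with `lam = 0`
            ((∀ x t : ℝ, 0 ≤ t → ‖S x t‖ ≤ 1) → ν ≠ 0 →
              ∀ g : CKillIcc B a b, ∃ μ : CKillIcc B a b,
                (∀ x : Icc a b,
                  IsLaplacePathIntegral ν S 0 (extendZero (g : C(Icc a b, B))) x
                    ((μ : C(Icc a b, B)) x)) ∧
                (∀ h : CKillIcc B a b, (h, -g) ∈ genGraph Φab ↔ h = μ) ∧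
                ∀ h : CKillIcc B a b,
                  SolvesCaputo ν S a (Icc a b) (extendZero (g : C(Icc a b, B)))
                    (extendZero (h : C(Icc a b, B))) ↔ h = μ) := by
  have hB := hA.regularFamily_big hspaces
  obtain ⟨Φ, hΦ⟩ := hB.exists_levyPerturbation hν
  have hgrowth : ∀ MB mB : ℝ, (∀ x t : ℝ, 0 ≤ t → ‖S x t‖ ≤ MB * Real.exp (t * mB)) →
      ∀ x, HasGrowth (S x) MB mB := fun MB mB hS => hS
  refine ⟨Φ, hΦ.semigroup, hΦ.isGeneratedByLevyPlus hspaces hA, fun a => ⟨⟨_,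
    isC0Semigroup_killedSemigroup hΦ.semigroup (hΦ.invariant a),
    fun t ht f => coe_killedSemigroup _ ht f, fun MB mB hS lam hlam =>
      hΦ.exists_resolvent_killed hν (hgrowth MB mB hS) ?_⟩, fun b hab => ?_⟩⟩
  · rw [laplaceMass_zero]
    linarith
  have hres : ∀ MB mB : ℝ, (∀ x t : ℝ, 0 ≤ t → ‖S x t‖ ≤ MB * Real.exp (t * mB)) →
      ∀ lam : ℝ, mB + ν.real univ * (MB - 1) ≤ lam →
      (ν ≠ 0 ∨ mB + ν.real univ * (MB - 1) < lam) →
      ∃ R : CKillIcc B a b →L[ℝ] CKillIcc B a b,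
        IsResolvent (E := CKillIcc B a b)
          (killedIccSemigroup (killedSemigroup Φ (hΦ.invariant a)) hab.le) lam R ∧
        (∀ (g : CKillIcc B a b) (x : Icc a b),
          IsLaplacePathIntegral ν S lam (extendZero (g : C(Icc a b, B))) x
            ((R g : C(Icc a b, B)) x)) ∧
        ∀ g μ : CKillIcc B a b, SolvesRL ν S a lam (Icc a b) (extendZero (g : C(Icc a b, B)))
          (extendZero (μ : C(Icc a b, B))) ↔ μ = R g := fun MB mB hS lam hle hlt => by
    obtain ⟨M, m, θ, hθ, hg, hlam⟩ :=
      exists_growth_of_le (hA.semigroup_B 0) hν (hgrowth MB mB hS) hle hlt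
    exact hΦ.exists_resolvent_killedIcc hν hg hθ hlam hab.le
  refine ⟨_, isC0Semigroup_killedIccSemigroup hΦ.semigroup hΦ.invariant hab.le,
    fun t ht f f₀ hf x => ?_, hres, fun hS hν0 g => ?_⟩
  · have h1 : f₀ = restrictIcc B a b f := by
      ext y
      rw [hf y, restrictIcc_apply]
    rw [h1, ← restrictIcc_killedSemigroup hΦ.invariant hab.le, restrictIcc_apply,
      coe_killedSemigroup _ ht]
  -- With M = 1 and m = 0 the threshold is 0, and ν ≠ 0 admits the endpoint λ = 0.
  · obtain ⟨R, hR1, hR2, hR3⟩ := hres 1 0 (fun x t ht => by simpa using hS x t ht) 0 (by simp)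
      (.inl hν0)
    refine ⟨R g, hR2 g, fun h => ?_, fun h => ?_⟩
    · rw [← hR1 g h, zero_smul, zero_sub]
      exact Iff.rfl
    · rw [← hR3 g h]
      refine and_congr_right fun h0 => forall₂_congr fun x _ => ?_
      rw [derivCaputo_eq_derivRL h0, zero_smul, zero_add]
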